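/- **Setting.** Let $s>5/2$ and $S^1=\mathbb R/\mathbb Z$. For real $r$ let $H^r(S^1)$ be the Sobolev space of real functions on $S^1$, let $H_0^r(S^1)=\{f\in H^r(S^1): f(0)=0\}$ (for $r>1/2$), and let $H^r(S^1)/\mathbb R$ be the quotient by the constant functions, with classes $[\alpha]$. Let $\mathrm{Diff}_0^s(S^1)$ be the manifold of orientation-preserving $H^s$ diffeomorphisms $\varphi$ of $S^1$ with $\varphi(0)=0$; it is the open subset $\{\mathrm{id}+f : f\in H_0^s(S^1),\ 1+f_x>0\}$ of the affine space $\mathrm{id}+H_0^s(S^1)$. Put $K^s=\mathrm{Diff}_0^s(S^1)\times (H^{s-1}(S^1)/\mathbb R)$ (as a group, the semidirect product), with tangent spaces $H_0^s(S^1)\times(H^{s-1}(S^1)/\mathbb R)$. Write $\pi(\rho)=\rho-\int_{S^1}\rho\,dx$, which depends on $[\rho]$ only, and, for $f$ with $\int_{S^1}f\,dx=0$, let $$(A^{-1}f)(x)=-\int_0^x\!\int_0^y f(z)\,dz\,dy+x\int_{S^1}\!\int_0^y f(z)\,dz\,dy ,$$ the inverse of $A=-\partial_x^2$. The Christoffel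 map of $K^s$ is given at the identity by $$\Gamma_{(\mathrm{id},[0])}\bigl((u_1,[u_2]),(v_1,[v_2])\bigr)=-\tfrac12\begin{pmatrix}A^{-1}\partial_x\bigl(u_{1x}v_{1x}-\pi(u_2)\pi(v_2)\bigr)\\ \bigl[u_{1x}\pi(v_2)+v_{1x}\pi(u_2)\bigr]\end{pmatrix}$$ and elsewhere by right invariance, $\Gamma_{(\varphi,[\alpha])}(U,V)=\Gamma_{(\mathrm{id},[0])}(U\circ\varphi^{-1},V\circ\varphi^{-1})\circ\varphi$. A $C^2$-curve $(\varphi,[\alpha])$ in $K^s$ is a geodesic of the connection $\nabla_XY=DY\cdot X-\Gamma(Y,X)$ if $$(\varphi_{tt},[\alpha_{tt}])=\Gamma_{(\varphi,[\alpha])}\bigl((\varphi_t,[\alpha_t]),(\varphi_t,[\alpha_t])\bigr)\quad\text{for all } t .$$ **Proposition.** Let $s>5/2$, let $J\subset\mathbb R$ be an open interval, let $(\varphi,[\alpha]):J\to K^s$ be a $C^2$-curve, and define $(u,[\rho])=(\varphi_t\circ\varphi^{-1},[\alpha_t\circ\varphi^{-1}])$. Then $$(u,[\rho])\in C\bigl(J;H_0^s(S^1)\times(H^{s-1}(S^1)/\mathbb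 R)\bigr)\cap C^1\bigl(J;H_0^{s-1}(S^1)\times(H^{s-2}(S^1)/\mathbb R)\bigr),$$ and $(\varphi,[\alpha])$ is a geodesic on $J$ if and only if, for all $t\in J$, $$\begin{pmatrix}u_t+uu_x\\ \pi(\rho)_t\end{pmatrix}=\begin{pmatrix}-\tfrac12A^{-1}\partial_x\bigl(u_x^2-\pi(\rho)^2\bigr)\\ -(u\,\pi(\rho))_x\end{pmatrix},$$ where $u_t$ is the derivative in $H_0^{s-1}(S^1)$ and $\pi(\rho)_t$ the derivative in $H^{s-2}(S^1)$. -/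

import Mathlib

open Set

noncomputable section

namespace HunterSaxton

/-! Functions on the circle `S¹ = ℝ/ℤ` are identified with `1`-periodic functions on `ℝ`. -/

/-- The Fourier coefficients of a real-valued function on `S¹ = ℝ/ℤ`:
`fourierC f n = ∫₀¹ f(x) exp(-2πinx) dx`. -/
def fourierC (f : ℝ → ℝ) (n : ℤ) : ℂ :=
  fourierCoeffOn (zero_lt_one' ℝ) (fun x => (f x : ℂ)) n

theorem fourierC_eq (f : ℝ → ℝ) (n : ℤ) :
    fourierC f n
      = ∫ x in (0 : ℝ)..1, Complex.exp (-(2 * Real.pi * Complex.I * n * x)) * (f x : ℂ) := by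
  unfold fourierC
  rw [fourierCoeffOn_eq_integral]
  simp only [sub_zero, div_one, one_smul, smul_eq_mul]
  refine intervalIntegral.integral_congr fun x _ => ?_
  simp only [fourier_apply, neg_smul, AddCircle.toCircle_neg, Circle.coe_inv]
  have h := fourier_coe_apply (T := 1 - 0) (n := n) (x := x)
  rw [fourier_apply] at h
  rw [h, ← Complex.exp_neg]
  simp

theorem fourierC_add {f g : ℝ → ℝ} (hf : Continuous f) (hg : Continuous g) (n : ℤ) :
    fourierC (f + g) n = fourierC f n + fourierC g n := by
  simp only [fourierC_eq]
  rw [← intervalIntegral.integral_add]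
  · refine intervalIntegral.integral_congr fun x _ => ?_
    simp [mul_add]
  · exact Continuous.intervalIntegrable (by fun_prop) _ _
  · exact Continuous.intervalIntegrable (by fun_prop) _ _

theorem fourierC_smul (c : ℝ) (f : ℝ → ℝ) (n : ℤ) :
    fourierC (c • f) n = c • fourierC f n := by
  simp only [fourierC_eq]
  rw [← intervalIntegral.integral_smul]
  refine intervalIntegral.integral_congr fun x _ => ?_
  simp only [Pi.smul_apply, smul_eq_mul, Complex.ofReal_mul, Complex.real_smul]
  ring

/-- A continuous periodic function all of whose Fourier coefficients vanish is zero. -/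
theorem eq_zero_of_fourierC {f : ℝ → ℝ} (hf : Continuous f) (hp : Function.Periodic f 1)
    (h : ∀ n, fourierC f n = 0) : f = 0 := by
  have hp' : Function.Periodic (fun x => (f x : ℂ)) 1 := fun x => by simp [hp x]
  let F : C(AddCircle (1 : ℝ), ℂ) :=
    ⟨hp'.lift, continuous_coinduced_dom.mpr (Complex.continuous_ofReal.comp hf)⟩
  have hF : ∀ x : ℝ, F (x : AddCircle (1 : ℝ)) = (f x : ℂ) := fun x => rfl
  have h0 : ∀ n, fourierCoeff F n = 0 := by
    intro n
    rw [fourierCoeff_eq_intervalIntegral F n 0]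
    have := h n
    rw [fourierC_eq] at this
    have e : (∫ x in (0 : ℝ)..0 + 1, fourier (-n) (x : AddCircle (1 : ℝ)) • F x)
        = ∫ x in (0 : ℝ)..1, Complex.exp (-(2 * Real.pi * Complex.I * n * x)) * (f x : ℂ) := by
      rw [zero_add]
      refine intervalIntegral.integral_congr fun x _ => ?_
      simp only [fourier_coe_apply, hF, smul_eq_mul]
      congr 2
      push_cast
      ring
    rw [e, this, smul_zero]
  have hs : Summable (fourierCoeff F) := by
    have : fourierCoeff F = 0 := funext h0
    rw [this]
    exact summable_zero
  have hsum := hasSum_fourier_series_of_summable hs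
  have hsum' : HasSum (fun _ : ℤ => (0 : C(AddCircle (1 : ℝ), ℂ))) F := by
    have e : (fun n : ℤ => fourierCoeff F n • fourier (T := 1) n) = fun _ => 0 :=
      funext fun n => by rw [h0 n]; exact zero_smul ℂ (fourier n : C(AddCircle (1 : ℝ), ℂ))
    rwa [e] at hsum
  have hz : F = 0 := hsum'.unique hasSum_zero
  funext x
  have : F (x : AddCircle (1 : ℝ)) = 0 := by rw [hz]; rfl
  rw [hF] at this
  exact_mod_cast this

/-- The weighted Fourier coefficients `(1 + n²)^(r/2) f̂(n)`. -/
def weighted (r : ℝ) (f : ℝ → ℝ) (n : ℤ) : ℂ :=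
  ((1 + (n : ℝ) ^ 2) ^ (r / 2)) • fourierC f n

theorem weighted_add (r : ℝ) {f g : ℝ → ℝ} (hf : Continuous f) (hg : Continuous g) :
    weighted r (f + g) = weighted r f + weighted r g := by
  funext n
  simp [weighted, fourierC_add hf hg]

theorem weighted_smul (r c : ℝ) (f : ℝ → ℝ) : weighted r (c • f) = c • weighted r f := by
  funext n
  simp only [weighted, fourierC_smul, Pi.smul_apply]
  rw [smul_comm]

/-- The Sobolev space `H^r(S¹)` of real-valued functions on the circle, as a space of functions:
`f ∈ H^r` iff `∑ₙ (1 + n²)^r |f̂(n)|² < ∞`. It is used for `r > 1/2` only, where every class of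
`H^r(S¹) ⊆ L²(S¹)` has exactly one continuous representative, which is the one taken here. -/
def sobolevSubmodule (r : ℝ) : Submodule ℝ (ℝ → ℝ) where
  carrier := {f | Continuous f ∧ Function.Periodic f 1 ∧ Memℓp (weighted r f) 2}
  zero_mem' := by
    refine ⟨continuous_zero, fun _ => rfl, ?_⟩
    have : weighted r 0 = 0 := by
      have := weighted_smul r 0 0
      simpa using this
    rw [this]
    exact zero_memℓp
  add_mem' := by
    rintro f g ⟨hf, hf', hf''⟩ ⟨hg, hg', hg''⟩
    refine ⟨hf.add hg, hf'.add hg', ?_⟩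
    rw [weighted_add r hf hg]
    exact hf''.add hg''
  smul_mem' := by
    rintro c f ⟨hf, hf', hf''⟩
    refine ⟨hf.const_smul c, fun x => by simp [hf' x], ?_⟩
    rw [weighted_smul]
    exact hf''.const_smul c

/-- The Sobolev space `H^r(S¹)` as a type (see `sobolevSubmodule`). -/
def Hs (r : ℝ) : Type := sobolevSubmodule r

instance (r : ℝ) : AddCommGroup (Hs r) := inferInstanceAs (AddCommGroup (sobolevSubmodule r))

instance (r : ℝ) : Module ℝ (Hs r) := inferInstanceAs (Module ℝ (sobolevSubmodule r))

/-- The inclusion of `H^r(S¹)` in the space of functions. -/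
def Hs.toFun (r : ℝ) : Hs r →ₗ[ℝ] (ℝ → ℝ) := (sobolevSubmodule r).subtype

instance (r : ℝ) : CoeFun (Hs r) (fun _ => ℝ → ℝ) := ⟨fun f => Hs.toFun r f⟩

theorem Hs.toFun_injective (r : ℝ) : Function.Injective (Hs.toFun r) :=
  (sobolevSubmodule r).subtype_injective

/-- A function with the defining properties of `H^r(S¹)`, as an element of this space. -/
def Hs.mk {r : ℝ} (f : ℝ → ℝ) (hf : f ∈ sobolevSubmodule r) : Hs r := ⟨f, hf⟩

theorem Hs.mk_apply {r : ℝ} (f : ℝ → ℝ) (hf : f ∈ sobolevSubmodule r) :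
    (Hs.mk f hf : ℝ → ℝ) = f :=
  rfl

theorem Hs.mem {r : ℝ} (f : Hs r) :
    Continuous f ∧ Function.Periodic f 1 ∧ Memℓp (weighted r f) 2 := Subtype.property f

/-- The weighted Fourier transform `f ↦ ((1 + n²)^(r/2) f̂(n))ₙ`, from `H^r(S¹)` to `ℓ²(ℤ; ℂ)`. -/
def Hs.toLp (r : ℝ) : Hs r →ₗ[ℝ] lp (fun _ : ℤ => ℂ) 2 where
  toFun f := ⟨weighted r f, f.mem.2.2⟩
  map_add' f g := by
    apply Subtype.ext
    change weighted r (Hs.toFun r (f + g)) = weighted r f + weighted r g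
    rw [map_add, weighted_add r f.mem.1 g.mem.1]
  map_smul' c f := by
    apply Subtype.ext
    change weighted r (Hs.toFun r (c • f)) = c • weighted r f
    rw [map_smul, weighted_smul]

theorem Hs.toLp_injective (r : ℝ) : Function.Injective (Hs.toLp r) := by
  rw [injective_iff_map_eq_zero]
  intro f hf
  apply Hs.toFun_injective r
  rw [map_zero]
  refine eq_zero_of_fourierC f.mem.1 f.mem.2.1 fun n => ?_
  have h : weighted r f n = 0 := by
    exact congrArg (fun v : lp (fun _ : ℤ => ℂ) 2 => (v : ℤ → ℂ) n) hf
  have hpos : (0 : ℝ) < (1 + (n : ℝ) ^ 2) ^ (r / 2) := Real.rpow_pos_of_pos (by positivity) _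
  exact (smul_eq_zero.mp h).resolve_left hpos.ne'

/-- The Sobolev norm `‖f‖² = ∑ₙ (1 + n²)^r |f̂(n)|²` of `H^r(S¹)`. -/
instance (r : ℝ) : NormedAddCommGroup (Hs r) :=
  NormedAddCommGroup.induced (Hs r) (lp (fun _ : ℤ => ℂ) 2) (Hs.toLp r) (Hs.toLp_injective r)

instance (r : ℝ) : NormedSpace ℝ (Hs r) :=
  NormedSpace.induced ℝ (Hs r) (lp (fun _ : ℤ => ℂ) 2) (Hs.toLp r)

theorem weighted_memℓp_mono {q r : ℝ} (h : q ≤ r) {f : ℝ → ℝ} (hf : Memℓp (weighted r f) 2) :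
    Memℓp (weighted q f) 2 := by
  refine hf.mono' fun n => ?_
  simp only [weighted, norm_smul, Real.norm_eq_abs]
  refine mul_le_mul_of_nonneg_right ?_ (norm_nonneg _)
  rw [abs_of_nonneg (by positivity), abs_of_nonneg (by positivity)]
  exact Real.rpow_le_rpow_of_exponent_le (by nlinarith [sq_nonneg (n : ℝ)]) (by linarith)

theorem Hs.mem_of_le {q r : ℝ} (h : q ≤ r) (f : Hs r) : (f : ℝ → ℝ) ∈ sobolevSubmodule q :=
  ⟨f.mem.1, f.mem.2.1, weighted_memℓp_mono h f.mem.2.2⟩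

/-- The inclusion `H^r(S¹) → H^q(S¹)` for `q ≤ r`. -/
def Hs.incl {q r : ℝ} (h : q ≤ r) : Hs r →ₗ[ℝ] Hs q where
  toFun f := Hs.mk f (Hs.mem_of_le h f)
  map_add' f g := Hs.toFun_injective q (by
    rw [map_add (Hs.toFun q), Hs.mk_apply, Hs.mk_apply, Hs.mk_apply, map_add])
  map_smul' c f := Hs.toFun_injective q (by
    rw [map_smul (Hs.toFun q), Hs.mk_apply, Hs.mk_apply, map_smul]
    rfl)

theorem Hs.incl_apply {q r : ℝ} (h : q ≤ r) (f : Hs r) : (Hs.incl h f : ℝ → ℝ) = f :=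
  Hs.mk_apply _ _

/-- `H_0^r(S¹)`, the subspace of the functions in `H^r(S¹)` that vanish at `0`. -/
def H0 (r : ℝ) : Submodule ℝ (Hs r) :=
  LinearMap.ker ((LinearMap.proj (0 : ℝ)).comp (Hs.toFun r))

theorem mem_H0 {r : ℝ} (f : Hs r) : f ∈ H0 r ↔ f 0 = 0 := Iff.rfl

instance (r : ℝ) : CoeFun (H0 r) (fun _ => ℝ → ℝ) := ⟨fun f => Hs.toFun r f⟩

/-- The inclusion `H_0^r(S¹) → H_0^q(S¹)` for `q ≤ r`. -/
def H0.incl {q r : ℝ} (h : q ≤ r) : H0 r →ₗ[ℝ] H0 q :=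
  (Hs.incl h).restrict fun f hf => by
    rw [mem_H0] at hf ⊢
    rw [Hs.incl_apply, hf]

theorem const_mem (r c : ℝ) : (fun _ => c) ∈ sobolevSubmodule r := by
  refine ⟨continuous_const, fun _ => rfl, ?_⟩
  have key : ∀ n : ℤ, n ≠ 0 → fourierC (fun _ => c) n = 0 := by
    intro n hn
    rw [fourierC_eq, intervalIntegral.integral_mul_const]
    have hn' : -(2 * Real.pi * Complex.I * n : ℂ) ≠ 0 := by
      simp [Real.pi_ne_zero, hn]
    have := integral_exp_mul_complex (a := 0) (b := 1) hn'
    simp only [neg_mul] at this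
    rw [this]
    have h1 : Complex.exp (-(2 * Real.pi * Complex.I * n)) = 1 := by
      rw [Complex.exp_neg, inv_eq_one, Complex.exp_eq_one_iff]
      exact ⟨n, by ring⟩
    simp [h1]
  have hfin : (Function.support (weighted r fun _ => c)).Finite := by
    refine (finite_singleton (0 : ℤ)).subset fun n hn => ?_
    by_contra hne
    exact hn (by simp [weighted, key n hne])
  refine memℓp_gen ?_
  refine summable_of_hasFiniteSupport (hfin.subset fun n hn => ?_)
  intro h0
  exact hn (by simp [h0])

/-- The constant functions, as elements of `H^r(S¹)`. -/
def Hs.const (r : ℝ) : ℝ →ₗ[ℝ] Hs r where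
  toFun c := Hs.mk (fun _ => c) (const_mem r c)
  map_add' _ _ := Hs.toFun_injective r (by simp only [map_add, Hs.mk_apply]; rfl)
  map_smul' _ _ := Hs.toFun_injective r (by simp only [map_smul, Hs.mk_apply]; rfl)

theorem Hs.const_apply (r c : ℝ) : (Hs.const r c : ℝ → ℝ) = fun _ => c := Hs.mk_apply _ _

/-- The line of the constant functions in `H^r(S¹)`. -/
def constants (r : ℝ) : Submodule ℝ (Hs r) := LinearMap.range (Hs.const r)

instance (r : ℝ) : IsClosed ((constants r : Submodule ℝ (Hs r)) : Set (Hs r)) := by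
  have : FiniteDimensional ℝ (constants r) :=
    inferInstanceAs (FiniteDimensional ℝ (LinearMap.range (Hs.const r)))
  exact (constants r).closed_of_finiteDimensional

/-- The quotient `H^r(S¹)/ℝ`, with its quotient norm. -/
abbrev HsQ (r : ℝ) : Type := Hs r ⧸ constants r

/-- The class `[α] ∈ H^r(S¹)/ℝ` of `α ∈ H^r(S¹)`. -/
abbrev HsQ.mk {r : ℝ} (α : Hs r) : HsQ r := (constants r).mkQ α

/-- The inclusion `H^r(S¹)/ℝ → H^q(S¹)/ℝ` for `q ≤ r`. -/
def HsQ.incl {q r : ℝ} (h : q ≤ r) : HsQ r →ₗ[ℝ] HsQ q :=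
  (constants r).mapQ (constants q) (Hs.incl h) (by
    rintro _ ⟨c, rfl⟩
    refine ⟨c, Hs.toFun_injective q ?_⟩
    rw [Hs.incl_apply, Hs.const_apply, Hs.const_apply])

/-- `π(ρ) = ρ - ∫_{S¹} ρ dx`. -/
def meanFree (ρ : ℝ → ℝ) : ℝ → ℝ := fun x => ρ x - ∫ y in (0 : ℝ)..1, ρ y

/-- The mean value `∫_{S¹} ρ dx` as a linear functional on `H^r(S¹)`. -/
def Hs.mean (r : ℝ) : Hs r →ₗ[ℝ] ℝ where
  toFun ρ := ∫ y in (0 : ℝ)..1, ρ y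
  map_add' f g := by
    rw [map_add]
    exact intervalIntegral.integral_add (f.mem.1.intervalIntegrable _ _)
      (g.mem.1.intervalIntegrable _ _)
  map_smul' c f := by
    rw [map_smul]
    exact intervalIntegral.integral_smul c (Hs.toFun r f)

/-- The projection `π(ρ) = ρ - ∫_{S¹} ρ dx`, as a map `H^r(S¹)/ℝ → H^r(S¹)`. -/
def HsQ.proj (r : ℝ) : HsQ r →ₗ[ℝ] Hs r :=
  (constants r).liftQ (LinearMap.id - (Hs.const r).comp (Hs.mean r)) (by
    rintro _ ⟨c, rfl⟩
    have : Hs.mean r (Hs.const r c) = c := by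
      change (∫ y in (0 : ℝ)..1, Hs.const r c y) = c
      simp [Hs.const_apply]
    simp [this])

theorem HsQ.proj_mk {r : ℝ} (ρ : Hs r) :
    (HsQ.proj r (HsQ.mk ρ) : ℝ → ℝ) = meanFree ρ := by
  have h : HsQ.proj r (HsQ.mk ρ) = ρ - Hs.const r (Hs.mean r ρ) :=
    (constants r).liftQ_apply _ ρ
  rw [h, map_sub, Hs.const_apply]
  rfl

/-- The inverse of `A = -∂ₓ²`, on functions of zero mean:
`(A⁻¹f)(x) = -∫₀ˣ∫₀ʸ f(z) dz dy + x ∫_{S¹} ∫₀ʸ f(z) dz dy`. -/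
def Ainv (f : ℝ → ℝ) : ℝ → ℝ := fun x =>
  -(∫ y in (0 : ℝ)..x, ∫ z in (0 : ℝ)..y, f z) + x * ∫ y in (0 : ℝ)..1, ∫ z in (0 : ℝ)..y, f z

/-- The model space `H_0^s(S¹) × H^{s-1}(S¹)/ℝ` of `K^s`, which is also each tangent space. -/
abbrev Model (s : ℝ) : Type := H0 s × HsQ (s - 1)

/-- The lift `ℝ → ℝ`, `x ↦ x + f(x)`, of the circle map that is represented by `f ∈ H_0^s(S¹)`. -/
def lift {s : ℝ} (p : Model s) : ℝ → ℝ := fun x => x + p.1 x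

/-- The manifold `K^s = Diff_0^s(S¹) ⓢ (H^{s-1}(S¹)/ℝ)`, in its global chart. An orientation
preserving `H^s` diffeomorphism `φ` of the circle with `φ(0) = 0` is `φ(x) = x + f(x)` for exactly
one `f ∈ H_0^s(S¹)`, and the `f` that arise are those with `1 + f_x > 0` everywhere. Thus `K^s` is
the subset (open for `s > 3/2`) of the pairs `(f, [α])` in the model space with `1 + f_x > 0`. -/
def Ks (s : ℝ) : Set (Model s) := {p | ∀ x, 0 < deriv (lift p) x}

/-- Equality in the space of functions modulo constants. -/
def EqModConst (f g : ℝ → ℝ) : Prop := ∃ c : ℝ, ∀ x, f x = g x + c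

/-- The Christoffel map at the identity. Tangent vectors `(u₁, [u₂])` are given by representatives
`(u₁, u₂)`, and the second component of the result is a representative of a class modulo constants;
it depends on the classes `[u₂]`, `[v₂]` only. -/
def christoffelId (u v : (ℝ → ℝ) × (ℝ → ℝ)) : (ℝ → ℝ) × (ℝ → ℝ) :=
  (fun x => -(1 / 2) *
      Ainv (deriv fun y => deriv u.1 y * deriv v.1 y - meanFree u.2 y * meanFree v.2 y) x,
    fun x => -(1 / 2) * (deriv u.1 x * meanFree v.2 x + deriv v.1 x * meanFree u.2 x))

/-- The Christoffel map at `(φ, [α])`, by right invariance: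
`Γ_{(φ,[α])}(U, V) = Γ_{(id,[0])}(U ∘ φ⁻¹, V ∘ φ⁻¹) ∘ φ`. -/
def christoffel (φ : ℝ → ℝ) (U V : (ℝ → ℝ) × (ℝ → ℝ)) : (ℝ → ℝ) × (ℝ → ℝ) :=
  let ψ := Function.invFun φ
  let W := christoffelId (U.1 ∘ ψ, U.2 ∘ ψ) (V.1 ∘ ψ, V.2 ∘ ψ)
  (W.1 ∘ φ, W.2 ∘ φ)

/-- `γ = (φ, [α])` is a `C²` curve in `K^s`, parametrized by the open interval `J`. -/
structure IsC2Curve {s : ℝ} (J : Set ℝ) (γ : ℝ → Model s) : Prop where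
  mem : ∀ t ∈ J, γ t ∈ Ks s
  contDiffOn : ContDiffOn ℝ 2 γ J

/-- The geodesic equation `∇_{γ'} γ' = 0` for a `C²` curve `γ = (φ, [α])` in `K^s`, where
`∇_X Y = DY·X - Γ(Y, X)`; that is,
`(φ_tt, [α_tt]) = Γ_{(φ,[α])}((φ_t, [α_t]), (φ_t, [α_t]))` on `J`. Here `αt` and `αtt` run through
the representatives of `[α_t]` and `[α_tt]`. -/
def IsGeodesic {s : ℝ} (J : Set ℝ) (γ : ℝ → Model s) : Prop :=
  ∀ t ∈ J, ∀ αt αtt : Hs (s - 1),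
    HsQ.mk αt = (deriv γ t).2 → HsQ.mk αtt = (deriv (deriv γ) t).2 →
    let U : (ℝ → ℝ) × (ℝ → ℝ) := ((deriv γ t).1, αt)
    ((deriv (deriv γ) t).1 : ℝ → ℝ) = (christoffel (lift (γ t)) U U).1 ∧
      EqModConst αtt (christoffel (lift (γ t)) U U).2

/-- `(u, [ρ]) = (φ_t ∘ φ⁻¹, [α_t ∘ φ⁻¹])` on `J`, for the curve `γ = (φ, [α])`. -/
def IsVelocity {s : ℝ} (J : Set ℝ) (γ : ℝ → Model s) (u : ℝ → H0 s) (ρ : ℝ → HsQ (s - 1)) : Prop :=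
  ∀ t ∈ J, (u t : ℝ → ℝ) = (deriv γ t).1 ∘ Function.invFun (lift (γ t)) ∧
    ∀ αt ρt : Hs (s - 1), HsQ.mk αt = (deriv γ t).2 → HsQ.mk ρt = ρ t →
      EqModConst ρt (αt ∘ Function.invFun (lift (γ t)))

theorem sub_one_le (s : ℝ) : s - 1 ≤ s := by linarith

theorem sub_two_le (s : ℝ) : s - 2 ≤ s - 1 := by linarith

/-- The weak form of the projected two-component Hunter-Saxton system on `J`:
`u_t + u u_x = -½ A⁻¹ ∂ₓ(u_x² - π(ρ)²)` and `π(ρ)_t = -(u π(ρ))_x`. The time derivative of `u` is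
taken in `H_0^{s-1}(S¹)` and that of `π(ρ)` in `H^{s-2}(S¹)`. -/
def SolvesWeakSystem {s : ℝ} (J : Set ℝ) (u : ℝ → H0 s) (ρ : ℝ → HsQ (s - 1)) : Prop :=
  ∀ t ∈ J,
    let v : ℝ → ℝ := u t
    let q : ℝ → ℝ := HsQ.proj (s - 1) (ρ t)
    let ut : ℝ → ℝ := deriv (fun τ => H0.incl (sub_one_le s) (u τ)) t
    let qt : ℝ → ℝ := deriv (fun τ => Hs.incl (sub_two_le s) (HsQ.proj (s - 1) (ρ τ))) t
    (∀ x, ut x + v x * deriv v x = -(1 / 2) * Ainv (deriv fun y => deriv v y ^ 2 - q y ^ 2) x) ∧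
      ∀ x, qt x = -deriv (fun y => v y * q y) x

end HunterSaxton

end

noncomputable section

namespace HunterSaxton

open MeasureTheory ENNReal Filter Topology Asymptotics

/-! Formally the theorem is one differentiation. From φ_t = u ∘ φ and α_t = ρ ∘ φ (modulo constants)
the chain rule gives φ_tt = (u_t + u u_x) ∘ φ and α_tt = (ρ_t + u ρ_x) ∘ φ, again modulo constants.
The Christoffel map is right invariant, so composing the geodesic equation with φ⁻¹ yields the
equation for u and ρ_t + u ρ_x = -u_x π(ρ) + c(t), that is, ρ_t = -(u π(ρ))_x + c(t). An
x-derivative of a periodic function has mean zero, hence π removes exactly the constant c(t). All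
these steps can be reversed; this is `lagrangian_iff_eulerian`.

The substance is the regularity that justifies the differentiation. The map (φ, f) ↦ f ∘ φ⁻¹ is
jointly continuous on H^r for 1/2 < r ≤ s (`continuousAt_compInv`), and along curves it is
differentiable at the price of one derivative in x (`exists_hasDerivAt_incl_compInv`). Continuity
for r < s comes from operator bounds that are uniform for φ near φ₀, together with the density of
trigonometric polynomials. For r = s it is reduced to r = s - 1 through (f ∘ φ⁻¹)_x = (f_x / φ_x) ∘
φ⁻¹.

The uniform bounds for division by φ_x and for composition with φ⁻¹ (`uniformlyBounded_div`,
`uniformlyBounded_comp`) are needed for fractional r. In L² and H¹ they are elementary; a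
K-functional argument (`energy_interpolation`) gives the orders in between, and the rules for
differentiating quotients and compositions raise the order by one (`uniformlyBounded_bootstrap`).

The time derivative is first computed at each point x, by linearizing the equation that defines
φ⁻¹(x). The resulting expression is a continuous curve in H^q, and integrating it in time shows that
it is the derivative in H^q (`Hs.hasDerivAt_of_pointwise`). -/

/-! ### Sobolev energies with values in `ℝ≥0∞` -/

/-- The squared Sobolev norm `∑ₙ (1 + n²)^r |f̂(n)|²`, as an extended nonnegative real. -/
def energy (r : ℝ) (f : ℝ → ℝ) : ℝ≥0∞ :=
  ∑' n : ℤ, ENNReal.ofReal ((1 + (n : ℝ) ^ 2) ^ r) * ‖fourierC f n‖ₑ ^ 2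

theorem enorm_weighted_sq (r : ℝ) (f : ℝ → ℝ) (n : ℤ) :
    ‖weighted r f n‖ₑ ^ 2 = ENNReal.ofReal ((1 + (n : ℝ) ^ 2) ^ r) * ‖fourierC f n‖ₑ ^ 2 := by
  have h : (0 : ℝ) < 1 + (n : ℝ) ^ 2 := by positivity
  rw [weighted, enorm_smul, mul_pow, Real.enorm_eq_ofReal (by positivity),
    ← ENNReal.ofReal_pow (by positivity), ← Real.rpow_natCast, ← Real.rpow_mul h.le]
  norm_num

theorem energy_eq_tsum_weighted (r : ℝ) (f : ℝ → ℝ) :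
    energy r f = ∑' n : ℤ, ‖weighted r f n‖ₑ ^ 2 := by
  simp only [energy, enorm_weighted_sq]

theorem summable_norm_sq_iff {ι : Type*} (v : ι → ℂ) :
    Summable (fun n => ‖v n‖ ^ 2) ↔ ∑' n, ‖v n‖ₑ ^ 2 ≠ ⊤ := by
  have : (fun n => ‖v n‖ₑ ^ 2) = fun n => ((‖v n‖₊ ^ 2 : NNReal) : ℝ≥0∞) := by
    funext n; simp [enorm]
  rw [this, ENNReal.tsum_coe_ne_top_iff_summable, ← NNReal.summable_coe]
  simp

theorem memℓp_weighted_iff (r : ℝ) (f : ℝ → ℝ) :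
    Memℓp (weighted r f) 2 ↔ energy r f ≠ ⊤ := by
  rw [energy_eq_tsum_weighted, ← summable_norm_sq_iff, memℓp_gen_iff (by norm_num)]
  norm_num

theorem mem_sobolev_iff {r : ℝ} {f : ℝ → ℝ} :
    f ∈ sobolevSubmodule r ↔ Continuous f ∧ Function.Periodic f 1 ∧ energy r f ≠ ⊤ := by
  rw [← memℓp_weighted_iff]; rfl

theorem Hs.continuous {r : ℝ} (f : Hs r) : Continuous f := f.mem.1

theorem Hs.periodic {r : ℝ} (f : Hs r) : Function.Periodic f 1 := f.mem.2.1

theorem Hs.energy_ne_top {r : ℝ} (f : Hs r) : energy r f ≠ ⊤ :=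
  (mem_sobolev_iff.1 f.mem).2.2

theorem Hs.energy_eq {r : ℝ} (f : Hs r) : energy r f = ENNReal.ofReal (‖f‖ ^ 2) := by
  have h : ‖f‖ ^ 2 = ∑' n, ‖weighted r f n‖ ^ 2 := by
    have := lp.norm_rpow_eq_tsum (p := 2) (by norm_num) (Hs.toLp r f)
    norm_num at this
    exact this
  rw [h, energy_eq_tsum_weighted]
  have hs : Summable (fun n => ‖weighted r f n‖ ^ 2) := by
    rw [summable_norm_sq_iff, ← energy_eq_tsum_weighted]
    exact f.energy_ne_top
  rw [ENNReal.ofReal_tsum_of_nonneg (fun _ => by positivity) hs]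
  refine tsum_congr fun n => ?_
  rw [ENNReal.ofReal_pow (norm_nonneg _), ofReal_norm]

theorem energy_mono {q r : ℝ} (h : q ≤ r) (f : ℝ → ℝ) : energy q f ≤ energy r f := by
  refine ENNReal.tsum_le_tsum fun n => ?_
  gcongr
  nlinarith [sq_nonneg (n : ℝ)]

theorem fourierC_sub {f g : ℝ → ℝ} (hf : Continuous f) (hg : Continuous g) (n : ℤ) :
    fourierC (f - g) n = fourierC f n - fourierC g n := by
  have h1 : f - g = f + (-1 : ℝ) • g := by simp [sub_eq_add_neg]
  rw [h1, fourierC_add hf (hg.const_smul _), fourierC_smul]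
  simp [sub_eq_add_neg]

theorem ennreal_add_sq_le (a b : ℝ≥0∞) : (a + b) ^ 2 ≤ 2 * (a ^ 2 + b ^ 2) := by
  have := ENNReal.rpow_add_le_mul_rpow_add_rpow a b (p := 2) (by norm_num)
  norm_num at this
  exact this

theorem energy_add_le (r : ℝ) {f g : ℝ → ℝ} (hf : Continuous f) (hg : Continuous g) :
    energy r (f + g) ≤ 2 * (energy r f + energy r g) := by
  unfold energy
  rw [← ENNReal.tsum_add, ← ENNReal.tsum_mul_left]
  refine ENNReal.tsum_le_tsum fun n => ?_
  rw [fourierC_add hf hg, ← mul_add, mul_left_comm]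
  gcongr
  refine le_trans ?_ (ennreal_add_sq_le _ _)
  gcongr
  exact enorm_add_le _ _

theorem energy_smul (r c : ℝ) (f : ℝ → ℝ) :
    energy r (c • f) = ENNReal.ofReal (c ^ 2) * energy r f := by
  unfold energy
  rw [← ENNReal.tsum_mul_left]
  refine tsum_congr fun n => ?_
  rw [fourierC_smul, enorm_smul, mul_pow, mul_left_comm, ← enorm_pow,
    Real.enorm_eq_ofReal (by positivity)]

theorem energy_neg (r : ℝ) (f : ℝ → ℝ) : energy r (-f) = energy r f := by
  have := energy_smul r (-1) f
  simpa using this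

theorem energy_sub_le (r : ℝ) {f g : ℝ → ℝ} (hf : Continuous f) (hg : Continuous g) :
    energy r (f - g) ≤ 2 * (energy r f + energy r g) := by
  rw [sub_eq_add_neg, ← energy_neg r g]
  exact energy_add_le r hf hg.neg

/-! ### Parseval's identity and bounds in `L²` -/

/-- **Parseval's identity**. -/
theorem energy_zero {f : ℝ → ℝ} (hf : Continuous f) :
    energy 0 f = ENNReal.ofReal (∫ x in (0 : ℝ)..1, f x ^ 2) := by
  have hm : MemLp (fun x => (f x : ℂ)) 2 (volume.restrict (Ioc (0 : ℝ) 1)) := by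
    have hc : Continuous fun x => (f x : ℂ) := by fun_prop
    obtain ⟨C, hC⟩ := (isCompact_Icc (a := (0 : ℝ)) (b := 1)).exists_bound_of_continuousOn
      hc.continuousOn
    refine MemLp.of_bound hc.aestronglyMeasurable C ?_
    filter_upwards [ae_restrict_mem measurableSet_Ioc] with x hx
    exact hC x ⟨hx.1.le, hx.2⟩
  have h := hasSum_sq_fourierCoeffOn (zero_lt_one' ℝ) hm
  simp only [sub_zero, inv_one, one_smul, Complex.norm_real, Real.norm_eq_abs, sq_abs] at h
  rw [← h.tsum_eq, ENNReal.ofReal_tsum_of_nonneg (fun _ => by positivity) h.summable]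
  refine tsum_congr fun n => ?_
  rw [Real.rpow_zero, ENNReal.ofReal_one, one_mul, ENNReal.ofReal_pow (norm_nonneg _), ofReal_norm]
  rfl

theorem energy_zero_le_of_abs_le {f g : ℝ → ℝ} (hf : Continuous f) (hg : Continuous g) {K : ℝ}
    (h : ∀ x, |f x| ≤ K * |g x|) : energy 0 f ≤ ENNReal.ofReal (K ^ 2) * energy 0 g := by
  rw [energy_zero hf, energy_zero hg, ← ENNReal.ofReal_mul (by positivity),
    ← intervalIntegral.integral_const_mul]
  refine ENNReal.ofReal_le_ofReal (intervalIntegral.integral_mono_on zero_le_one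
    (Continuous.intervalIntegrable (by fun_prop) _ _)
    (Continuous.intervalIntegrable (by fun_prop) _ _) fun x _ => ?_)
  rw [← sq_abs (f x), ← sq_abs (g x), ← mul_pow]
  exact pow_le_pow_left₀ (abs_nonneg _) (h x) 2

theorem energy_zero_le_of_abs_le_const {f : ℝ → ℝ} (hf : Continuous f) {K : ℝ}
    (h : ∀ x, |f x| ≤ K) : energy 0 f ≤ ENNReal.ofReal (K ^ 2) := by
  rw [energy_zero hf]
  refine ENNReal.ofReal_le_ofReal ?_
  have := intervalIntegral.integral_mono_on (a := 0) (b := 1) (μ := volume) zero_le_one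
    (f := fun x => f x ^ 2) (g := fun _ => K ^ 2)
    (Continuous.intervalIntegrable (by fun_prop) _ _)
    (Continuous.intervalIntegrable (by fun_prop) _ _) fun x _ => by
      rw [← sq_abs (f x)]
      exact pow_le_pow_left₀ (abs_nonneg _) (h x) 2
  simpa using this

/-! ### Fourier inversion and the Sobolev embedding -/

/-- The Cauchy-Schwarz inequality for sums in `ℝ≥0∞`. -/
theorem ennreal_tsum_mul_sq_le {ι : Type*} (a b : ι → ℝ≥0∞) :
    (∑' i, a i * b i) ^ 2 ≤ (∑' i, a i ^ 2) * ∑' i, b i ^ 2 := by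
  let _ : MeasurableSpace ι := ⊤
  have h := ENNReal.lintegral_mul_le_Lp_mul_Lq (Measure.count : Measure ι)
    Real.HolderConjugate.two_two (f := a) (g := b) (measurable_from_top.aemeasurable)
    (measurable_from_top.aemeasurable)
  simp only [lintegral_count, Pi.mul_apply] at h
  calc _ ≤ _ := pow_le_pow_left' h 2
    _ = _ := by
      rw [mul_pow, ← ENNReal.rpow_natCast, ← ENNReal.rpow_natCast, ← ENNReal.rpow_mul,
        ← ENNReal.rpow_mul]
      norm_num

/-- `∑ₙ (1 + n²)^(-r)`. -/
def embConst (r : ℝ) : ℝ≥0∞ := ∑' n : ℤ, ENNReal.ofReal ((1 + (n : ℝ) ^ 2) ^ (-r))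

theorem embConst_ne_top {r : ℝ} (hr : 1 / 2 < r) : embConst r ≠ ⊤ := by
  have hs : Summable fun n : ℤ => (1 + (n : ℝ) ^ 2) ^ (-r) := by
    have h0 := Real.summable_abs_int_rpow (b := 2 * r) (by linarith)
    -- The weight is compared with |n|^(-2r), which is summable because 2r > 1. The extra summand
    -- covers n = 0, where |n|^(-2r) has the value 0.
    have h1 : Summable fun n : ℤ => |(n : ℝ)| ^ (-(2 * r)) + (if n = 0 then 1 else 0 : ℝ) := by
      refine h0.add (summable_of_hasFiniteSupport ((finite_singleton (0 : ℤ)).subset ?_))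
      intro n hn
      by_contra h
      simp_all
    refine Summable.of_nonneg_of_le (fun _ => by positivity) (fun n => ?_) h1
    by_cases hn : n = 0
    · subst hn
      simp
      positivity
    · have hn' : 0 < |(n : ℝ)| := by positivity
      simp only [hn, if_false, add_zero]
      have : |(n : ℝ)| ^ (-(2 * r)) = (|(n : ℝ)| ^ 2) ^ (-r) := by
        rw [← Real.rpow_natCast, ← Real.rpow_mul hn'.le]
        congr 1; push_cast; ring
      rw [this]
      exact Real.rpow_le_rpow_of_nonpos (by positivity) (by rw [sq_abs]; linarith) (by linarith)
  rw [embConst, ← ENNReal.ofReal_tsum_of_nonneg (fun _ => by positivity) hs]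
  exact ENNReal.ofReal_ne_top

/-- Cauchy-Schwarz, after inserting the weights with exponents -r/2 and r/2. The sequence is
arbitrary, so that the bound also applies to the coefficients 2πin f̂(n) of a derivative that is not
yet known to exist. -/
theorem tsum_enorm_sq_le (r : ℝ) (v : ℤ → ℂ) :
    (∑' n, ‖v n‖ₑ) ^ 2
      ≤ embConst r * ∑' n : ℤ, ENNReal.ofReal ((1 + (n : ℝ) ^ 2) ^ r) * ‖v n‖ₑ ^ 2 := by
  have h := ennreal_tsum_mul_sq_le
    (fun n : ℤ => ENNReal.ofReal ((1 + (n : ℝ) ^ 2) ^ (-r / 2)))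
    (fun n => ENNReal.ofReal ((1 + (n : ℝ) ^ 2) ^ (r / 2)) * ‖v n‖ₑ)
  have e1 : ∀ n : ℤ, ENNReal.ofReal ((1 + (n : ℝ) ^ 2) ^ (-r / 2))
      * (ENNReal.ofReal ((1 + (n : ℝ) ^ 2) ^ (r / 2)) * ‖v n‖ₑ) = ‖v n‖ₑ := fun n => by
    have hp : (0 : ℝ) < 1 + (n : ℝ) ^ 2 := by positivity
    rw [← mul_assoc, ← ENNReal.ofReal_mul (by positivity), ← Real.rpow_add hp]
    simp [neg_div]
  have e2 : ∀ q : ℝ, ∀ n : ℤ, ENNReal.ofReal ((1 + (n : ℝ) ^ 2) ^ (q / 2)) ^ 2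
      = ENNReal.ofReal ((1 + (n : ℝ) ^ 2) ^ q) := fun q n => by
    have hp : (0 : ℝ) < 1 + (n : ℝ) ^ 2 := by positivity
    rw [← ENNReal.ofReal_pow (by positivity), ← Real.rpow_mul_natCast hp.le]
    norm_num
  simpa only [e1, e2, mul_pow, embConst] using h

theorem tsum_fourierC_sq_le (r : ℝ) (f : ℝ → ℝ) :
    (∑' n, ‖fourierC f n‖ₑ) ^ 2 ≤ embConst r * energy r f :=
  tsum_enorm_sq_le r _

/-- The character `x ↦ exp(2πinx)` of the circle. -/
def circleExp (n : ℤ) (x : ℝ) : ℂ := Complex.exp (2 * Real.pi * Complex.I * n * x)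

theorem circleExp_add (m n : ℤ) (x : ℝ) : circleExp (m + n) x = circleExp m x * circleExp n x := by
  rw [circleExp, circleExp, circleExp, ← Complex.exp_add]
  push_cast
  ring_nf

theorem circleExp_zero (x : ℝ) : circleExp 0 x = 1 := by simp [circleExp]

theorem norm_circleExp (n : ℤ) (x : ℝ) : ‖circleExp n x‖ = 1 := by
  rw [circleExp, show (2 * Real.pi * Complex.I * n * x : ℂ) = ((2 * Real.pi * n * x : ℝ) : ℂ)
    * Complex.I by push_cast; ring]
  exact Complex.norm_exp_ofReal_mul_I _

theorem hasDerivAt_circleExp (n : ℤ) (x : ℝ) :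
    HasDerivAt (circleExp n) (2 * Real.pi * Complex.I * n * circleExp n x) x := by
  have h : HasDerivAt (fun y : ℝ => (2 * Real.pi * Complex.I * n : ℂ) * (y : ℂ))
      (2 * Real.pi * Complex.I * n) x := by
    simpa using (Complex.ofRealCLM.hasDerivAt (x := x)).const_mul (2 * Real.pi * Complex.I * n : ℂ)
  exact h.cexp.congr_deriv (by rw [circleExp]; ring)

theorem contDiff_circleExp (n : ℤ) : ContDiff ℝ ⊤ (circleExp n) := by
  unfold circleExp
  have : ContDiff ℝ ⊤ fun x : ℝ => (x : ℂ) := Complex.ofRealCLM.contDiff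
  fun_prop

theorem continuous_circleExp (n : ℤ) : Continuous (circleExp n) :=
  (contDiff_circleExp n).continuous

theorem circleExp_add_one (n : ℤ) (x : ℝ) : circleExp n (x + 1) = circleExp n x := by
  rw [circleExp, circleExp]
  have h : (2 * Real.pi * Complex.I * n * ((x + 1 : ℝ) : ℂ))
      = 2 * Real.pi * Complex.I * n * x + n * (2 * Real.pi * Complex.I) := by
    push_cast; ring
  rw [h, Complex.exp_periodic.int_mul n]

theorem circleExp_neg (n : ℤ) (x : ℝ) :
    circleExp (-n) x = (starRingEnd ℂ) (circleExp n x) := by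
  rw [circleExp, circleExp, ← Complex.exp_conj]
  simp [Complex.conj_ofNat]

theorem integral_circleExp (n : ℤ) :
    ∫ x in (0 : ℝ)..1, circleExp n x = if n = 0 then 1 else 0 := by
  split_ifs with h
  · subst h
    simp [circleExp_zero]
  · have hc : (2 * Real.pi * Complex.I * n : ℂ) ≠ 0 := by simp [Real.pi_ne_zero, h]
    unfold circleExp
    rw [integral_exp_mul_complex hc]
    have h1 : Complex.exp (2 * Real.pi * Complex.I * n * (1 : ℝ)) = 1 := by
      rw [Complex.exp_eq_one_iff]
      exact ⟨n, by push_cast; ring⟩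
    rw [h1]
    simp

theorem fourierC_eq_integral (f : ℝ → ℝ) (n : ℤ) :
    fourierC f n = ∫ x in (0 : ℝ)..1, circleExp (-n) x * (f x : ℂ) := by
  rw [fourierC_eq]
  simp [circleExp]

theorem fourierC_neg_index (f : ℝ → ℝ) (n : ℤ) :
    fourierC f (-n) = (starRingEnd ℂ) (fourierC f n) := by
  rw [fourierC_eq_integral, fourierC_eq_integral, intervalIntegral.integral_of_le zero_le_one,
    intervalIntegral.integral_of_le zero_le_one, ← integral_conj]
  refine integral_congr_ae (Filter.Eventually.of_forall fun x => ?_)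
  simp [circleExp_neg]

/-- The Fourier inversion formula. -/
theorem hasSum_fourierC {f : ℝ → ℝ} (hf : Continuous f) (hp : Function.Periodic f 1)
    (hs : Summable fun n => ‖fourierC f n‖) (x : ℝ) :
    HasSum (fun n => fourierC f n * circleExp n x) (f x : ℂ) := by
  have hp' : Function.Periodic (fun x => (f x : ℂ)) 1 := fun x => by simp [hp x]
  let F : C(AddCircle (1 : ℝ), ℂ) :=
    ⟨hp'.lift, continuous_coinduced_dom.mpr (Complex.continuous_ofReal.comp hf)⟩
  have hF : ∀ x : ℝ, F (x : AddCircle (1 : ℝ)) = (f x : ℂ) := fun x => rfl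
  have h0 : ∀ n, fourierCoeff F n = fourierC f n := by
    intro n
    rw [fourierCoeff_eq_intervalIntegral F n 0, fourierC_eq_integral, zero_add, div_one, one_smul]
    refine intervalIntegral.integral_congr fun x _ => ?_
    simp only [fourier_coe_apply, hF, smul_eq_mul, circleExp]
    simp
  have hs' : Summable (fourierCoeff F) := by
    rw [show fourierCoeff F = fourierC f from funext h0]
    exact hs.of_norm
  have := has_pointwise_sum_fourier_series_of_summable hs' (x : AddCircle (1 : ℝ))
  simpa only [h0, hF, smul_eq_mul, fourier_coe_apply, circleExp, Complex.ofReal_one, div_one]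
    using this

theorem tsum_enorm_fourierC_ne_top {r : ℝ} (hr : 1 / 2 < r) {f : ℝ → ℝ} (h : energy r f ≠ ⊤) :
    ∑' n, ‖fourierC f n‖ₑ ≠ ⊤ := by
  intro h'
  have := tsum_fourierC_sq_le r f
  rw [h'] at this
  simp only [ne_eq, OfNat.ofNat_ne_zero, not_false_eq_true, ENNReal.top_pow, top_le_iff] at this
  exact ENNReal.mul_ne_top (embConst_ne_top hr) h this

theorem summable_norm_of_tsum_enorm {ι : Type*} {v : ι → ℂ} (h : ∑' n, ‖v n‖ₑ ≠ ⊤) :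
    Summable fun n => ‖v n‖ := by
  have : (fun n => ‖v n‖ₑ) = fun n => ((‖v n‖₊ : NNReal) : ℝ≥0∞) := by
    funext n; simp [enorm]
  rw [this, ENNReal.tsum_coe_ne_top_iff_summable, ← NNReal.summable_coe] at h
  simpa using h

theorem summable_fourierC {r : ℝ} (hr : 1 / 2 < r) {f : ℝ → ℝ} (h : energy r f ≠ ⊤) :
    Summable fun n => ‖fourierC f n‖ :=
  summable_norm_of_tsum_enorm (tsum_enorm_fourierC_ne_top hr h)

/-- The Sobolev embedding of `H^r` in the continuous functions. -/
theorem enorm_sq_le_energy {r : ℝ} (hr : 1 / 2 < r) {f : ℝ → ℝ} (hf : f ∈ sobolevSubmodule r)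
    (x : ℝ) : ‖f x‖ₑ ^ 2 ≤ embConst r * energy r f := by
  obtain ⟨h1, h2, h3⟩ := mem_sobolev_iff.1 hf
  refine le_trans ?_ (tsum_fourierC_sq_le r f)
  gcongr
  have hs := summable_fourierC hr h3
  have h := hasSum_fourierC h1 h2 hs x
  have e : ‖f x‖ₑ = ‖(f x : ℂ)‖ₑ := by simp [enorm_eq_nnnorm]
  rw [e, ← h.tsum_eq]
  refine (enorm_tsum_le_tsum_enorm ).trans (ENNReal.tsum_le_tsum fun n => ?_)
  rw [enorm_mul]
  have : ‖circleExp n x‖ₑ = 1 := by rw [← ofReal_norm, norm_circleExp]; simp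
  rw [this, mul_one]

/-! ### Differentiation in the Sobolev scale -/

theorem fourierC_deriv {f f' : ℝ → ℝ} (hf : ∀ x, HasDerivAt f (f' x) x) (hf' : Continuous f')
    (hp : Function.Periodic f 1) (n : ℤ) :
    fourierC f' n = 2 * Real.pi * Complex.I * n * fourierC f n := by
  have hfc : Continuous f := continuous_iff_continuousAt.2 fun x => (hf x).continuousAt
  have h := intervalIntegral.integral_mul_deriv_eq_deriv_mul (a := 0) (b := 1)
    (u := circleExp (-n)) (v := fun x => (f x : ℂ))
    (u' := fun x => 2 * Real.pi * Complex.I * ((-n : ℤ) : ℂ) * circleExp (-n) x)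
    (v' := fun x => (f' x : ℂ)) (fun x _ => hasDerivAt_circleExp (-n) x)
    (fun x _ => (hf x).ofReal_comp)
    (Continuous.intervalIntegrable (by have := continuous_circleExp (-n); fun_prop) _ _)
    (Continuous.intervalIntegrable (by fun_prop) _ _)
  rw [fourierC_eq_integral, h, fourierC_eq_integral, ← intervalIntegral.integral_const_mul]
  have h1 : circleExp (-n) 1 = circleExp (-n) 0 := by
    simpa using circleExp_add_one (-n) 0
  have h2 : f 1 = f 0 := by simpa using hp 0
  rw [h1, h2, sub_self, zero_sub, ← intervalIntegral.integral_neg]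
  refine intervalIntegral.integral_congr fun x _ => ?_
  push_cast
  ring

/-- One power of the weight is paid for by the derivative, since 1 + n² ≤ 1 + (2πn)². The passages
from order r - 1 to order r, for division and for composition, rest on this. -/
theorem energy_le_energy_deriv {r : ℝ} {f f' : ℝ → ℝ} (hf : ∀ x, HasDerivAt f (f' x) x)
    (hf' : Continuous f') (hp : Function.Periodic f 1) :
    energy r f ≤ energy (r - 1) f + energy (r - 1) f' := by
  unfold energy
  rw [← ENNReal.tsum_add]
  refine ENNReal.tsum_le_tsum fun n => ?_
  rw [← mul_add, fourierC_deriv hf hf' hp, enorm_mul, mul_pow]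
  have hp : (0 : ℝ) < 1 + (n : ℝ) ^ 2 := by positivity
  have hn : (1 + ENNReal.ofReal ((n : ℝ) ^ 2)) * ‖fourierC f n‖ₑ ^ 2
      ≤ ‖fourierC f n‖ₑ ^ 2 + ‖(2 * Real.pi * Complex.I * n : ℂ)‖ₑ ^ 2 * ‖fourierC f n‖ₑ ^ 2 := by
    rw [add_mul, one_mul]
    gcongr
    rw [← ofReal_norm, ← ENNReal.ofReal_pow (norm_nonneg _)]
    refine ENNReal.ofReal_le_ofReal ?_
    have : ‖(2 * Real.pi * Complex.I * n : ℂ)‖ = 2 * Real.pi * |(n : ℝ)| := by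
      simp [abs_of_pos Real.pi_pos]
    rw [this, mul_pow, sq_abs]
    have : 1 ≤ (2 * Real.pi) ^ 2 := by nlinarith [Real.pi_gt_three]
    nlinarith [sq_nonneg (n : ℝ)]
  refine le_trans ?_ (mul_le_mul_right hn _)
  rw [← mul_assoc]
  refine mul_le_mul_left (le_of_eq ?_) _
  rw [← ENNReal.ofReal_one, ← ENNReal.ofReal_add zero_le_one (by positivity),
    ← ENNReal.ofReal_mul (by positivity)]
  congr 1
  conv_rhs => rw [← Real.rpow_one (1 + (n : ℝ) ^ 2), ← Real.rpow_mul hp.le, ← Real.rpow_add hp]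
  congr 1
  ring

theorem weight_mul_enorm_deriv_le (r : ℝ) (n : ℤ) (z : ℂ) :
    ENNReal.ofReal ((1 + (n : ℝ) ^ 2) ^ (r - 1)) * ‖2 * Real.pi * Complex.I * n * z‖ₑ ^ 2
      ≤ ENNReal.ofReal ((2 * Real.pi) ^ 2)
        * (ENNReal.ofReal ((1 + (n : ℝ) ^ 2) ^ r) * ‖z‖ₑ ^ 2) := by
  rw [enorm_mul, mul_pow, ← mul_assoc, ← mul_assoc]
  refine mul_le_mul_left ?_ _
  have hp : (0 : ℝ) < 1 + (n : ℝ) ^ 2 := by positivity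
  have : ‖(2 * Real.pi * Complex.I * n : ℂ)‖ = 2 * Real.pi * |(n : ℝ)| := by
    simp [abs_of_pos Real.pi_pos]
  rw [← ofReal_norm, ← ENNReal.ofReal_pow (norm_nonneg _), ← ENNReal.ofReal_mul (by positivity),
    ← ENNReal.ofReal_mul (by positivity), this, mul_pow, sq_abs]
  refine ENNReal.ofReal_le_ofReal ?_
  have e : (1 + (n : ℝ) ^ 2) ^ r = (1 + (n : ℝ) ^ 2) ^ (r - 1) * (1 + (n : ℝ) ^ 2) := by
    conv_rhs => rw [← Real.rpow_one (1 + (n : ℝ) ^ 2), ← Real.rpow_mul hp.le, ← Real.rpow_add hp]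
    congr 1
    ring
  rw [e]
  have h0 : 0 ≤ (1 + (n : ℝ) ^ 2) ^ (r - 1) := by positivity
  nlinarith [mul_nonneg h0 (sq_nonneg (2 * Real.pi))]

theorem energy_deriv_le {r : ℝ} {f f' : ℝ → ℝ} (hf : ∀ x, HasDerivAt f (f' x) x)
    (hf' : Continuous f') (hp : Function.Periodic f 1) :
    energy (r - 1) f' ≤ ENNReal.ofReal ((2 * Real.pi) ^ 2) * energy r f := by
  unfold energy
  rw [← ENNReal.tsum_mul_left]
  refine ENNReal.tsum_le_tsum fun n => ?_
  rw [fourierC_deriv hf hf' hp]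
  exact weight_mul_enorm_deriv_le r n _

/-- Functions in `H^r` with `r > 3/2` are continuously differentiable. -/
theorem hasDerivAt_of_mem_sobolev {r : ℝ} (hr : 3 / 2 < r) {f : ℝ → ℝ}
    (hf : f ∈ sobolevSubmodule r) : (∀ x, HasDerivAt f (deriv f x) x) ∧ Continuous (deriv f) := by
  obtain ⟨h1, h2, h3⟩ := mem_sobolev_iff.1 hf
  have hs := summable_fourierC (by linarith) h3
  -- The differentiated series has finite energy of order r - 1 > 1/2, so it converges absolutely
  -- and may be summed term by term.
  have hs' : Summable fun n : ℤ => ‖2 * Real.pi * Complex.I * n * fourierC f n‖ := by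
    refine summable_norm_of_tsum_enorm fun h => ?_
    have h' := tsum_enorm_sq_le (r - 1) fun n : ℤ => 2 * Real.pi * Complex.I * n * fourierC f n
    rw [h] at h'
    simp only [ne_eq, OfNat.ofNat_ne_zero, not_false_eq_true, ENNReal.top_pow, top_le_iff] at h'
    refine ENNReal.mul_ne_top (embConst_ne_top (by linarith)) (ne_top_of_le_ne_top ?_
      (ENNReal.tsum_le_tsum fun n : ℤ => weight_mul_enorm_deriv_le r n (fourierC f n))) h'
    rw [ENNReal.tsum_mul_left]
    exact ENNReal.mul_ne_top ENNReal.ofReal_ne_top h3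
  have hd : ∀ x, HasDerivAt (fun z => ∑' n, fourierC f n * circleExp n z)
      (∑' n : ℤ, fourierC f n * (2 * Real.pi * Complex.I * n * circleExp n x)) x := by
    refine hasDerivAt_tsum (y₀ := 0) hs' (fun n y => (hasDerivAt_circleExp n y).const_mul _) ?_
      (hasSum_fourierC h1 h2 hs 0).summable
    intro n y
    simp [norm_circleExp, mul_comm]
  have hc : Continuous fun x =>
      ∑' n : ℤ, fourierC f n * (2 * Real.pi * Complex.I * n * circleExp n x) := by
    refine continuous_tsum (fun n => ?_) hs' ?_
    · have := continuous_circleExp n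
      fun_prop
    · intro n y
      simp [norm_circleExp, mul_comm]
  have he : (fun z => ∑' n, fourierC f n * circleExp n z) = fun z => (f z : ℂ) :=
    funext fun z => (hasSum_fourierC h1 h2 hs z).tsum_eq
  rw [he] at hd
  have hd' : ∀ x, HasDerivAt f
      (∑' n : ℤ, fourierC f n * (2 * Real.pi * Complex.I * n * circleExp n x)).re x :=
    fun x => Complex.reCLM.hasFDerivAt.comp_hasDerivAt x (hd x)
  have e : deriv f = fun x =>
      (∑' n : ℤ, fourierC f n * (2 * Real.pi * Complex.I * n * circleExp n x)).re :=
    funext fun x => (hd' x).deriv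
  refine ⟨fun x => (hd' x).differentiableAt.hasDerivAt, ?_⟩
  rw [e]
  exact Complex.continuous_re.comp hc

/-! ### The algebra property of `H^r` -/

/-- Absolute convergence allows the Fourier series of f to be inserted under the integral of the
product; dominated convergence then exhibits the coefficients as a convolution. -/
theorem enorm_fourierC_mul_le {f g : ℝ → ℝ} (hf : Continuous f) (hg : Continuous g)
    (hp : Function.Periodic f 1) (hs : Summable fun n => ‖fourierC f n‖) (n : ℤ) :
    ‖fourierC (f * g) n‖ₑ ≤ ∑' m, ‖fourierC f m‖ₑ * ‖fourierC g (n - m)‖ₑ := by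
  have h : HasSum (fun m => fourierC f m * fourierC g (n - m)) (fourierC (f * g) n) := by
    obtain ⟨K, hK⟩ := (isCompact_Icc (a := (0 : ℝ)) (b := 1)).exists_bound_of_continuousOn
      hg.continuousOn
    have := intervalIntegral.hasSum_integral_of_dominated_convergence (a := 0) (b := 1)
      (μ := volume) (F := fun m x => circleExp (-n) x * (g x : ℂ) * (fourierC f m * circleExp m x))
      (f := fun x => circleExp (-n) x * (g x : ℂ) * (f x : ℂ))
      (fun m _ => K * ‖fourierC f m‖)
      (fun m => by
        have h1 := continuous_circleExp (-n)
        have h2 := continuous_circleExp m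
        exact Continuous.aestronglyMeasurable (by fun_prop))
      (fun m => Filter.Eventually.of_forall fun x hx => by
        rw [uIoc_of_le zero_le_one] at hx
        simp only [norm_mul, norm_circleExp, one_mul, mul_one, Complex.norm_real]
        exact mul_le_mul_of_nonneg_right (hK x ⟨hx.1.le, hx.2⟩) (norm_nonneg _))
      (Filter.Eventually.of_forall fun x _ => hs.mul_left K)
      (Continuous.intervalIntegrable (by fun_prop) _ _)
      (Filter.Eventually.of_forall fun x _ => (hasSum_fourierC hf hp hs x).mul_left _)
    convert! this using 1
    · funext m
      rw [fourierC_eq_integral g, ← intervalIntegral.integral_const_mul]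
      refine intervalIntegral.integral_congr fun x _ => ?_
      rw [neg_sub, sub_eq_add_neg, circleExp_add]
      ring
    · rw [fourierC_eq_integral]
      refine intervalIntegral.integral_congr fun x _ => ?_
      simp only [Pi.mul_apply, Complex.ofReal_mul]
      ring
  rw [← h.tsum_eq]
  refine enorm_tsum_le_tsum_enorm.trans (le_of_eq (tsum_congr fun m => enorm_mul _ _))

/-- Since n = m + (n - m), the weight at n is at most four times the larger of the weights at m and
n - m; the larger power is then bounded by the sum of both. -/
theorem weight_le {r : ℝ} (hr : 0 ≤ r) (m n : ℤ) :
    (1 + (n : ℝ) ^ 2) ^ r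
      ≤ 4 ^ r * ((1 + (m : ℝ) ^ 2) ^ r + (1 + ((n - m : ℤ) : ℝ) ^ 2) ^ r) := by
  have key : ∀ A B : ℝ, 0 ≤ A → 0 ≤ B → A ≤ B → 1 + (n : ℝ) ^ 2 ≤ 2 * (A + B) →
      (1 + (n : ℝ) ^ 2) ^ r ≤ 4 ^ r * B ^ r := by
    intro A B hA hB hAB h
    rw [← Real.mul_rpow (by norm_num) hB]
    exact Real.rpow_le_rpow (by positivity) (by linarith) hr
  have h1 : 1 + (n : ℝ) ^ 2 ≤ 2 * ((1 + (m : ℝ) ^ 2) + (1 + ((n - m : ℤ) : ℝ) ^ 2)) := by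
    push_cast
    nlinarith [sq_nonneg ((m : ℝ) - (n - m))]
  rw [mul_add]
  rcases le_total (1 + (m : ℝ) ^ 2) (1 + ((n - m : ℤ) : ℝ) ^ 2) with h | h
  · exact (key _ _ (by positivity) (by positivity) h h1).trans (le_add_of_nonneg_left (by positivity))
  · exact (key _ _ (by positivity) (by positivity) h (by linarith)).trans
      (le_add_of_nonneg_right (by positivity))

/-- Young's inequality `ℓ¹ * ℓ² ⊆ ℓ²`. -/
theorem tsum_conv_sq_le (a b : ℤ → ℝ≥0∞) :
    ∑' n, (∑' m, a m * b (n - m)) ^ 2 ≤ (∑' m, a m) ^ 2 * ∑' n, b n ^ 2 := by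
  have h1 : ∀ n, (∑' m, a m * b (n - m)) ^ 2 ≤ (∑' m, a m) * ∑' m, a m * b (n - m) ^ 2 := by
    intro n
    -- Splitting a into two square roots puts one factor ∑ a outside and leaves a b² inside, which
    -- can be summed over n first.
    have := ennreal_tsum_mul_sq_le (fun m => a m ^ (1 / 2 : ℝ))
      (fun m => a m ^ (1 / 2 : ℝ) * b (n - m))
    have e : ∀ x : ℝ≥0∞, x ^ (1 / 2 : ℝ) * x ^ (1 / 2 : ℝ) = x := fun x => by
      rw [← ENNReal.rpow_add_of_nonneg _ _ (by norm_num) (by norm_num)]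
      norm_num
    simpa only [← mul_assoc, e, mul_pow, sq (_ ^ (1 / 2 : ℝ))] using this
  calc ∑' n, (∑' m, a m * b (n - m)) ^ 2
      ≤ ∑' n, (∑' m, a m) * ∑' m, a m * b (n - m) ^ 2 := ENNReal.tsum_le_tsum h1
    _ = (∑' m, a m) * ∑' m, ∑' n, a m * b (n - m) ^ 2 := by
        rw [ENNReal.tsum_mul_left, ENNReal.tsum_comm]
    _ = (∑' m, a m) * ∑' m, a m * ∑' n, b n ^ 2 := by
        congr 1
        refine tsum_congr fun m => ?_
        rw [ENNReal.tsum_mul_left]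
        congr 1
        exact (Equiv.subRight m).tsum_eq fun n => b n ^ 2
    _ = _ := by rw [ENNReal.tsum_mul_right, sq, mul_assoc]

/-- `H^r` is an algebra for `r > 1/2`. -/
theorem energy_mul_le {r : ℝ} (hr : 1 / 2 < r) {f g : ℝ → ℝ} (hf : f ∈ sobolevSubmodule r)
    (hg : g ∈ sobolevSubmodule r) :
    energy r (f * g)
      ≤ ENNReal.ofReal (4 ^ r) * (4 * embConst r) * (energy r f * energy r g) := by
  obtain ⟨hf1, hf2, hf3⟩ := mem_sobolev_iff.1 hf
  obtain ⟨hg1, hg2, hg3⟩ := mem_sobolev_iff.1 hg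
  set a : ℤ → ℝ≥0∞ := fun n => ‖fourierC f n‖ₑ with ha
  set b : ℤ → ℝ≥0∞ := fun n => ‖fourierC g n‖ₑ with hb
  set w : ℤ → ℝ≥0∞ := fun n => ENNReal.ofReal ((1 + (n : ℝ) ^ 2) ^ (r / 2)) with hw
  have hw2 : ∀ n : ℤ, w n ^ 2 = ENNReal.ofReal ((1 + (n : ℝ) ^ 2) ^ r) := fun n => by
    have hp : (0 : ℝ) < 1 + (n : ℝ) ^ 2 := by positivity
    rw [hw, ← ENNReal.ofReal_pow (by positivity), ← Real.rpow_mul_natCast hp.le]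
    norm_num
  have hwle : ∀ n m : ℤ, w n ≤ ENNReal.ofReal (4 ^ (r / 2)) * (w m + w (n - m)) := fun n m => by
    rw [hw]
    simp only
    rw [← ENNReal.ofReal_add (by positivity) (by positivity), ← ENNReal.ofReal_mul (by positivity)]
    exact ENNReal.ofReal_le_ofReal (weight_le (by linarith) m n)
  have hC : ENNReal.ofReal (4 ^ (r / 2)) ^ 2 = ENNReal.ofReal (4 ^ r) := by
    rw [← ENNReal.ofReal_pow (by positivity), ← Real.rpow_mul_natCast (by norm_num)]
    norm_num
  have h1 : ∀ n, w n * ‖fourierC (f * g) n‖ₑ ≤ ENNReal.ofReal (4 ^ (r / 2)) *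
      ((∑' m, b m * (w (n - m) * a (n - m))) + ∑' m, a m * (w (n - m) * b (n - m))) := by
    intro n
    -- The substitution m ↦ n - m moves the weighted factor to the shifted index, so that both sums
    -- are convolutions of an ℓ¹ with an ℓ² sequence.
    have e : ∑' m, b m * (w (n - m) * a (n - m)) = ∑' m, (w m * a m) * b (n - m) := by
      rw [← (Equiv.subLeft n).tsum_eq]
      refine tsum_congr fun m => ?_
      rw [Equiv.subLeft_apply, sub_sub_self]
      ring
    rw [e, ← ENNReal.tsum_add, ← ENNReal.tsum_mul_left]
    calc _ ≤ w n * ∑' m, a m * b (n - m) := by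
          gcongr
          exact enorm_fourierC_mul_le hf1 hg1 hf2 (summable_fourierC hr hf3) n
      _ = ∑' m, w n * (a m * b (n - m)) := ENNReal.tsum_mul_left.symm
      _ ≤ _ := by
          refine ENNReal.tsum_le_tsum fun m => ?_
          calc _ ≤ (ENNReal.ofReal (4 ^ (r / 2)) * (w m + w (n - m))) * (a m * b (n - m)) := by
                gcongr
                exact hwle n m
            _ = _ := by ring
  have hE : ∀ h : ℝ → ℝ, energy r h = ∑' n, (w n * ‖fourierC h n‖ₑ) ^ 2 := fun h => by
    simp only [energy, mul_pow, hw2]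
  have y1 := tsum_conv_sq_le b fun n => w n * a n
  have y2 := tsum_conv_sq_le a fun n => w n * b n
  have s1 : (∑' m, a m) ^ 2 ≤ embConst r * energy r f := tsum_fourierC_sq_le r f
  have s2 : (∑' m, b m) ^ 2 ≤ embConst r * energy r g := tsum_fourierC_sq_le r g
  rw [← hE f] at y1
  rw [← hE g] at y2
  calc energy r (f * g) = ∑' n, (w n * ‖fourierC (f * g) n‖ₑ) ^ 2 := hE _
    _ ≤ ∑' n, ENNReal.ofReal (4 ^ r) * (2 * ((∑' m, b m * (w (n - m) * a (n - m))) ^ 2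
          + (∑' m, a m * (w (n - m) * b (n - m))) ^ 2)) := by
        refine ENNReal.tsum_le_tsum fun n => ?_
        refine (pow_le_pow_left' (h1 n) 2).trans ?_
        rw [mul_pow, hC]
        gcongr
        exact ennreal_add_sq_le _ _
    _ = ENNReal.ofReal (4 ^ r) * (2 * (∑' n, (∑' m, b m * (w (n - m) * a (n - m))) ^ 2
          + ∑' n, (∑' m, a m * (w (n - m) * b (n - m))) ^ 2)) := by
        rw [ENNReal.tsum_mul_left, ENNReal.tsum_mul_left, ENNReal.tsum_add]
    _ ≤ ENNReal.ofReal (4 ^ r) * (2 * (embConst r * energy r g * energy r f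
          + embConst r * energy r f * energy r g)) := by
        gcongr
        · exact y1.trans (by gcongr)
        · exact y2.trans (by gcongr)
    _ = _ := by ring

theorem mul_mem_sobolev {r : ℝ} (hr : 1 / 2 < r) {f g : ℝ → ℝ} (hf : f ∈ sobolevSubmodule r)
    (hg : g ∈ sobolevSubmodule r) : f * g ∈ sobolevSubmodule r := by
  have h := energy_mul_le hr hf hg
  obtain ⟨hf1, hf2, hf3⟩ := mem_sobolev_iff.1 hf
  obtain ⟨hg1, hg2, hg3⟩ := mem_sobolev_iff.1 hg
  refine mem_sobolev_iff.2 ⟨hf1.mul hg1, hf2.mul hg2, ne_top_of_le_ne_top ?_ h⟩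
  exact ENNReal.mul_ne_top (ENNReal.mul_ne_top ENNReal.ofReal_ne_top
    (ENNReal.mul_ne_top (by norm_num) (embConst_ne_top hr))) (ENNReal.mul_ne_top hf3 hg3)

/-! ### Trigonometric polynomials and their density -/

/-- The partial Fourier sum of `f` over the frequencies in `S`. -/
def fourierSum (S : Finset ℤ) (f : ℝ → ℝ) (x : ℝ) : ℝ :=
  (∑ n ∈ S, fourierC f n * circleExp n x).re

theorem contDiff_fourierSum (S : Finset ℤ) (f : ℝ → ℝ) : ContDiff ℝ ⊤ (fourierSum S f) := by
  have h : ContDiff ℝ ⊤ fun x => ∑ n ∈ S, fourierC f n * circleExp n x :=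
    ContDiff.sum fun n _ => contDiff_const.mul (contDiff_circleExp n)
  exact Complex.reCLM.contDiff.comp h

theorem periodic_fourierSum (S : Finset ℤ) (f : ℝ → ℝ) : Function.Periodic (fourierSum S f) 1 :=
  fun x => by simp only [fourierSum, circleExp_add_one]

/-- Symmetry of S pairs n with -n, and the corresponding terms are conjugate because f is real. The
partial sum is therefore real, and the real part in `fourierSum` discards nothing. -/
theorem fourierC_fourierSum {S : Finset ℤ} (hS : ∀ n ∈ S, -n ∈ S) (f : ℝ → ℝ) (n : ℤ) :
    fourierC (fourierSum S f) n = if n ∈ S then fourierC f n else 0 := by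
  have hreal : ∀ x, ((fourierSum S f x : ℝ) : ℂ) = ∑ m ∈ S, fourierC f m * circleExp m x := by
    intro x
    rw [fourierSum]
    apply Complex.conj_eq_iff_re.1
    rw [map_sum]
    refine Finset.sum_nbij' (fun m => -m) (fun m => -m) hS hS (by simp) (by simp) fun m _ => ?_
    rw [map_mul, circleExp_neg, fourierC_neg_index]
  rw [fourierC_eq_integral]
  simp only [hreal, Finset.mul_sum]
  rw [intervalIntegral.integral_finsetSum]
  · have : ∀ m ∈ S, ∫ x in (0 : ℝ)..1, circleExp (-n) x * (fourierC f m * circleExp m x)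
        = if m = n then fourierC f m else 0 := by
      intro m _
      have e : ∀ x, circleExp (-n) x * (fourierC f m * circleExp m x)
          = fourierC f m * circleExp (m - n) x := fun x => by
        rw [sub_eq_add_neg, circleExp_add]; ring
      simp only [e]
      rw [intervalIntegral.integral_const_mul, integral_circleExp]
      simp [sub_eq_zero]
    rw [Finset.sum_congr rfl this, Finset.sum_ite_eq']
  · intro m _
    have h1 := continuous_circleExp (-n)
    have h2 := continuous_circleExp m
    exact Continuous.intervalIntegrable (by fun_prop) _ _

theorem fourierSum_mem_sobolev {S : Finset ℤ} (hS : ∀ n ∈ S, -n ∈ S) (f : ℝ → ℝ) (r : ℝ) :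
    fourierSum S f ∈ sobolevSubmodule r := by
  refine mem_sobolev_iff.2 ⟨(contDiff_fourierSum S f).continuous, periodic_fourierSum S f, ?_⟩
  rw [energy, tsum_eq_sum (s := S)]
  · exact ENNReal.sum_ne_top.2 fun n _ => ENNReal.mul_ne_top ENNReal.ofReal_ne_top (by simp)
  · intro n hn
    simp [fourierC_fourierSum hS, hn]

theorem energy_fourierSum {S : Finset ℤ} (hS : ∀ n ∈ S, -n ∈ S) (f : ℝ → ℝ) (r : ℝ) :
    energy r (fourierSum S f) = ∑' n : ℤ,
      if n ∈ S then ENNReal.ofReal ((1 + (n : ℝ) ^ 2) ^ r) * ‖fourierC f n‖ₑ ^ 2 else 0 := by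
  refine tsum_congr fun n => ?_
  rw [fourierC_fourierSum hS]
  split_ifs <;> simp

theorem energy_sub_fourierSum {S : Finset ℤ} (hS : ∀ n ∈ S, -n ∈ S) {f : ℝ → ℝ}
    (hf : Continuous f) (r : ℝ) : energy r (f - fourierSum S f) = ∑' n : ℤ,
      if n ∈ S then 0 else ENNReal.ofReal ((1 + (n : ℝ) ^ 2) ^ r) * ‖fourierC f n‖ₑ ^ 2 := by
  refine tsum_congr fun n => ?_
  rw [fourierC_sub hf (contDiff_fourierSum S f).continuous, fourierC_fourierSum hS]
  split_ifs <;> simp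

/-- Trigonometric polynomials are dense in `H^r`. -/
theorem exists_fourierSum_energy_lt {r : ℝ} {f : ℝ → ℝ} (hf : f ∈ sobolevSubmodule r)
    {ε : ℝ≥0∞} (hε : 0 < ε) : ∃ S : Finset ℤ, (∀ n ∈ S, -n ∈ S) ∧
      energy r (f - fourierSum S f) < ε := by
  obtain ⟨h1, h2, h3⟩ := mem_sobolev_iff.1 hf
  have ht := ENNReal.tendsto_tsum_compl_atTop_zero h3
  obtain ⟨S₀, hS₀⟩ := Filter.eventually_atTop.1 (ht.eventually (gt_mem_nhds hε))
  -- Symmetrizing only enlarges S₀, and the tail bound holds for every larger set.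
  refine ⟨S₀ ∪ S₀.image fun n => -n, ?_, ?_⟩
  · intro n hn
    simp only [Finset.mem_union, Finset.mem_image] at hn ⊢
    rcases hn with hn | ⟨m, hm, rfl⟩
    · exact Or.inr ⟨n, hn, rfl⟩
    · left; simpa using hm
  · have hS : ∀ n ∈ S₀ ∪ S₀.image fun n => -n, -n ∈ S₀ ∪ S₀.image fun n => -n := by
      intro n hn
      simp only [Finset.mem_union, Finset.mem_image] at hn ⊢
      rcases hn with hn | ⟨m, hm, rfl⟩
      · exact Or.inr ⟨n, hn, rfl⟩
      · left; simpa using hm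
    rw [energy_sub_fourierSum hS h1]
    refine lt_of_le_of_lt (le_of_eq ?_) (hS₀ (S₀ ∪ S₀.image fun n => -n) Finset.subset_union_left)
    have := tsum_subtype {n : ℤ | n ∉ S₀ ∪ S₀.image fun n => -n}
      fun n : ℤ => ENNReal.ofReal ((1 + (n : ℝ) ^ 2) ^ r) * ‖fourierC f n‖ₑ ^ 2
    refine Eq.trans ?_ this.symm
    refine tsum_congr fun n => ?_
    by_cases hn : n ∈ S₀ ∪ S₀.image fun n => -n
    · rw [if_pos hn, indicator_of_notMem (not_not.2 hn)]
    · rw [if_neg hn, indicator_of_mem (by simpa using hn)]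

/-! ### Interpolation between `L²` and `H^b`, and bootstrapping -/

/-- The integral is cut at t = w. Below w the minimum is 1 and r > 0 gives w^r / r; above w the
integrand is w^b t^(r-1-b), and r < b gives w^r / (b - r). -/
theorem lintegral_rpow_mul_min {w r b : ℝ} (hw : 0 < w) (hr : 0 < r) (hrb : r < b) :
    ∫⁻ t in Ioi (0 : ℝ), ENNReal.ofReal (t ^ (r - 1)) * ENNReal.ofReal (min 1 ((w / t) ^ b))
      = ENNReal.ofReal (1 / r + 1 / (b - r)) * ENNReal.ofReal (w ^ r) := by
  rw [← Ioc_union_Ioi_eq_Ioi hw.le, lintegral_union measurableSet_Ioi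
    (by rw [disjoint_left]; exact fun x hx hx' => not_lt.2 hx.2 hx')]
  have e1 : ∫⁻ t in Ioc 0 w, ENNReal.ofReal (t ^ (r - 1)) * ENNReal.ofReal (min 1 ((w / t) ^ b))
      = ENNReal.ofReal (w ^ r / r) := by
    have hi : IntervalIntegrable (fun t : ℝ => t ^ (r - 1)) volume 0 w :=
      intervalIntegral.intervalIntegrable_rpow' (by linarith)
    have h := integral_rpow (a := 0) (b := w) (r := r - 1) (Or.inl (by linarith))
    rw [sub_add_cancel, Real.zero_rpow hr.ne', sub_zero,
      intervalIntegral.integral_of_le hw.le] at h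
    rw [← h, ofReal_integral_eq_lintegral_ofReal ((intervalIntegrable_iff_integrableOn_Ioc_of_le hw.le).1 hi)]
    · refine setLIntegral_congr_fun measurableSet_Ioc fun t ht => ?_
      have : 1 ≤ (w / t) ^ b := Real.one_le_rpow ((one_le_div ht.1).2 ht.2) (by linarith)
      simp [min_eq_left this]
    · filter_upwards [ae_restrict_mem measurableSet_Ioc] with t ht
      exact Real.rpow_nonneg ht.1.le _
  have e2 : ∫⁻ t in Ioi w, ENNReal.ofReal (t ^ (r - 1)) * ENNReal.ofReal (min 1 ((w / t) ^ b))
      = ENNReal.ofReal (w ^ r / (b - r)) := by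
    have hi := integrableOn_Ioi_rpow_of_lt (a := r - 1 - b) (by linarith) hw
    have h := integral_Ioi_rpow_of_lt (a := r - 1 - b) (by linarith) hw
    have h' : w ^ r / (b - r) = w ^ b * ∫ t in Ioi w, t ^ (r - 1 - b) := by
      rw [h, show r - 1 - b + 1 = r - b by ring, Real.rpow_sub hw]
      have : b - r ≠ 0 := by linarith
      have : r - b ≠ 0 := by linarith
      have : w ^ b ≠ 0 := by positivity
      field_simp
      ring
    rw [h', ← integral_const_mul, ofReal_integral_eq_lintegral_ofReal (hi.const_mul _)]
    · refine setLIntegral_congr_fun measurableSet_Ioi fun t ht => ?_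
      have ht0 : 0 < t := hw.trans ht
      have : (w / t) ^ b ≤ 1 := Real.rpow_le_one (by positivity)
        ((div_le_one ht0).2 (le_of_lt ht)) (by linarith)
      rw [min_eq_right this, ← ENNReal.ofReal_mul (by positivity), Real.div_rpow hw.le ht0.le,
        Real.rpow_sub ht0 (r - 1) b]
      congr 1
      ring
    · filter_upwards [ae_restrict_mem measurableSet_Ioi] with t ht
      have ht0 : 0 < t := hw.trans ht
      positivity
  have : 0 < b - r := by linarith
  rw [e1, e2, ← ENNReal.ofReal_add (by positivity) (by positivity),
    ← ENNReal.ofReal_mul (by positivity)]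
  congr 1
  ring

/-- The quadratic `K`-functional of `f` for the couple `(L², H^b)`. -/
def kFunctional (b t : ℝ) (f : ℝ → ℝ) : ℝ≥0∞ :=
  ∑' n : ℤ, ENNReal.ofReal (min 1 (((1 + (n : ℝ) ^ 2) / t) ^ b)) * ‖fourierC f n‖ₑ ^ 2

/-- Up to a constant factor, the weight of order r is a superposition over t of the weights of the
`K`-functional. A bound on the functional for each t therefore becomes a bound in H^r, for
fractional r as well. -/
theorem lintegral_kFunctional {r b : ℝ} (hr : 0 < r) (hrb : r < b) (f : ℝ → ℝ) :
    ∫⁻ t in Ioi (0 : ℝ), ENNReal.ofReal (t ^ (r - 1)) * kFunctional b t f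
      = ENNReal.ofReal (1 / r + 1 / (b - r)) * energy r f := by
  simp only [kFunctional, energy, ← ENNReal.tsum_mul_left]
  rw [lintegral_tsum fun n => Measurable.aemeasurable (by fun_prop)]
  refine tsum_congr fun n => ?_
  simp only [← mul_assoc]
  rw [lintegral_mul_const _ (by fun_prop), lintegral_rpow_mul_min (by positivity) hr hrb]

theorem kFunctional_le_zero (b t : ℝ) (f : ℝ → ℝ) : kFunctional b t f ≤ energy 0 f := by
  refine ENNReal.tsum_le_tsum fun n => ?_
  gcongr
  rw [Real.rpow_zero]
  exact min_le_left _ _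

theorem kFunctional_le (b : ℝ) {t : ℝ} (ht : 0 < t) (f : ℝ → ℝ) :
    kFunctional b t f ≤ ENNReal.ofReal (t ^ (-b)) * energy b f := by
  rw [energy, ← ENNReal.tsum_mul_left]
  refine ENNReal.tsum_le_tsum fun n => ?_
  rw [← mul_assoc, ← ENNReal.ofReal_mul (by positivity)]
  gcongr
  refine (min_le_right _ _).trans (le_of_eq ?_)
  rw [Real.div_rpow (by positivity) ht.le, Real.rpow_neg ht.le]
  ring

theorem kFunctional_add_le (b t : ℝ) {f g : ℝ → ℝ} (hf : Continuous f) (hg : Continuous g) :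
    kFunctional b t (f + g) ≤ 2 * (kFunctional b t f + kFunctional b t g) := by
  unfold kFunctional
  rw [← ENNReal.tsum_add, ← ENNReal.tsum_mul_left]
  refine ENNReal.tsum_le_tsum fun n => ?_
  rw [fourierC_add hf hg, ← mul_add, mul_left_comm]
  gcongr
  refine le_trans ?_ (ennreal_add_sq_le _ _)
  gcongr
  exact enorm_add_le _ _

theorem exists_lowFrequencies (t : ℝ) :
    ∃ S : Finset ℤ, (∀ n ∈ S, -n ∈ S) ∧ ∀ n : ℤ, n ∈ S ↔ 1 + (n : ℝ) ^ 2 ≤ t := by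
  have hfin : {n : ℤ | 1 + (n : ℝ) ^ 2 ≤ t}.Finite := by
    refine (finite_Icc (-⌈t⌉) ⌈t⌉).subset fun n hn => ?_
    have h1 : |(n : ℝ)| ≤ ⌈t⌉ := by
      refine le_trans ?_ (Int.le_ceil t)
      have : 1 + (n : ℝ) ^ 2 ≤ t := hn
      rw [← sq_abs] at this
      nlinarith [sq_nonneg (|(n : ℝ)| - 1), abs_nonneg (n : ℝ)]
    rw [← Int.cast_abs] at h1
    exact abs_le.1 (by exact_mod_cast h1)
  refine ⟨hfin.toFinset, fun n hn => ?_, fun n => by simp⟩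
  simp only [Finite.mem_toFinset, mem_ofPred_eq] at hn ⊢
  simpa using hn

/-- At each frequency the minimum is attained by one of its two entries, and the change occurs at 1
+ n² = t. The sharp cut-off there is thus an optimal decomposition, and there is nothing to
minimize. -/
theorem kFunctional_eq {b t : ℝ} (hb : 0 < b) (ht : 0 < t) {S : Finset ℤ} (hS : ∀ n ∈ S, -n ∈ S)
    (hSt : ∀ n : ℤ, n ∈ S ↔ 1 + (n : ℝ) ^ 2 ≤ t) {f : ℝ → ℝ} (hf : Continuous f) :
    kFunctional b t f = energy 0 (f - fourierSum S f)
      + ENNReal.ofReal (t ^ (-b)) * energy b (fourierSum S f) := by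
  rw [energy_sub_fourierSum hS hf, energy_fourierSum hS, ← ENNReal.tsum_mul_left,
    ← ENNReal.tsum_add]
  refine tsum_congr fun n => ?_
  by_cases hn : n ∈ S
  · have : ((1 + (n : ℝ) ^ 2) / t) ^ b ≤ 1 := Real.rpow_le_one (by positivity)
      ((div_le_one ht).2 ((hSt n).1 hn)) hb.le
    rw [if_pos hn, if_pos hn, zero_add, min_eq_right this, ← mul_assoc,
      ← ENNReal.ofReal_mul (by positivity), Real.div_rpow (by positivity) ht.le,
      Real.rpow_neg ht.le]
    congr 2
    ring
  · have : 1 ≤ ((1 + (n : ℝ) ^ 2) / t) ^ b :=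
      Real.one_le_rpow ((one_le_div ht).2 (not_le.1 (mt (hSt n).2 hn)).le) hb.le
    rw [if_neg hn, if_neg hn, min_eq_left this]
    simp

/-- Interpolation: an additive operator that is bounded on `L²` and on `H^b` is bounded on `H^r`
for `0 < r < b`. -/
theorem energy_interpolation {T : (ℝ → ℝ) → (ℝ → ℝ)} {M : ℝ≥0∞} {r b : ℝ} (hr : 0 < r) (hrb : r < b)
    (hadd : ∀ g h, T (g + h) = T g + T h)
    (hT : ∀ g, Continuous g → Function.Periodic g 1 → Continuous (T g))
    (h0 : ∀ g, Continuous g → Function.Periodic g 1 → energy 0 (T g) ≤ M * energy 0 g)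
    (hb : ∀ g, ContDiff ℝ ⊤ g → g ∈ sobolevSubmodule b → energy b (T g) ≤ M * energy b g)
    {f : ℝ → ℝ} (hf : Continuous f) (hp : Function.Periodic f 1) :
    energy r (T f) ≤ 2 * M * energy r f := by
  have hK : ∀ t, 0 < t → kFunctional b t (T f) ≤ 2 * M * kFunctional b t f := by
    intro t ht
    obtain ⟨S, hS, hSt⟩ := exists_lowFrequencies t
    have c1 : Continuous (fourierSum S f) := (contDiff_fourierSum S f).continuous
    have c0 : Continuous (f - fourierSum S f) := hf.sub c1
    have p1 := periodic_fourierSum S f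
    have p0 : Function.Periodic (f - fourierSum S f) 1 := hp.sub p1
    -- High frequencies are estimated in L² and low ones in H^b; T need not respect the frequencies,
    -- additivity suffices.
    calc kFunctional b t (T f)
        = kFunctional b t (T (f - fourierSum S f) + T (fourierSum S f)) := by
          rw [← hadd, sub_add_cancel]
      _ ≤ 2 * (kFunctional b t (T (f - fourierSum S f)) + kFunctional b t (T (fourierSum S f))) :=
          kFunctional_add_le b t (hT _ c0 p0) (hT _ c1 p1)
      _ ≤ 2 * (M * energy 0 (f - fourierSum S f)
            + ENNReal.ofReal (t ^ (-b)) * (M * energy b (fourierSum S f))) := by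
          gcongr
          · exact (kFunctional_le_zero b t _).trans (h0 _ c0 p0)
          · refine (kFunctional_le b ht _).trans ?_
            gcongr
            exact hb _ (contDiff_fourierSum S f) (fourierSum_mem_sobolev hS f b)
      _ = _ := by
          rw [kFunctional_eq (hr.trans hrb) ht hS hSt hf]
          ring
  have hκ : ENNReal.ofReal (1 / r + 1 / (b - r)) ≠ 0 := by
    have : 0 < b - r := by linarith
    rw [ENNReal.ofReal_ne_zero_iff]
    positivity
  rw [← ENNReal.mul_le_mul_iff_right hκ ENNReal.ofReal_ne_top, ← lintegral_kFunctional hr hrb]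
  calc ∫⁻ t in Ioi (0 : ℝ), ENNReal.ofReal (t ^ (r - 1)) * kFunctional b t (T f)
      ≤ ∫⁻ t in Ioi (0 : ℝ), 2 * M * (ENNReal.ofReal (t ^ (r - 1)) * kFunctional b t f) := by
        refine setLIntegral_mono' measurableSet_Ioi fun t ht => ?_
        rw [mul_left_comm]
        gcongr
        exact hK t ht
    _ = _ := by
        rw [lintegral_const_mul, lintegral_kFunctional hr hrb]
        · ring
        · unfold kFunctional
          fun_prop

/-- A family of operators is bounded on `H^r`, uniformly. -/
def UniformlyBounded {ι : Type*} (T : ι → (ℝ → ℝ) → (ℝ → ℝ)) (r : ℝ) : Prop :=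
  ∃ M : ℝ≥0∞, M ≠ ⊤ ∧ ∀ i, ∀ f ∈ sobolevSubmodule r, energy r (T i f) ≤ M * energy r f

/-- Bootstrapping: a family of additive operators that is bounded on `L²` and on `H¹`, and whose
boundedness on `H^(r-1)` implies the one on `H^r`, is bounded on `H^r` for `1/2 < r ≤ R`. -/
theorem uniformlyBounded_bootstrap {ι : Type*} {T : ι → (ℝ → ℝ) → (ℝ → ℝ)} {M : ℝ≥0∞} (hM : M ≠ ⊤)
    {R : ℝ} (hR : 3 / 2 < R)
    (hadd : ∀ i g h, T i (g + h) = T i g + T i h)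
    (hT : ∀ i g, Continuous g → Function.Periodic g 1 → Continuous (T i g))
    (h0 : ∀ i g, Continuous g → Function.Periodic g 1 → energy 0 (T i g) ≤ M * energy 0 g)
    (h1 : ∀ i g, ContDiff ℝ ⊤ g → Function.Periodic g 1 → energy 1 (T i g) ≤ M * energy 1 g)
    (hstep : ∀ r, 3 / 2 < r → r ≤ R → UniformlyBounded T (r - 1) → UniformlyBounded T r)
    {r : ℝ} (hr : 1 / 2 < r) (hrR : r ≤ R) : UniformlyBounded T r := by
  have interp : ∀ b r : ℝ, 0 < r → r < b → UniformlyBounded T b → UniformlyBounded T r := by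
    rintro b r hr hrb ⟨M', hM', h⟩
    refine ⟨2 * max M M', ENNReal.mul_ne_top (by norm_num) (by simp [hM, hM']), fun i f hf => ?_⟩
    obtain ⟨c, p, -⟩ := mem_sobolev_iff.1 hf
    refine energy_interpolation hr hrb (hadd i) (hT i) (fun g hg hg' => ?_) (fun g _ hg => ?_) c p
    · exact (h0 i g hg hg').trans (by gcongr; exact le_max_left _ _)
    · exact (h i g hg).trans (by gcongr; exact le_max_right _ _)
  have low : ∀ r : ℝ, 0 < r → r < 1 → UniformlyBounded T r := by
    intro r hr hr1
    refine ⟨2 * M, ENNReal.mul_ne_top (by norm_num) hM, fun i f hf => ?_⟩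
    obtain ⟨c, p, -⟩ := mem_sobolev_iff.1 hf
    exact energy_interpolation hr hr1 (hadd i) (hT i) (h0 i)
      (fun g hg hg' => h1 i g hg hg'.2.1) c p
  -- For 3/2 < b < 2 the order b - 1 lies in (1/2, 1), where interpolation between L² and H¹
  -- applies; a single use of `hstep` then reaches b.
  obtain ⟨b, hb1, hb2, hbR⟩ : ∃ b : ℝ, 3 / 2 < b ∧ b < 2 ∧ b ≤ R :=
    ⟨min R (7 / 4), lt_min hR (by norm_num), lt_of_le_of_lt (min_le_right _ _) (by norm_num),
      min_le_left _ _⟩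
  have hb : UniformlyBounded T b := hstep b hb1 hbR (low (b - 1) (by linarith) (by linarith))
  -- Interpolation with L² covers the orders below b, and each use of `hstep` extends the range by
  -- one. Orders up to 3/2, to which `hstep` does not apply, already lie below b.
  have main : ∀ n : ℕ, ∀ r : ℝ, 1 / 2 < r → r ≤ R → r ≤ b + n → UniformlyBounded T r := by
    intro n
    induction n with
    | zero =>
      intro r hr _ hrb
      rw [Nat.cast_zero, add_zero] at hrb
      rcases hrb.lt_or_eq with h | h
      · exact interp b r (by linarith) h hb
      · rwa [h]
    | succ n ih =>
      intro r hr hrR hrb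
      push_cast at hrb
      rcases le_or_gt r (3 / 2) with h | h
      · exact ih r hr hrR (by have : (0 : ℝ) ≤ n := by positivity
                              linarith)
      · exact hstep r h hrR (ih (r - 1) (by linarith) (by linarith) (by linarith))
  obtain ⟨n, hn⟩ := exists_nat_ge (r - b)
  exact main n r hr hrR (by linarith)

/-! ### Division by a function bounded away from zero -/

theorem periodic_deriv {f : ℝ → ℝ} (hp : Function.Periodic f 1) :
    Function.Periodic (deriv f) 1 := fun x => by
  rw [← deriv_comp_add_const, show (fun x => f (x + 1)) = f from funext hp]

theorem energy_deriv_le_of_mem {r : ℝ} (hr : 3 / 2 < r) {f : ℝ → ℝ} (hf : f ∈ sobolevSubmodule r) :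
    energy (r - 1) (deriv f) ≤ ENNReal.ofReal ((2 * Real.pi) ^ 2) * energy r f := by
  obtain ⟨h1, h2⟩ := hasDerivAt_of_mem_sobolev hr hf
  exact energy_deriv_le h1 h2 hf.2.1

theorem deriv_mem_sobolev {r : ℝ} (hr : 3 / 2 < r) {f : ℝ → ℝ} (hf : f ∈ sobolevSubmodule r) :
    deriv f ∈ sobolevSubmodule (r - 1) :=
  mem_sobolev_iff.2 ⟨(hasDerivAt_of_mem_sobolev hr hf).2, periodic_deriv hf.2.1,
    ne_top_of_le_ne_top (ENNReal.mul_ne_top ENNReal.ofReal_ne_top (mem_sobolev_iff.1 hf).2.2)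
      (energy_deriv_le_of_mem hr hf)⟩

theorem sobolev_mono {q r : ℝ} (h : q ≤ r) {f : ℝ → ℝ} (hf : f ∈ sobolevSubmodule r) :
    f ∈ sobolevSubmodule q :=
  ⟨hf.1, hf.2.1, weighted_memℓp_mono h hf.2.2⟩

theorem abs_le_of_energy_le {r : ℝ} (hr : 1 / 2 < r) {f : ℝ → ℝ} (hf : f ∈ sobolevSubmodule r)
    {K : ℝ≥0∞} (hK : K ≠ ⊤) (h : energy r f ≤ K) (x : ℝ) :
    |f x| ≤ Real.sqrt (embConst r * K).toReal := by
  refine Real.le_sqrt_of_sq_le ?_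
  have h1 := (enorm_sq_le_energy hr hf x).trans (mul_le_mul_right h (embConst r))
  have h2 := ENNReal.toReal_mono (ENNReal.mul_ne_top (embConst_ne_top hr) hK) h1
  rwa [ENNReal.toReal_pow, toReal_enorm, Real.norm_eq_abs] at h2

/-- Division by a family of functions that is bounded in `H^R`, `R > 3/2`, and bounded away from
zero is bounded on `H^r` for `1/2 < r ≤ R`. -/
theorem uniformlyBounded_div {ι : Type*} {R : ℝ} (hR : 3 / 2 < R) {a : ι → ℝ → ℝ}
    (ha : ∀ i, a i ∈ sobolevSubmodule R) {c : ℝ} (hc : 0 < c) (hca : ∀ i x, c ≤ a i x)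
    {K : ℝ≥0∞} (hK : K ≠ ⊤) (haK : ∀ i, energy R (a i) ≤ K) {r : ℝ} (hr : 1 / 2 < r)
    (hrR : r ≤ R) : UniformlyBounded (fun i g => g / a i) r := by
  have hcont : ∀ i (g : ℝ → ℝ), Continuous g → Continuous (g / a i) := fun i g hg =>
    hg.div (ha i).1 fun x => (hc.trans_le (hca i x)).ne'
  have hper : ∀ i (g : ℝ → ℝ), Function.Periodic g 1 → Function.Periodic (g / a i) 1 :=
    fun i g hg => hg.div (ha i).2.1
  -- In the form (g' - (g/a) a')/a the derivative of the quotient is itself a quotient by a, whose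
  -- numerator involves g/a without derivatives. This is what makes the induction on the order
  -- possible.
  have hder : ∀ i (g g' : ℝ → ℝ), (∀ x, HasDerivAt g (g' x) x) →
      ∀ x, HasDerivAt (g / a i) (((g' - (g / a i) * deriv (a i)) / a i) x) x := by
    intro i g g' hg x
    have h0 : a i x ≠ 0 := (hc.trans_le (hca i x)).ne'
    refine ((hg x).div ((hasDerivAt_of_mem_sobolev hR (ha i)).1 x) h0).congr_deriv ?_
    simp only [Pi.div_apply, Pi.sub_apply, Pi.mul_apply]
    field_simp
  set K' : ℝ≥0∞ := ENNReal.ofReal ((2 * Real.pi) ^ 2) * K with hK'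
  have hK't : K' ≠ ⊤ := ENNReal.mul_ne_top ENNReal.ofReal_ne_top hK
  have haK' : ∀ i, energy (R - 1) (deriv (a i)) ≤ K' := fun i =>
    (energy_deriv_le_of_mem hR (ha i)).trans (mul_le_mul_right (haK i) _)
  set D : ℝ := Real.sqrt (embConst (R - 1) * K').toReal with hD
  have haD : ∀ i x, |deriv (a i) x| ≤ D := fun i x =>
    abs_le_of_energy_le (by linarith) (deriv_mem_sobolev hR (ha i)) hK't (haK' i) x
  have h0 : ∀ i (g : ℝ → ℝ), Continuous g →
      energy 0 (g / a i) ≤ ENNReal.ofReal (c⁻¹ ^ 2) * energy 0 g := by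
    intro i g hg
    refine energy_zero_le_of_abs_le (hcont i g hg) hg fun x => ?_
    rw [Pi.div_apply, abs_div, div_eq_inv_mul]
    have : c ≤ |a i x| := (hca i x).trans (le_abs_self _)
    gcongr
  set m : ℝ≥0∞ := ENNReal.ofReal (c⁻¹ ^ 2) with hm
  set P : ℝ≥0∞ := ENNReal.ofReal ((2 * Real.pi) ^ 2) with hP
  -- The first summand of M is the L² bound, the rest is the H¹ bound from the quotient rule: m
  -- stands for division in L², P for differentiation, and D is a uniform bound for |a'|.
  refine uniformlyBounded_bootstrap
    (M := m + (m + m * (2 * (P + ENNReal.ofReal (D ^ 2) * m))))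
    ?_ hR ?_ (fun i g hg _ => hcont i g hg) ?_ ?_ ?_ hr hrR
  · have h1 : m ≠ ⊤ := ENNReal.ofReal_ne_top
    have h2 : P ≠ ⊤ := ENNReal.ofReal_ne_top
    finiteness
  · intro i g h
    exact funext fun x => add_div (g x) (h x) (a i x)
  · intro i g hg _
    refine (h0 i g hg).trans ?_
    gcongr
    exact le_self_add
  · intro i g hg hgp
    have hg1 : ∀ x, HasDerivAt g (deriv g x) x := fun x =>
      (hg.differentiable (by simp)).differentiableAt.hasDerivAt
    have hg2 : Continuous (deriv g) := hg.continuous_deriv le_top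
    have hgc := hg.continuous
    have hac := (hasDerivAt_of_mem_sobolev hR (ha i)).2
    have hq := hcont i g hgc
    have e := energy_deriv_le (r := 1) hg1 hg2 hgp
    have b := energy_le_energy_deriv (r := 1) (hder i g _ hg1)
      (hcont i _ (hg2.sub (hq.mul hac))) (hper i g hgp)
    rw [sub_self] at e b
    have e0 : energy 0 g ≤ energy 1 g := energy_mono zero_le_one g
    calc energy 1 (g / a i) ≤ _ := b
      _ ≤ m * energy 0 g + m * (2 * (energy 0 (deriv g) + ENNReal.ofReal (D ^ 2) *
            (m * energy 0 g))) := by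
          refine add_le_add (h0 i g hgc) ((h0 i _ (hg2.sub (hq.mul hac))).trans ?_)
          refine mul_le_mul_right ((energy_sub_le 0 hg2 (hq.mul hac)).trans ?_) _
          gcongr
          refine (energy_zero_le_of_abs_le (K := D) (hq.mul hac) hq fun x => ?_).trans
            (mul_le_mul_right (h0 i g hgc) _)
          rw [Pi.mul_apply, abs_mul, mul_comm]
          exact mul_le_mul_of_nonneg_right (haD i x) (abs_nonneg _)
      _ ≤ m * energy 1 g + m * (2 * (P * energy 1 g + ENNReal.ofReal (D ^ 2) *
            (m * energy 1 g))) := by gcongr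
      _ = (m + m * (2 * (P + ENNReal.ofReal (D ^ 2) * m))) * energy 1 g := by ring
      _ ≤ _ := by
          gcongr
          exact le_add_self
  -- The numerator f' - (f/a) a' lies in H^(r-1), which is an algebra because r - 1 > 1/2; the bound
  -- at order r - 1 is used once for f/a and once for the whole quotient.
  · rintro r hr hrR ⟨M, hM, h⟩
    set A : ℝ≥0∞ := ENNReal.ofReal (4 ^ (r - 1)) * (4 * embConst (r - 1)) with hA
    have hAt : A ≠ ⊤ := by
      have := embConst_ne_top (r := r - 1) (by linarith)
      finiteness
    refine ⟨M + M * (2 * (P + A * (M * K'))), ?_, fun i f hf => ?_⟩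
    · have h2 : P ≠ ⊤ := ENNReal.ofReal_ne_top
      finiteness
    · obtain ⟨hf1, hf2⟩ := hasDerivAt_of_mem_sobolev hr hf
      have hac := (hasDerivAt_of_mem_sobolev hR (ha i)).2
      have hf' := deriv_mem_sobolev hr hf
      have hf0 : f ∈ sobolevSubmodule (r - 1) := sobolev_mono (by linarith) hf
      have hfin := (mem_sobolev_iff.1 hf0).2.2
      have hq : f / a i ∈ sobolevSubmodule (r - 1) :=
        mem_sobolev_iff.2 ⟨hcont i f hf.1, hper i f hf.2.1,
          ne_top_of_le_ne_top (by finiteness) (h i f hf0)⟩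
      have ha' : deriv (a i) ∈ sobolevSubmodule (r - 1) :=
        sobolev_mono (by linarith) (deriv_mem_sobolev hR (ha i))
      have hqa := mul_mem_sobolev (by linarith) hq ha'
      have e0 : energy (r - 1) f ≤ energy r f := energy_mono (by linarith) f
      calc energy r (f / a i) ≤ _ := energy_le_energy_deriv (hder i f _ hf1)
            (hcont i _ (hf2.sub ((hcont i f hf.1).mul hac))) (hper i f hf.2.1)
        _ ≤ M * energy (r - 1) f + M * (2 * (P * energy r f
              + A * (M * energy (r - 1) f * K'))) := by
            refine add_le_add (h i f hf0) ((h i _ (sub_mem hf' hqa)).trans ?_)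
            refine mul_le_mul_right ((energy_sub_le _ hf2 ((hcont i f hf.1).mul hac)).trans ?_) _
            gcongr
            · exact energy_deriv_le_of_mem hr hf
            · refine (energy_mul_le (by linarith) hq ha').trans ?_
              gcongr
              · exact h i f hf0
              · exact (energy_mono (by linarith) _).trans (haK' i)
        _ ≤ M * energy r f + M * (2 * (P * energy r f + A * (M * energy r f * K'))) := by gcongr
        _ = _ := by ring

/-! ### Circle diffeomorphisms and composition with their inverses -/

/-- `φ` is (a lift of) an orientation preserving `C¹` diffeomorphism of the circle that fixes `0`,
with inverse `ψ` and derivative `a`. -/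
structure IsCircleDiffeo (φ ψ a : ℝ → ℝ) : Prop where
  hasDerivAt : ∀ x, HasDerivAt φ (a x) x
  continuous_deriv : Continuous a
  pos : ∀ x, 0 < a x
  left_inv : ∀ x, ψ (φ x) = x
  right_inv : ∀ x, φ (ψ x) = x
  add_one : ∀ x, φ (x + 1) = φ x + 1
  zero : φ 0 = 0

namespace IsCircleDiffeo

variable {φ ψ a : ℝ → ℝ}

theorem continuous (h : IsCircleDiffeo φ ψ a) : Continuous φ :=
  continuous_iff_continuousAt.2 fun x => (h.hasDerivAt x).continuousAt

theorem strictMono (h : IsCircleDiffeo φ ψ a) : StrictMono φ :=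
  strictMono_of_deriv_pos fun x => by rw [(h.hasDerivAt x).deriv]; exact h.pos x

theorem continuous_inv (h : IsCircleDiffeo φ ψ a) : Continuous ψ := by
  have hm : Monotone ψ := fun x y hxy => by
    by_contra hlt
    have := h.strictMono (not_le.1 hlt)
    rw [h.right_inv, h.right_inv] at this
    exact not_le.2 this hxy
  exact hm.continuous_of_surjective fun x => ⟨φ x, h.left_inv x⟩

theorem hasDerivAt_inv (h : IsCircleDiffeo φ ψ a) (y : ℝ) : HasDerivAt ψ (a (ψ y))⁻¹ y :=
  (h.hasDerivAt (ψ y)).of_local_left_inverse h.continuous_inv.continuousAt (h.pos _).ne'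
    (Filter.Eventually.of_forall h.right_inv)

theorem inv_add_one (h : IsCircleDiffeo φ ψ a) (y : ℝ) : ψ (y + 1) = ψ y + 1 := by
  conv_lhs => rw [← h.right_inv y, ← h.add_one, h.left_inv]

theorem inv_zero (h : IsCircleDiffeo φ ψ a) : ψ 0 = 0 := by
  conv_lhs => rw [← h.zero, h.left_inv]

theorem periodic_comp (h : IsCircleDiffeo φ ψ a) {g : ℝ → ℝ} (hg : Function.Periodic g 1) :
    Function.Periodic (g ∘ ψ) 1 :=
  fun x => by simp only [Function.comp_apply, h.inv_add_one, hg (ψ x)]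

theorem hasDerivAt_comp (h : IsCircleDiffeo φ ψ a) {g g' : ℝ → ℝ}
    (hg : ∀ x, HasDerivAt g (g' x) x) (y : ℝ) :
    HasDerivAt (g ∘ ψ) (((g' / a) ∘ ψ) y) y := by
  simpa [div_eq_mul_inv] using (hg (ψ y)).comp y (h.hasDerivAt_inv y)

/-- The substitution y = φ(x), which maps [0, 1] onto itself, turns the integral of (g ∘ ψ)² into
that of g² a. -/
theorem energy_zero_comp_le (h : IsCircleDiffeo φ ψ a) {D : ℝ} (hD : ∀ x, a x ≤ D) {g : ℝ → ℝ}
    (hg : Continuous g) :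
    energy 0 (g ∘ ψ) ≤ ENNReal.ofReal D * energy 0 g := by
  have hD0 : 0 ≤ D := (h.pos 0).le.trans (hD 0)
  have hac := h.continuous_deriv
  have hφ := h.continuous
  have hψ := h.continuous_inv
  rw [energy_zero (hg.comp hψ), energy_zero hg, ← ENNReal.ofReal_mul hD0,
    ← intervalIntegral.integral_const_mul]
  refine ENNReal.ofReal_le_ofReal ?_
  have key := intervalIntegral.integral_comp_mul_deriv (a := 0) (b := 1) (f := φ) (f' := a)
    (g := fun y => (g ∘ ψ) y ^ 2) (fun x _ => h.hasDerivAt x) hac.continuousOn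
    ((hg.comp hψ).pow 2)
  have h1 : φ 1 = 1 := by simpa [h.zero] using h.add_one 0
  rw [h.zero, h1] at key
  rw [← key]
  refine intervalIntegral.integral_mono_on zero_le_one
    (Continuous.intervalIntegrable (by fun_prop) _ _)
    (Continuous.intervalIntegrable (by fun_prop) _ _) fun x _ => ?_
  simp only [Function.comp_apply, h.left_inv]
  nlinarith [hD x, sq_nonneg (g x)]

end IsCircleDiffeo

/-- Composition with the inverses of a bounded family of `H^s` diffeomorphisms is bounded
on `H^r` for `1/2 < r ≤ s`. -/
theorem uniformlyBounded_comp {ι : Type*} {s : ℝ} (hs : 5 / 2 < s) {φ ψ a : ι → ℝ → ℝ}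
    (hφ : ∀ i, IsCircleDiffeo (φ i) (ψ i) (a i)) (ha : ∀ i, a i ∈ sobolevSubmodule (s - 1))
    {c : ℝ} (hc : 0 < c) (hca : ∀ i x, c ≤ a i x)
    {K : ℝ≥0∞} (hK : K ≠ ⊤) (haK : ∀ i, energy (s - 1) (a i) ≤ K) {r : ℝ} (hr : 1 / 2 < r)
    (hrs : r ≤ s) : UniformlyBounded (fun i g => g ∘ ψ i) r := by
  set D : ℝ := Real.sqrt (embConst (s - 1) * K).toReal with hD
  have haD : ∀ i x, a i x ≤ D := fun i x => (le_abs_self _).trans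
    (abs_le_of_energy_le (by linarith) (ha i) hK (haK i) x)
  have hdiv0 : ∀ i (g : ℝ → ℝ), Continuous g → Continuous (g / a i) := fun i g hg =>
    hg.div (ha i).1 fun x => (hc.trans_le (hca i x)).ne'
  set m : ℝ≥0∞ := ENNReal.ofReal (c⁻¹ ^ 2) with hm
  set d : ℝ≥0∞ := ENNReal.ofReal D with hd
  set P : ℝ≥0∞ := ENNReal.ofReal ((2 * Real.pi) ^ 2) with hP
  have hmt : m ≠ ⊤ := ENNReal.ofReal_ne_top
  have hdt : d ≠ ⊤ := ENNReal.ofReal_ne_top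
  have hPt : P ≠ ⊤ := ENNReal.ofReal_ne_top
  refine uniformlyBounded_bootstrap (M := d + d * (m * P)) (by finiteness) (R := s) (by linarith)
    (fun i g h => rfl) (fun i g hg _ => hg.comp (hφ i).continuous_inv) ?_ ?_ ?_ hr hrs
  · intro i g hg _
    refine ((hφ i).energy_zero_comp_le (haD i) hg).trans ?_
    gcongr
    exact le_self_add
  · intro i g hg hgp
    have hg1 : ∀ x, HasDerivAt g (deriv g x) x := fun x =>
      (hg.differentiable (by simp)).differentiableAt.hasDerivAt
    have hg2 : Continuous (deriv g) := hg.continuous_deriv le_top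
    have e := energy_deriv_le (r := 1) hg1 hg2 hgp
    have b := energy_le_energy_deriv (r := 1) ((hφ i).hasDerivAt_comp hg1)
      ((hdiv0 i _ hg2).comp (hφ i).continuous_inv) ((hφ i).periodic_comp hgp)
    rw [sub_self] at e b
    refine b.trans ?_
    rw [add_mul]
    refine add_le_add (((hφ i).energy_zero_comp_le (haD i) hg.continuous).trans ?_)
      (((hφ i).energy_zero_comp_le (haD i) (hdiv0 i _ hg2)).trans ?_)
    · gcongr
      exact energy_mono zero_le_one g
    · rw [mul_assoc, mul_assoc]
      gcongr
      refine (energy_zero_le_of_abs_le (K := c⁻¹) (hdiv0 i _ hg2) hg2 fun x => ?_).trans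
        (mul_le_mul_right e _)
      rw [Pi.div_apply, abs_div, div_eq_inv_mul]
      have : c ≤ |a i x| := (hca i x).trans (le_abs_self _)
      gcongr
  -- Here (f ∘ ψ)' = (f'/a) ∘ ψ. Division is bounded on H^(r-1) because a lies in H^(s-1) and r ≤ s,
  -- and composition is bounded there by hypothesis. The division bound requires s - 1 > 3/2, which
  -- is the assumption s > 5/2.
  · rintro r hr hrs ⟨M, hM, h⟩
    obtain ⟨M', hM', h'⟩ := uniformlyBounded_div (by linarith) ha hc hca hK haK
      (r := r - 1) (by linarith) (by linarith)
    refine ⟨M + M * (M' * P), by finiteness, fun i f hf => ?_⟩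
    obtain ⟨hf1, hf2⟩ := hasDerivAt_of_mem_sobolev hr hf
    have hf' := deriv_mem_sobolev hr hf
    have hf't := (mem_sobolev_iff.1 hf').2.2
    have hq : deriv f / a i ∈ sobolevSubmodule (r - 1) :=
      mem_sobolev_iff.2 ⟨hdiv0 i _ hf2, hf'.2.1.div (ha i).2.1,
        ne_top_of_le_ne_top (by finiteness) (h' i _ hf')⟩
    refine (energy_le_energy_deriv ((hφ i).hasDerivAt_comp hf1)
      ((hdiv0 i _ hf2).comp (hφ i).continuous_inv) ((hφ i).periodic_comp hf.2.1)).trans ?_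
    rw [add_mul, mul_assoc, mul_assoc]
    refine add_le_add ((h i f (sobolev_mono (by linarith) hf)).trans ?_)
      ((h i _ hq).trans (mul_le_mul_right ((h' i _ hf').trans ?_) _))
    · gcongr
      exact energy_mono (by linarith) f
    · gcongr
      exact energy_deriv_le_of_mem hr hf

/-! ### Bounded linear maps on `H^r`, and its completeness -/

theorem Hs.ext {r : ℝ} {f g : Hs r} (h : ∀ x, f x = g x) : f = g :=
  Hs.toFun_injective r (funext h)

theorem Hs.coe_mem {r : ℝ} (f : Hs r) : (f : ℝ → ℝ) ∈ sobolevSubmodule r := Subtype.property f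

theorem Hs.add_apply {r : ℝ} (f g : Hs r) (x : ℝ) : (f + g) x = f x + g x := by
  rw [map_add]; rfl

theorem Hs.sub_apply {r : ℝ} (f g : Hs r) (x : ℝ) : (f - g) x = f x - g x := by
  rw [map_sub]; rfl

theorem Hs.smul_apply {r : ℝ} (c : ℝ) (f : Hs r) (x : ℝ) : (c • f) x = c * f x := by
  rw [map_smul]; rfl

theorem Hs.coe_sub {r : ℝ} (f g : Hs r) : ((f - g : Hs r) : ℝ → ℝ) = (f : ℝ → ℝ) - g :=
  map_sub _ _ _

theorem Hs.norm_le_of_energy_le {q r : ℝ} {f : Hs r} {g : Hs q} {M : ℝ≥0∞} (hM : M ≠ ⊤)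
    (h : energy q g ≤ M * energy r f) : ‖g‖ ≤ Real.sqrt M.toReal * ‖f‖ := by
  rw [Hs.energy_eq, Hs.energy_eq] at h
  have h' := ENNReal.toReal_mono (by finiteness) h
  rw [ENNReal.toReal_mul, ENNReal.toReal_ofReal (by positivity),
    ENNReal.toReal_ofReal (by positivity)] at h'
  refine le_of_sq_le_sq ?_ (by positivity)
  rwa [mul_pow, Real.sq_sqrt ENNReal.toReal_nonneg]

theorem Hs.abs_apply_le {r : ℝ} (hr : 1 / 2 < r) (f : Hs r) (x : ℝ) :
    |f x| ≤ Real.sqrt (embConst r).toReal * ‖f‖ := by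
  have h := enorm_sq_le_energy hr f.coe_mem x
  rw [Hs.energy_eq] at h
  have h' := ENNReal.toReal_mono
    (ENNReal.mul_ne_top (embConst_ne_top hr) ENNReal.ofReal_ne_top) h
  rw [ENNReal.toReal_mul, ENNReal.toReal_ofReal (by positivity), ENNReal.toReal_pow, toReal_enorm,
    Real.norm_eq_abs] at h'
  refine le_of_sq_le_sq ?_ (by positivity)
  rwa [mul_pow, Real.sq_sqrt ENNReal.toReal_nonneg]

/-- Evaluation at a point, as a continuous linear functional on `H^r`, `r > 1/2`. -/
def Hs.evalL {r : ℝ} (hr : 1 / 2 < r) (x : ℝ) : Hs r →L[ℝ] ℝ :=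
  ((LinearMap.proj x).comp (Hs.toFun r)).mkContinuous _ (Hs.abs_apply_le hr · x)

theorem Hs.evalL_apply {r : ℝ} (hr : 1 / 2 < r) (x : ℝ) (f : Hs r) : Hs.evalL hr x f = f x := rfl

/-- The inclusion `H^r → H^q` as a continuous linear map. -/
def Hs.inclL {q r : ℝ} (h : q ≤ r) : Hs r →L[ℝ] Hs q :=
  (Hs.incl h).mkContinuous (Real.sqrt (1 : ℝ≥0∞).toReal) fun f =>
    Hs.norm_le_of_energy_le (by simp) (by
      rw [Hs.incl_apply, one_mul]
      exact energy_mono h f)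

theorem Hs.inclL_apply {q r : ℝ} (h : q ≤ r) (f : Hs r) : Hs.inclL h f = Hs.incl h f := rfl

/-- The derivative `H^r → H^(r-1)`, for `r > 3/2`. -/
def Hs.derivL {r : ℝ} (hr : 3 / 2 < r) : Hs r →L[ℝ] Hs (r - 1) :=
  LinearMap.mkContinuous
    { toFun := fun f => Hs.mk (deriv f) (deriv_mem_sobolev hr f.coe_mem)
      map_add' := fun f g => Hs.ext fun x => by
        rw [Hs.add_apply, Hs.mk_apply, Hs.mk_apply, Hs.mk_apply, map_add]
        exact deriv_add ((hasDerivAt_of_mem_sobolev hr f.coe_mem).1 x).differentiableAt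
          ((hasDerivAt_of_mem_sobolev hr g.coe_mem).1 x).differentiableAt
      map_smul' := fun c f => Hs.ext fun x => by
        rw [RingHom.id_apply, Hs.smul_apply, Hs.mk_apply, Hs.mk_apply, map_smul]
        exact deriv_const_smul c ((hasDerivAt_of_mem_sobolev hr f.coe_mem).1 x).differentiableAt }
    (Real.sqrt (ENNReal.ofReal ((2 * Real.pi) ^ 2)).toReal) fun f =>
      Hs.norm_le_of_energy_le (by simp) (energy_deriv_le_of_mem hr f.coe_mem)

theorem Hs.derivL_apply {r : ℝ} (hr : 3 / 2 < r) (f : Hs r) :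
    (Hs.derivL hr f : ℝ → ℝ) = deriv f := rfl

theorem Hs.hasDerivAt {r : ℝ} (hr : 3 / 2 < r) (f : Hs r) (x : ℝ) :
    HasDerivAt f (Hs.derivL hr f x) x :=
  (hasDerivAt_of_mem_sobolev hr f.coe_mem).1 x

/-- The multiplication of `H^r`, `r > 1/2`. -/
def Hs.mulL {r : ℝ} (hr : 1 / 2 < r) : Hs r →L[ℝ] Hs r →L[ℝ] Hs r :=
  LinearMap.mkContinuous₂
    (LinearMap.mk₂ ℝ (fun f g => Hs.mk (f * g : ℝ → ℝ) (mul_mem_sobolev hr f.coe_mem g.coe_mem))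
      (fun f f' g => Hs.ext fun x => by
        simp only [Hs.add_apply, Hs.mk_apply, Pi.mul_apply]; ring)
      (fun c f g => Hs.ext fun x => by
        simp only [Hs.smul_apply, Hs.mk_apply, Pi.mul_apply]; ring)
      (fun f g g' => Hs.ext fun x => by
        simp only [Hs.add_apply, Hs.mk_apply, Pi.mul_apply]; ring)
      (fun c f g => Hs.ext fun x => by
        simp only [Hs.smul_apply, Hs.mk_apply, Pi.mul_apply]; ring))
    (Real.sqrt (ENNReal.ofReal (4 ^ r) * (4 * embConst r)).toReal) fun f g => by
      have ht : ENNReal.ofReal (4 ^ r) * (4 * embConst r) ≠ ⊤ := by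
        have := embConst_ne_top hr
        finiteness
      have h := energy_mul_le hr f.coe_mem g.coe_mem
      -- The factor ‖f‖² is absorbed into the second argument, so that the bilinear bound takes the
      -- form of a linear one.
      have e : energy r f * energy r g = energy r ((‖f‖ • g : Hs r)) := by
        rw [map_smul, energy_smul, Hs.energy_eq f]
      rw [e] at h
      refine (Hs.norm_le_of_energy_le ht (g := Hs.mk _ (mul_mem_sobolev hr f.coe_mem g.coe_mem))
        h).trans (le_of_eq ?_)
      rw [norm_smul, norm_norm, mul_assoc]

theorem Hs.mulL_apply {r : ℝ} (hr : 1 / 2 < r) (f g : Hs r) (x : ℝ) :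
    Hs.mulL hr f g x = f x * g x := rfl

/-- The mean value as a continuous linear functional on `H^r`, `r > 1/2`. -/
def Hs.meanL {r : ℝ} (hr : 1 / 2 < r) : Hs r →L[ℝ] ℝ :=
  (Hs.mean r).mkContinuous (Real.sqrt (embConst r).toReal) fun f => by
    have := intervalIntegral.norm_integral_le_of_norm_le_const (a := 0) (b := 1) (f := (f : ℝ → ℝ))
      fun x _ => Hs.abs_apply_le hr f x
    change |∫ x in (0 : ℝ)..1, f x| ≤ _
    simpa using this

theorem Hs.meanL_apply {r : ℝ} (hr : 1 / 2 < r) (f : Hs r) :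
    Hs.meanL hr f = ∫ x in (0 : ℝ)..1, f x := rfl

theorem HsQ.mk_surjective {r : ℝ} (a : HsQ r) : ∃ f : Hs r, HsQ.mk f = a :=
  Submodule.mkQ_surjective _ a

theorem HsQ.mk_eq_iff {r : ℝ} {f g : Hs r} : HsQ.mk f = HsQ.mk g ↔ EqModConst f g := by
  change (Submodule.Quotient.mk f : HsQ r) = Submodule.Quotient.mk g ↔ _
  rw [Submodule.Quotient.eq]
  constructor
  · rintro ⟨c, hc⟩
    refine ⟨c, fun x => ?_⟩
    have := congrArg (fun h : Hs r => h x) hc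
    simp only [Hs.const_apply, Hs.sub_apply] at this
    linarith
  · rintro ⟨c, hc⟩
    refine ⟨c, Hs.ext fun x => ?_⟩
    rw [Hs.const_apply, Hs.sub_apply, hc]
    ring

theorem HsQ.proj_mk_apply {r : ℝ} (f : Hs r) (x : ℝ) :
    HsQ.proj r (HsQ.mk f) x = f x - ∫ y in (0 : ℝ)..1, f y := by
  rw [HsQ.proj_mk]; rfl

theorem HsQ.mk_proj {r : ℝ} (a : HsQ r) : HsQ.mk (HsQ.proj r a) = a := by
  obtain ⟨f, rfl⟩ := HsQ.mk_surjective a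
  rw [HsQ.mk_eq_iff]
  exact ⟨-∫ y in (0 : ℝ)..1, f y, fun x => by rw [HsQ.proj_mk_apply]; ring⟩

/-- The projection `π` as a continuous linear map. -/
def HsQ.projL {r : ℝ} (hr : 1 / 2 < r) : HsQ r →L[ℝ] Hs r where
  toLinearMap := HsQ.proj r
  cont := by
    refine (constants r).isOpenQuotientMap_mkQ.isQuotientMap.continuous_iff.2 ?_
    -- Composed with the quotient map, π is f ↦ f minus its mean, which is continuous on H^r by the
    -- Sobolev embedding.
    have e : (HsQ.proj r : HsQ r → Hs r) ∘ (constants r).mkQ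
        = fun f => f - LinearMap.toSpanSingleton ℝ (Hs r) (Hs.const r 1) (Hs.meanL hr f) := by
      funext f
      refine Hs.ext fun x => ?_
      rw [Function.comp_apply, HsQ.proj_mk_apply, Hs.sub_apply, LinearMap.toSpanSingleton_apply,
        Hs.smul_apply, Hs.const_apply, mul_one, Hs.meanL_apply]
    change Continuous ((HsQ.proj r : HsQ r → Hs r) ∘ (constants r).mkQ)
    rw [e]
    simp only [LinearMap.toSpanSingleton_apply]
    fun_prop

theorem HsQ.projL_apply {r : ℝ} (hr : 1 / 2 < r) (a : HsQ r) : HsQ.projL hr a = HsQ.proj r a := rfl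

theorem HsQ.incl_mk {q r : ℝ} (h : q ≤ r) (f : Hs r) :
    HsQ.incl h (HsQ.mk f) = HsQ.mk (Hs.incl h f) := rfl

theorem Hs.isometry_toLp (r : ℝ) : Isometry (Hs.toLp r) :=
  AddMonoidHomClass.isometry_of_norm (Hs.toLp r) fun _ => rfl

theorem norm_fourierC_le {f : ℝ → ℝ} {K : ℝ} (h : ∀ x, |f x| ≤ K) (n : ℤ) :
    ‖fourierC f n‖ ≤ K := by
  rw [fourierC_eq_integral]
  have := intervalIntegral.norm_integral_le_of_norm_le_const (a := 0) (b := 1) (C := K)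
    (f := fun x => circleExp (-n) x * (f x : ℂ)) fun x _ => by
      rw [norm_mul, norm_circleExp, one_mul, Complex.norm_real]
      exact h x
  simpa using this

/-- The Sobolev embedding `H^r → C_b`, `r > 1/2`. -/
def Hs.toBCF {r : ℝ} (hr : 1 / 2 < r) : Hs r →L[ℝ] BoundedContinuousFunction ℝ ℝ :=
  LinearMap.mkContinuous
    { toFun := fun f => BoundedContinuousFunction.ofNormedAddCommGroup f f.continuous _
        (Hs.abs_apply_le hr f)
      map_add' := fun f g => BoundedContinuousFunction.ext fun x => Hs.add_apply f g x
      map_smul' := fun c f => BoundedContinuousFunction.ext fun x => Hs.smul_apply c f x }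
    (Real.sqrt (embConst r).toReal) fun f =>
      BoundedContinuousFunction.norm_ofNormedAddCommGroup_le f.continuous (by positivity)
        (Hs.abs_apply_le hr f)

/-- A Cauchy sequence has a uniform limit F and its weighted coefficients have a limit v in ℓ².
Fourier coefficients pass to uniform limits, so v consists of the weighted coefficients of F.
Completeness is needed for the integral of a curve in H^r. -/
theorem Hs.completeSpace {r : ℝ} (hr : 1 / 2 < r) : CompleteSpace (Hs r) := by
  refine Metric.complete_of_cauchySeq_tendsto fun u hu => ?_
  obtain ⟨F, hF⟩ := cauchySeq_tendsto_of_complete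
    ((Hs.toBCF hr).uniformContinuous.comp_cauchySeq hu)
  obtain ⟨v, hv⟩ := cauchySeq_tendsto_of_complete
    ((Hs.isometry_toLp r).uniformContinuous.comp_cauchySeq hu)
  have hpt : ∀ x, Filter.Tendsto (fun k => u k x) Filter.atTop (nhds (F x)) := fun x =>
    ((continuous_eval_const (F := BoundedContinuousFunction ℝ ℝ) x).tendsto F).comp hF
  have hper : Function.Periodic F 1 := fun x =>
    tendsto_nhds_unique (hpt (x + 1)) (by
      simp only [fun k => (u k).periodic x]
      exact hpt x)
  have hcoef : ∀ n, Filter.Tendsto (fun k => fourierC (u k) n) Filter.atTop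
      (nhds (fourierC F n)) := fun n => by
    rw [tendsto_iff_norm_sub_tendsto_zero]
    refine squeeze_zero (fun _ => norm_nonneg _) (fun k => ?_)
      (tendsto_iff_norm_sub_tendsto_zero.1 hF)
    rw [← fourierC_sub (u k).continuous F.continuous]
    exact norm_fourierC_le (fun x => ((Hs.toBCF hr (u k)) - F).norm_coe_le_norm x) n
  have hw : weighted r F = v := by
    funext n
    refine tendsto_nhds_unique (f := fun k => weighted r (u k) n) (l := Filter.atTop)
      ((hcoef n).const_smul _) ?_
    rw [tendsto_iff_norm_sub_tendsto_zero]
    refine squeeze_zero (fun _ => norm_nonneg _) (fun k => ?_)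
      (tendsto_iff_norm_sub_tendsto_zero.1 hv)
    exact lp.norm_apply_le_norm (by norm_num) (Hs.toLp r (u k) - v) n
  have hmem : (F : ℝ → ℝ) ∈ sobolevSubmodule r :=
    ⟨F.continuous, hper, by rw [hw]; exact lp.memℓp v⟩
  refine ⟨Hs.mk F hmem, ?_⟩
  have hv' : Hs.toLp r (Hs.mk F hmem) = v := Subtype.ext hw
  rw [← hv'] at hv
  exact (Hs.isometry_toLp r).isUniformInducing.isInducing.tendsto_nhds_iff.2 hv

/-! ### Diffeomorphisms in the chart of `K^s` -/

theorem lift_eq {s : ℝ} (p : Model s) : lift p = fun x => x + (p.1 : Hs s) x := rfl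

theorem hasDerivAt_lift {s : ℝ} (hs : 3 / 2 < s) (p : Model s) (x : ℝ) :
    HasDerivAt (lift p) (1 + Hs.derivL hs p.1 x) x :=
  (hasDerivAt_id x).add (Hs.hasDerivAt hs _ x)

theorem deriv_lift {s : ℝ} (hs : 3 / 2 < s) (p : Model s) :
    deriv (lift p) = fun x => 1 + Hs.derivL hs p.1 x :=
  funext fun x => (hasDerivAt_lift hs p x).deriv

/-- The derivative of the diffeomorphism that is represented by `p`, as an element of
`H^(s-1)`. -/
def jacobian {s : ℝ} (hs : 3 / 2 < s) (p : Model s) : Hs (s - 1) :=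
  Hs.const (s - 1) 1 + Hs.derivL hs p.1

theorem jacobian_apply {s : ℝ} (hs : 3 / 2 < s) (p : Model s) (x : ℝ) :
    jacobian hs p x = 1 + Hs.derivL hs p.1 x := by
  rw [jacobian, Hs.add_apply, Hs.const_apply]

theorem deriv_lift_eq_jacobian {s : ℝ} (hs : 3 / 2 < s) (p : Model s) :
    deriv (lift p) = jacobian hs p := by
  rw [deriv_lift hs]
  exact funext fun x => (jacobian_apply hs p x).symm

theorem continuous_jacobian {s : ℝ} (hs : 3 / 2 < s) : Continuous (jacobian hs (s := s)) := by
  unfold jacobian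
  fun_prop

theorem isCircleDiffeo_lift {s : ℝ} (hs : 3 / 2 < s) {p : Model s} (hp : p ∈ Ks s) :
    IsCircleDiffeo (lift p) (Function.invFun (lift p)) (jacobian hs p) := by
  have hd : ∀ x, HasDerivAt (lift p) (jacobian hs p x) x := fun x => by
    rw [jacobian_apply]; exact hasDerivAt_lift hs p x
  have hpos : ∀ x, 0 < jacobian hs p x := fun x => by
    rw [← deriv_lift_eq_jacobian hs]; exact hp x
  have hmono : StrictMono (lift p) := strictMono_of_deriv_pos hp
  have hshift : ∀ x, lift p (x + 1) = lift p x + 1 := fun x => by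
    simp only [lift_eq, Hs.periodic (p.1 : Hs s) x]; ring
  have hcont : Continuous (lift p) :=
    continuous_iff_continuousAt.2 fun x => (hd x).continuousAt
  -- The lift differs from the identity by a bounded function, so it tends to ±∞ with x.
  have hsurj : Function.Surjective (lift p) := by
    obtain ⟨C, hC⟩ : ∃ C, ∀ x, |(p.1 : Hs s) x| ≤ C := ⟨_, Hs.abs_apply_le (by linarith) _⟩
    refine hcont.surjective ?_ ?_
    · refine Filter.tendsto_atTop_mono (f := fun x => x + -C) (fun x => ?_)
        (Filter.tendsto_atTop_add_const_right _ _ Filter.tendsto_id)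
      have := (abs_le.1 (hC x)).1
      simp only [lift_eq]
      linarith
    · refine Filter.tendsto_atBot_mono (fun x => (?_ : lift p x ≤ x + C))
        (Filter.tendsto_atBot_add_const_right _ _ Filter.tendsto_id)
      have := (abs_le.1 (hC x)).2
      simp only [lift_eq]
      linarith
  refine ⟨hd, (jacobian hs p).continuous, hpos, Function.leftInverse_invFun hmono.injective,
    Function.rightInverse_invFun hsurj, hshift, ?_⟩
  have : (p.1 : Hs s) 0 = 0 := (mem_H0 _).1 p.1.2
  simp only [lift_eq, this, add_zero]

/-- Near a point of `K^s`, the diffeomorphisms are uniformly bounded in `H^s`, with derivatives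
that are uniformly bounded from below. -/
theorem exists_local_bounds {s : ℝ} (hs : 3 / 2 < s) {p₀ : Model s} (hp₀ : p₀ ∈ Ks s) :
    ∃ c > 0, ∃ K : ℝ≥0∞, K ≠ ⊤ ∧ ∃ N ∈ 𝓝 p₀, ∀ p ∈ N,
      (∀ x, c ≤ jacobian hs p x) ∧ energy (s - 1) (jacobian hs p) ≤ K := by
  have hJ := isCircleDiffeo_lift hs hp₀
  -- By periodicity the Jacobian of p₀ attains a positive minimum c. The Sobolev embedding keeps
  -- nearby Jacobians uniformly within c/2 of it, so that c/2 is a common lower bound.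
  obtain ⟨x₀, -, hx₀⟩ := (isCompact_Icc (a := (0 : ℝ)) (b := 1)).exists_isMinOn
    (nonempty_Icc.2 zero_le_one) (jacobian hs p₀).continuous.continuousOn
  have hmin : ∀ x, jacobian hs p₀ x₀ ≤ jacobian hs p₀ x := fun x => by
    obtain ⟨y, hy, hxy⟩ := (jacobian hs p₀).periodic.exists_mem_Ico₀ one_pos x
    rw [hxy]
    exact hx₀ ⟨hy.1, hy.2.le⟩
  set c := jacobian hs p₀ x₀ with hc
  have hcpos : 0 < c := hJ.pos x₀
  set C := Real.sqrt (embConst (s - 1)).toReal with hC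
  have hC0 : 0 ≤ C := Real.sqrt_nonneg _
  have hcont := (continuous_jacobian hs).tendsto p₀
  rw [tendsto_iff_norm_sub_tendsto_zero] at hcont
  have h1 : ∀ᶠ p in 𝓝 p₀, C * ‖jacobian hs p - jacobian hs p₀‖ < c / 2 := by
    have := hcont.const_mul C
    rw [mul_zero] at this
    exact this.eventually (gt_mem_nhds (by linarith))
  have h2 : ∀ᶠ p in 𝓝 p₀, ‖jacobian hs p‖ < ‖jacobian hs p₀‖ + 1 :=
    (continuous_jacobian hs).norm.tendsto p₀ |>.eventually (gt_mem_nhds (by linarith))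
  refine ⟨c / 2, by linarith, ENNReal.ofReal ((‖jacobian hs p₀‖ + 1) ^ 2), ENNReal.ofReal_ne_top,
    _, h1.and h2, fun p hp => ⟨fun x => ?_, ?_⟩⟩
  · have h := (abs_le.1 ((Hs.abs_apply_le (by linarith) (jacobian hs p - jacobian hs p₀) x).trans
      hp.1.le)).1
    rw [Hs.sub_apply] at h
    linarith [hmin x]
  · rw [Hs.energy_eq]
    refine ENNReal.ofReal_le_ofReal (pow_le_pow_left₀ (norm_nonneg _) hp.2.le 2)

theorem mem_Ks_iff {s : ℝ} (hs : 3 / 2 < s) {p : Model s} :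
    p ∈ Ks s ↔ ∀ x, 0 < jacobian hs p x := by
  rw [← deriv_lift_eq_jacobian hs]; rfl

/-- A neighbourhood in `K^s` on which composition with the inverse and division by the
derivative are uniformly bounded. -/
theorem exists_uniformlyBounded {s : ℝ} (hs : 5 / 2 < s) {p₀ : Model s} (hp₀ : p₀ ∈ Ks s) :
    ∃ c > 0, ∃ N ∈ 𝓝 p₀, (∀ p ∈ N, p ∈ Ks s ∧ ∀ x, c ≤ jacobian (by linarith) p x) ∧
      (∀ r, 1 / 2 < r → r ≤ s →
        UniformlyBounded (fun (p : N) (g : ℝ → ℝ) => g ∘ Function.invFun (lift p.1)) r) ∧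
      ∀ r, 1 / 2 < r → r ≤ s - 1 →
        UniformlyBounded (fun (p : N) (g : ℝ → ℝ) =>
          g / (jacobian (by linarith) p.1 : ℝ → ℝ)) r := by
  have hs' : 3 / 2 < s := by linarith
  obtain ⟨c, hc, K, hK, N, hN, h⟩ := exists_local_bounds hs' hp₀
  have hmem : ∀ p ∈ N, p ∈ Ks s := fun p hp =>
    (mem_Ks_iff hs').2 fun x => hc.trans_le ((h p hp).1 x)
  refine ⟨c, hc, N, hN, fun p hp => ⟨hmem p hp, (h p hp).1⟩, fun r hr hrs => ?_, fun r hr hrs => ?_⟩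
  · exact uniformlyBounded_comp hs (fun p : N => isCircleDiffeo_lift hs' (hmem p.1 p.2))
      (fun p => Hs.coe_mem _) hc (fun p => (h p.1 p.2).1) hK (fun p => (h p.1 p.2).2) hr hrs
  · exact uniformlyBounded_div (by linarith)
      (fun p => Hs.coe_mem _) hc (fun p : N => (h p.1 p.2).1) hK (fun p => (h p.1 p.2).2) hr hrs

/-! ### Joint continuity of `(φ, f) ↦ f ∘ φ⁻¹` -/

open Classical in
/-- `f ∘ φ⁻¹`, where `φ` is represented by `p`. -/
def compInv {s r : ℝ} (p : Model s) (f : Hs r) : Hs r :=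
  if h : (f : ℝ → ℝ) ∘ Function.invFun (lift p) ∈ sobolevSubmodule r then Hs.mk _ h else 0

open Classical in
/-- `f / φ'`, where `φ` is represented by `p`. -/
def divJacobian {s r : ℝ} (p : Model s) (f : Hs r) : Hs r :=
  if h : (f : ℝ → ℝ) / deriv (lift p) ∈ sobolevSubmodule r then Hs.mk _ h else 0

/-- On `Ks s` the default value 0 in `compInv` never occurs: the uniform bound, taken at the single
point p, shows that the composition stays in H^r. -/
theorem compInv_coe {s r : ℝ} (hs : 5 / 2 < s) (hr : 1 / 2 < r) (hrs : r ≤ s) {p : Model s}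
    (hp : p ∈ Ks s) (f : Hs r) :
    (compInv p f : ℝ → ℝ) = (f : ℝ → ℝ) ∘ Function.invFun (lift p) := by
  have h : (f : ℝ → ℝ) ∘ Function.invFun (lift p) ∈ sobolevSubmodule r := by
    obtain ⟨c, hc, N, hN, -, h, -⟩ := exists_uniformlyBounded hs hp
    obtain ⟨M, hM, h⟩ := h r hr hrs
    have hJ := isCircleDiffeo_lift (by linarith) hp
    exact mem_sobolev_iff.2 ⟨f.continuous.comp hJ.continuous_inv, hJ.periodic_comp f.periodic,
      ne_top_of_le_ne_top (ENNReal.mul_ne_top hM f.energy_ne_top)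
        (h ⟨p, mem_of_mem_nhds hN⟩ f f.coe_mem)⟩
  rw [compInv, dif_pos h, Hs.mk_apply]

theorem divJacobian_coe {s r : ℝ} (hs : 5 / 2 < s) (hr : 1 / 2 < r) (hrs : r ≤ s - 1)
    {p : Model s} (hp : p ∈ Ks s) (f : Hs r) :
    (divJacobian p f : ℝ → ℝ) = (f : ℝ → ℝ) / deriv (lift p) := by
  have h : (f : ℝ → ℝ) / deriv (lift p) ∈ sobolevSubmodule r := by
    obtain ⟨c, hc, N, hN, -, -, h⟩ := exists_uniformlyBounded hs hp
    obtain ⟨M, hM, h⟩ := h r hr hrs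
    rw [deriv_lift_eq_jacobian (by linarith)]
    exact mem_sobolev_iff.2 ⟨f.continuous.div (Hs.continuous _)
        fun x => ((mem_Ks_iff (by linarith)).1 hp x).ne',
      f.periodic.div (Hs.periodic _),
      ne_top_of_le_ne_top (ENNReal.mul_ne_top hM f.energy_ne_top)
        (h ⟨p, mem_of_mem_nhds hN⟩ f f.coe_mem)⟩
  rw [divJacobian, dif_pos h, Hs.mk_apply]

theorem exists_norm_compInv_le {s r : ℝ} (hs : 5 / 2 < s) (hr : 1 / 2 < r) (hrs : r ≤ s)
    {p₀ : Model s} (hp₀ : p₀ ∈ Ks s) :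
    ∃ C, 0 ≤ C ∧ ∀ᶠ p in 𝓝 p₀, p ∈ Ks s ∧ ∀ f : Hs r, ‖compInv p f‖ ≤ C * ‖f‖ := by
  obtain ⟨c, hc, N, hN, hmem, h, -⟩ := exists_uniformlyBounded hs hp₀
  obtain ⟨M, hM, h⟩ := h r hr hrs
  refine ⟨_, Real.sqrt_nonneg M.toReal, mem_of_superset hN fun p hp => ⟨(hmem p hp).1,
    fun f => Hs.norm_le_of_energy_le hM ?_⟩⟩
  rw [compInv_coe hs hr hrs (hmem p hp).1]
  exact h ⟨p, hp⟩ f f.coe_mem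

theorem exists_norm_divJacobian_le {s r : ℝ} (hs : 5 / 2 < s) (hr : 1 / 2 < r) (hrs : r ≤ s - 1)
    {p₀ : Model s} (hp₀ : p₀ ∈ Ks s) :
    ∃ C, 0 ≤ C ∧ ∀ᶠ p in 𝓝 p₀, p ∈ Ks s ∧ ∀ f : Hs r, ‖divJacobian p f‖ ≤ C * ‖f‖ := by
  obtain ⟨c, hc, N, hN, hmem, -, h⟩ := exists_uniformlyBounded hs hp₀
  obtain ⟨M, hM, h⟩ := h r hr hrs
  refine ⟨_, Real.sqrt_nonneg M.toReal, mem_of_superset hN fun p hp => ⟨(hmem p hp).1,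
    fun f => Hs.norm_le_of_energy_le hM ?_⟩⟩
  rw [divJacobian_coe hs hr hrs (hmem p hp).1, deriv_lift_eq_jacobian (by linarith)]
  exact h ⟨p, hp⟩ f f.coe_mem

theorem Hs.abs_sub_le {r : ℝ} (hr : 3 / 2 < r) (f : Hs r) (a b : ℝ) :
    |f a - f b| ≤ Real.sqrt (embConst (r - 1)).toReal * ‖Hs.derivL hr f‖ * |a - b| :=
  Convex.norm_image_sub_le_of_norm_hasDerivWithin_le (f := (f : ℝ → ℝ))
    (f' := (Hs.derivL hr f : ℝ → ℝ)) (s := univ) (x := b) (y := a)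
    (fun z _ => (Hs.hasDerivAt hr f z).hasDerivWithinAt)
    (fun z _ => Hs.abs_apply_le (by linarith) _ z) convex_univ (mem_univ _) (mem_univ _)

/-- The inverses of diffeomorphisms depend continuously on the diffeomorphism, uniformly. -/
theorem exists_abs_invFun_sub_le {s : ℝ} (hs : 5 / 2 < s) {p₀ : Model s} (hp₀ : p₀ ∈ Ks s) :
    ∃ C, 0 ≤ C ∧ ∀ᶠ p in 𝓝 p₀, ∀ y,
      |Function.invFun (lift p) y - Function.invFun (lift p₀) y| ≤ C * ‖p - p₀‖ := by
  have hs' : 3 / 2 < s := by linarith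
  obtain ⟨c, hc, N, hN, hmem, -, -⟩ := exists_uniformlyBounded hs hp₀
  set E := Real.sqrt (embConst s).toReal with hE
  refine ⟨c⁻¹ * E, by positivity, mem_of_superset hN fun p hp y => ?_⟩
  have h0 := isCircleDiffeo_lift hs' hp₀
  have h1 := isCircleDiffeo_lift hs' (hmem p hp).1
  set ψ := Function.invFun (lift p) with hψ
  set x := Function.invFun (lift p₀) y with hx
  have hy : lift p₀ x = y := h0.right_inv y
  have hlip : ∀ a b, |ψ a - ψ b| ≤ c⁻¹ * |a - b| := fun a b => by
    have := Convex.norm_image_sub_le_of_norm_hasDerivWithin_le (f := ψ) (s := univ) (x := b)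
      (y := a) (C := c⁻¹) (fun z _ => (h1.hasDerivAt_inv z).hasDerivWithinAt) (fun z _ => by
        rw [norm_inv, Real.norm_eq_abs]
        exact inv_anti₀ hc (((hmem p hp).2 _).trans (le_abs_self _)))
      convex_univ (mem_univ _) (mem_univ _)
    exact this
  calc |ψ y - x| = |ψ (lift p₀ x) - ψ (lift p x)| := by rw [hy, h1.left_inv]
    _ ≤ c⁻¹ * |lift p₀ x - lift p x| := hlip _ _
    _ ≤ c⁻¹ * (E * ‖p - p₀‖) := by
        gcongr
        have e : lift p₀ x - lift p x = -(((p - p₀).1 : Hs s) x) := by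
          have : (((p - p₀).1 : H0 s) : Hs s) = (p.1 : Hs s) - p₀.1 := rfl
          rw [this, Hs.sub_apply, lift_eq, lift_eq]
          ring
        rw [e, abs_neg]
        refine (Hs.abs_apply_le (by linarith) _ x).trans ?_
        gcongr
        exact norm_fst_le (p - p₀)
    _ = _ := by ring

/-- An interpolation inequality between Sobolev norms. -/
theorem exists_energy_le {r s : ℝ} (hr : 0 < r) (hrs : r < s) {δ : ℝ} (hδ : 0 < δ) :
    ∃ C : ℝ, 0 ≤ C ∧ ∀ f : ℝ → ℝ,
      energy r f ≤ ENNReal.ofReal δ * energy s f + ENNReal.ofReal C * energy 0 f := by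
  set b : ℝ := δ⁻¹ ^ (1 / (s - r)) with hb
  have hb0 : 0 ≤ b := by positivity
  refine ⟨b ^ r, by positivity, fun f => ?_⟩
  unfold energy
  rw [← ENNReal.tsum_mul_left, ← ENNReal.tsum_mul_left, ← ENNReal.tsum_add]
  refine ENNReal.tsum_le_tsum fun n => ?_
  rw [← mul_assoc, ← mul_assoc, ← add_mul, ← ENNReal.ofReal_mul hδ.le, Real.rpow_zero,
    ENNReal.ofReal_one, mul_one, ← ENNReal.ofReal_add (by positivity) (by positivity)]
  gcongr
  set w : ℝ := 1 + (n : ℝ) ^ 2 with hw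
  have hw0 : 0 < w := by positivity
  rcases le_total w b with h | h
  · exact (Real.rpow_le_rpow hw0.le h hr.le).trans (le_add_of_nonneg_left (by positivity))
  · refine le_trans ?_ (le_add_of_nonneg_right (by positivity))
    have h1 : δ⁻¹ ≤ w ^ (s - r) := by
      have h2 := Real.rpow_le_rpow hb0 h (sub_pos.2 hrs).le
      rwa [hb, ← Real.rpow_mul (by positivity), one_div_mul_cancel (sub_pos.2 hrs).ne',
        Real.rpow_one] at h2
    have h3 : w ^ s = w ^ r * w ^ (s - r) := by
      rw [← Real.rpow_add hw0]; congr 1; ring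
    rw [h3]
    have h4 : 1 ≤ δ * w ^ (s - r) := by
      have := mul_le_mul_of_nonneg_left h1 hδ.le
      rwa [mul_inv_cancel₀ hδ.ne'] at this
    have h5 : 0 < w ^ r := by positivity
    nlinarith

theorem compInv_incl {s r : ℝ} (hs : 5 / 2 < s) (hr : 1 / 2 < r) (hrs : r ≤ s) {p : Model s}
    (hp : p ∈ Ks s) (f : Hs s) : compInv p (Hs.incl hrs f) = Hs.incl hrs (compInv p f) := by
  refine Hs.toFun_injective r ?_
  rw [compInv_coe hs hr hrs hp, Hs.incl_apply, Hs.incl_apply,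
    compInv_coe hs (by linarith) le_rfl hp]

theorem compInv_sub {s r : ℝ} (hs : 5 / 2 < s) (hr : 1 / 2 < r) (hrs : r ≤ s) {p : Model s}
    (hp : p ∈ Ks s) (f g : Hs r) : compInv p (f - g) = compInv p f - compInv p g := by
  refine Hs.toFun_injective r ?_
  rw [Hs.coe_sub, compInv_coe hs hr hrs hp, compInv_coe hs hr hrs hp, compInv_coe hs hr hrs hp,
    Hs.coe_sub]
  rfl

/-- For f in H^s the differences f ∘ φ⁻¹ - f ∘ φ₀⁻¹ stay bounded in H^s and tend to zero uniformly,
since f is Lipschitz and the inverses converge uniformly. Interpolating between these two facts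
gives convergence in H^r for r < s. -/
theorem tendsto_compInv_incl {s r : ℝ} (hs : 5 / 2 < s) (hr : 1 / 2 < r) (hrs : r < s)
    {p₀ : Model s} (hp₀ : p₀ ∈ Ks s) (f : Hs s) :
    Tendsto (fun p => compInv p (Hs.incl hrs.le f)) (𝓝 p₀)
      (𝓝 (compInv p₀ (Hs.incl hrs.le f))) := by
  obtain ⟨B, hB0, hB⟩ := exists_norm_compInv_le hs (by linarith) le_rfl hp₀
  obtain ⟨C, hC0, hC⟩ := exists_abs_invFun_sub_le hs hp₀
  set L := Real.sqrt (embConst (s - 1)).toReal * ‖Hs.derivL (by linarith) f‖ with hL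
  have hL0 : 0 ≤ L := by positivity
  have hlip : ∀ a b, |f a - f b| ≤ L * |a - b| := Hs.abs_sub_le (by linarith) f
  rw [tendsto_iff_norm_sub_tendsto_zero]
  have hsq : Tendsto (fun p => ‖compInv p (Hs.incl hrs.le f) - compInv p₀ (Hs.incl hrs.le f)‖ ^ 2)
      (𝓝 p₀) (𝓝 0) := by
    rw [Metric.tendsto_nhds]
    intro ε hε
    -- Q bounds the squared H^s norm of the difference g, and the added 1 makes it positive. With δ
    -- = ε/(2Q) the H^s term contributes at most ε/2.
    set Q := (2 * B * ‖f‖) ^ 2 + 1 with hQ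
    have hQ0 : 0 < Q := by positivity
    obtain ⟨D, hD0, hD⟩ := exists_energy_le (by linarith) hrs (δ := ε / 2 / Q) (by positivity)
    have hlim : Tendsto (fun p : Model s => D * (L * (C * ‖p - p₀‖)) ^ 2) (𝓝 p₀) (𝓝 0) := by
      have : Continuous fun p : Model s => D * (L * (C * ‖p - p₀‖)) ^ 2 := by fun_prop
      simpa using this.tendsto p₀
    filter_upwards [hB, hC, hlim.eventually (gt_mem_nhds (half_pos hε))] with p hpB hpC hplim
    obtain ⟨-, hB₀⟩ := hB.self_of_nhds
    set g : Hs s := compInv p f - compInv p₀ f with hg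
    have e : compInv p (Hs.incl hrs.le f) - compInv p₀ (Hs.incl hrs.le f) = Hs.incl hrs.le g := by
      rw [compInv_incl hs hr hrs.le hpB.1, compInv_incl hs hr hrs.le hp₀, hg, map_sub]
    have hgn : ‖g‖ ≤ 2 * B * ‖f‖ := by
      refine (norm_sub_le _ _).trans ?_
      linarith [hpB.2 f, hB₀ f]
    have hg0 : energy 0 g ≤ ENNReal.ofReal ((L * (C * ‖p - p₀‖)) ^ 2) := by
      refine energy_zero_le_of_abs_le_const g.continuous fun x => ?_
      rw [hg, Hs.sub_apply, compInv_coe hs (by linarith) le_rfl hpB.1,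
        compInv_coe hs (by linarith) le_rfl hp₀]
      refine (hlip _ _).trans ?_
      gcongr
      exact hpC x
    have hmain := hD g
    rw [← Hs.incl_apply hrs.le, Hs.energy_eq, Hs.incl_apply, Hs.energy_eq] at hmain
    have h2 := hmain.trans (add_le_add_right (mul_le_mul_right hg0 (ENNReal.ofReal D)) _)
    rw [← ENNReal.ofReal_mul (by positivity), ← ENNReal.ofReal_mul hD0,
      ← ENNReal.ofReal_add (by positivity) (by positivity),
      ENNReal.ofReal_le_ofReal_iff (by positivity)] at h2
    rw [Real.dist_eq, sub_zero, abs_of_nonneg (by positivity), e]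
    have h3 : ε / 2 / Q * ‖g‖ ^ 2 ≤ ε / 2 := by
      rw [div_mul_eq_mul_div, div_le_iff₀ hQ0]
      have : ‖g‖ ^ 2 ≤ Q := by
        have := pow_le_pow_left₀ (norm_nonneg g) hgn 2
        linarith
      gcongr
    linarith
  have := hsq.sqrt
  simpa using this

/-- Composition with the inverse is jointly continuous on `H^r` for `r < s`. -/
theorem continuousAt_compInv_of_lt {s r : ℝ} (hs : 5 / 2 < s) (hr : 1 / 2 < r) (hrs : r < s)
    {p₀ : Model s} (hp₀ : p₀ ∈ Ks s) (f₀ : Hs r) :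
    ContinuousAt (fun z : Model s × Hs r => compInv z.1 z.2) (p₀, f₀) := by
  obtain ⟨B, hB0, hB⟩ := exists_norm_compInv_le hs hr hrs.le hp₀
  rw [ContinuousAt, Metric.tendsto_nhds]
  intro ε hε
  -- The difference is split into four terms: three are at most Bδ ≤ ε/4 by the uniform bound B, and
  -- the fourth, with a trigonometric polynomial h, is below ε/4 for p near p₀.
  set δ := ε / (4 * (B + 1)) with hδ
  have hδ0 : 0 < δ := by positivity
  obtain ⟨S, hS, hSf⟩ := exists_fourierSum_energy_lt f₀.coe_mem (ε := ENNReal.ofReal (δ ^ 2))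
    (by simpa using pow_pos hδ0 2)
  set h : Hs s := Hs.mk _ (fourierSum_mem_sobolev hS f₀ s) with hh
  have hfh : ‖f₀ - Hs.incl hrs.le h‖ < δ := by
    have e : ((f₀ - Hs.incl hrs.le h : Hs r) : ℝ → ℝ) = f₀ - fourierSum S f₀ := by
      rw [Hs.coe_sub, Hs.incl_apply, hh, Hs.mk_apply]
    rw [← e, Hs.energy_eq, ENNReal.ofReal_lt_ofReal_iff (by positivity)] at hSf
    exact lt_of_pow_lt_pow_left₀ 2 hδ0.le hSf
  have h1 := tendsto_iff_norm_sub_tendsto_zero.1 (tendsto_compInv_incl hs hr hrs hp₀ h)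
  have h2 : ∀ᶠ z : Model s × Hs r in 𝓝 (p₀, f₀), ‖z.2 - f₀‖ < δ := by
    have : Continuous fun z : Model s × Hs r => ‖z.2 - f₀‖ := by fun_prop
    exact (this.tendsto _).eventually (gt_mem_nhds (by simpa using hδ0))
  have hfst : Tendsto Prod.fst (𝓝 (p₀, f₀)) (𝓝 p₀) := continuous_fst.tendsto _
  filter_upwards [h2, hfst.eventually hB,
    hfst.eventually (h1.eventually (gt_mem_nhds (show 0 < ε / 4 by positivity)))] with z hz2 hzB hz1
  obtain ⟨-, hB₀⟩ := hB.self_of_nhds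
  rw [dist_eq_norm]
  have e : compInv z.1 z.2 - compInv p₀ f₀ = compInv z.1 (z.2 - f₀)
      + compInv z.1 (f₀ - Hs.incl hrs.le h)
      + (compInv z.1 (Hs.incl hrs.le h) - compInv p₀ (Hs.incl hrs.le h))
      - compInv p₀ (f₀ - Hs.incl hrs.le h) := by
    rw [compInv_sub hs hr hrs.le hzB.1, compInv_sub hs hr hrs.le hzB.1,
      compInv_sub hs hr hrs.le hp₀]
    abel
  have hBδ : B * δ ≤ ε / 4 := by
    rw [hδ, mul_div_assoc', div_le_div_iff₀ (by positivity) (by norm_num)]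
    nlinarith
  have n1 : ‖compInv z.1 (z.2 - f₀)‖ ≤ B * δ := (hzB.2 _).trans (by gcongr)
  have n2 : ‖compInv z.1 (f₀ - Hs.incl hrs.le h)‖ ≤ B * δ := (hzB.2 _).trans (by gcongr)
  have n3 : ‖compInv p₀ (f₀ - Hs.incl hrs.le h)‖ ≤ B * δ := (hB₀ _).trans (by gcongr)
  rw [e]
  refine (norm_sub_le _ _).trans_lt ?_
  have t1 := norm_add_le (compInv z.1 (z.2 - f₀) + compInv z.1 (f₀ - Hs.incl hrs.le h))
    (compInv z.1 (Hs.incl hrs.le h) - compInv p₀ (Hs.incl hrs.le h))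
  have t2 := norm_add_le (compInv z.1 (z.2 - f₀)) (compInv z.1 (f₀ - Hs.incl hrs.le h))
  linarith

/-- With q = f₀/a₀ one has f/a - f₀/a₀ = ((f - f₀) - q (a - a₀))/a. The numerator tends to zero in
H^(s-1), and division by a is bounded uniformly near p₀. -/
theorem continuousAt_divJacobian {s : ℝ} (hs : 5 / 2 < s) {p₀ : Model s} (hp₀ : p₀ ∈ Ks s)
    (f₀ : Hs (s - 1)) :
    ContinuousAt (fun z : Model s × Hs (s - 1) => divJacobian z.1 z.2) (p₀, f₀) := by
  have hs' : 3 / 2 < s := by linarith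
  have hr : 1 / 2 < s - 1 := by linarith
  obtain ⟨B, hB0, hB⟩ := exists_norm_divJacobian_le hs hr le_rfl hp₀
  set q := divJacobian p₀ f₀ with hq
  have hfst : Tendsto Prod.fst (𝓝 (p₀, f₀)) (𝓝 p₀) := continuous_fst.tendsto _
  rw [ContinuousAt, tendsto_iff_norm_sub_tendsto_zero]
  have hlim : Tendsto (fun z : Model s × Hs (s - 1) =>
      B * ‖(z.2 - f₀) - Hs.mulL hr q (jacobian hs' z.1 - jacobian hs' p₀)‖) (𝓝 (p₀, f₀))
      (𝓝 0) := by
    have hj := continuous_jacobian hs'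
    have : Continuous fun z : Model s × Hs (s - 1) =>
        B * ‖(z.2 - f₀) - Hs.mulL hr q (jacobian hs' z.1 - jacobian hs' p₀)‖ := by fun_prop
    simpa using this.tendsto (p₀, f₀)
  refine squeeze_zero' (Eventually.of_forall fun _ => norm_nonneg _) ?_ hlim
  filter_upwards [hfst.eventually hB] with z hz
  have e : divJacobian z.1 z.2 - q
      = divJacobian z.1 ((z.2 - f₀) - Hs.mulL hr q (jacobian hs' z.1 - jacobian hs' p₀)) := by
    refine Hs.ext fun x => ?_
    have h1 : jacobian hs' z.1 x ≠ 0 := ((mem_Ks_iff hs').1 hz.1 x).ne'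
    have h2 : jacobian hs' p₀ x ≠ 0 := ((mem_Ks_iff hs').1 hp₀ x).ne'
    rw [Hs.sub_apply, divJacobian_coe hs hr le_rfl hz.1, divJacobian_coe hs hr le_rfl hz.1, hq,
      divJacobian_coe hs hr le_rfl hp₀, deriv_lift_eq_jacobian hs', deriv_lift_eq_jacobian hs']
    simp only [Pi.div_apply]
    rw [Hs.sub_apply, Hs.sub_apply, Hs.mulL_apply, Hs.sub_apply, divJacobian_coe hs hr le_rfl hp₀,
      deriv_lift_eq_jacobian hs', Pi.div_apply]
    field_simp
    ring
  rw [e]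
  exact hz.2 _

theorem derivL_compInv {s : ℝ} (hs : 5 / 2 < s) (hs' : 3 / 2 < s) {p : Model s} (hp : p ∈ Ks s)
    (f : Hs s) :
    Hs.derivL hs' (compInv p f) = compInv p (divJacobian p (Hs.derivL hs' f)) := by
  refine Hs.ext fun x => ?_
  rw [Hs.derivL_apply, compInv_coe hs (by linarith) le_rfl hp,
    compInv_coe hs (by linarith) (by linarith) hp,
    divJacobian_coe hs (by linarith) le_rfl hp, deriv_lift_eq_jacobian hs']
  exact ((isCircleDiffeo_lift hs' hp).hasDerivAt_comp (fun y => Hs.hasDerivAt hs' f y) x).deriv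

theorem norm_le_norm_incl_add_norm_derivL {s : ℝ} (hs : 3 / 2 < s) (f : Hs s) :
    ‖f‖ ≤ ‖Hs.incl (sub_one_le s) f‖ + ‖Hs.derivL hs f‖ := by
  have h := energy_le_energy_deriv (r := s) (Hs.hasDerivAt hs f) (Hs.continuous _) f.periodic
  rw [← Hs.incl_apply (sub_one_le s), Hs.energy_eq, Hs.energy_eq, Hs.incl_apply, Hs.energy_eq,
    ← ENNReal.ofReal_add (by positivity) (by positivity),
    ENNReal.ofReal_le_ofReal_iff (by positivity)] at h
  refine le_of_sq_le_sq ?_ (by positivity)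
  nlinarith [mul_nonneg (norm_nonneg (Hs.incl (sub_one_le s) f)) (norm_nonneg (Hs.derivL hs f))]

/-- Composition with the inverse is jointly continuous on `H^r` for `r ≤ s`. -/
theorem continuousAt_compInv {s r : ℝ} (hs : 5 / 2 < s) (hr : 1 / 2 < r) (hrs : r ≤ s)
    {p₀ : Model s} (hp₀ : p₀ ∈ Ks s) (f₀ : Hs r) :
    ContinuousAt (fun z : Model s × Hs r => compInv z.1 z.2) (p₀, f₀) := by
  rcases hrs.lt_or_eq with h | rfl
  · exact continuousAt_compInv_of_lt hs hr h hp₀ f₀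
  -- At the top order the approximation argument is not available, since it gains convergence only
  -- below s. Instead f ∘ φ⁻¹ and its derivative (f'/φ') ∘ φ⁻¹ are both continuous in H^(s-1), and
  -- together they control the H^s norm.
  have hs' : 3 / 2 < r := by linarith
  have hr1 : 1 / 2 < r - 1 := by linarith
  have hKs : ∀ᶠ z : Model r × Hs r in 𝓝 (p₀, f₀), z.1 ∈ Ks r := by
    obtain ⟨B, -, hB⟩ := exists_norm_compInv_le hs hr le_rfl hp₀
    have hfst : Tendsto Prod.fst (𝓝 (p₀, f₀)) (𝓝 p₀) := continuous_fst.tendsto _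
    exact (hfst.eventually hB).mono fun z hz => hz.1
  have c1 : ContinuousAt (fun z : Model r × Hs r => Hs.incl (sub_one_le r) (compInv z.1 z.2))
      (p₀, f₀) := by
    have h1 := continuousAt_compInv_of_lt hs hr1 (by linarith) hp₀ (Hs.incl (sub_one_le r) f₀)
    have h2 : ContinuousAt (fun z : Model r × Hs r => (z.1, Hs.inclL (sub_one_le r) z.2))
        (p₀, f₀) := by fun_prop
    refine (ContinuousAt.comp (x := (p₀, f₀)) (f := fun z : Model r × Hs r =>
      (z.1, Hs.inclL (sub_one_le r) z.2)) h1 h2).congr ?_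
    filter_upwards [hKs] with z hz
    exact compInv_incl hs hr1 (sub_one_le r) hz z.2
  have c2 : ContinuousAt (fun z : Model r × Hs r => Hs.derivL hs' (compInv z.1 z.2))
      (p₀, f₀) := by
    have h1 := continuousAt_compInv_of_lt hs hr1 (by linarith) hp₀
      (divJacobian p₀ (Hs.derivL hs' f₀))
    have h2 := continuousAt_divJacobian hs hp₀ (Hs.derivL hs' f₀)
    have h3 : ContinuousAt (fun z : Model r × Hs r => (z.1, Hs.derivL hs' z.2))
        (p₀, f₀) := by fun_prop
    have h4 : ContinuousAt (fun z : Model r × Hs r => divJacobian z.1 (Hs.derivL hs' z.2))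
        (p₀, f₀) := ContinuousAt.comp (x := (p₀, f₀))
          (f := fun z : Model r × Hs r => (z.1, Hs.derivL hs' z.2)) h2 h3
    refine (ContinuousAt.comp (x := (p₀, f₀)) (f := fun z : Model r × Hs r =>
      (z.1, divJacobian z.1 (Hs.derivL hs' z.2))) h1 (continuousAt_fst.prodMk h4)).congr ?_
    filter_upwards [hKs] with z hz
    exact (derivL_compInv hs hs' hz z.2).symm
  rw [ContinuousAt, tendsto_iff_norm_sub_tendsto_zero] at c1 c2 ⊢
  refine squeeze_zero (fun _ => norm_nonneg _) (fun z => ?_) (by simpa using c1.add c2)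
  rw [← map_sub, ← map_sub]
  exact norm_le_norm_incl_add_norm_derivL hs' _

/-! ### Time derivatives along curves -/

/-- The evaluation map `(f, x) ↦ f(x)` on `H^r × ℝ`, `r > 3/2`, is differentiable. -/
theorem hasFDerivAt_eval {r : ℝ} (hr : 3 / 2 < r) (z₀ : Hs r × ℝ) :
    HasFDerivAt (fun z : Hs r × ℝ => z.1 z.2)
      ((Hs.evalL (by linarith) z₀.2).comp (ContinuousLinearMap.fst ℝ (Hs r) ℝ)
        + (Hs.derivL hr z₀.1 z₀.2) • ContinuousLinearMap.snd ℝ (Hs r) ℝ) z₀ := by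
  set C := Real.sqrt (embConst (r - 1)).toReal * ‖Hs.derivL hr‖ with hC
  have hlip : ∀ (f : Hs r) (a b : ℝ), |f a - f b| ≤ C * ‖f‖ * |a - b| := fun f a b => by
    refine (Hs.abs_sub_le hr f a b).trans ?_
    refine (mul_le_mul_of_nonneg_right (mul_le_mul_of_nonneg_left ((Hs.derivL hr).le_opNorm f)
      (Real.sqrt_nonneg _)) (abs_nonneg _)).trans (le_of_eq ?_)
    rw [hC]
    ring
  -- The increment in x of the difference f - f₀ is quadratic in z - z₀, because the Lipschitz
  -- constant of a function is bounded by its H^r norm.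
  have h1 : (fun z : Hs r × ℝ => (z.1 - z₀.1) z.2 - (z.1 - z₀.1) z₀.2) =o[𝓝 z₀]
      fun z => z - z₀ := by
    have hO : (fun z : Hs r × ℝ => (z.1 - z₀.1) z.2 - (z.1 - z₀.1) z₀.2) =O[𝓝 z₀]
        fun z => ‖z - z₀‖ ^ 2 := by
      refine IsBigO.of_bound C (Eventually.of_forall fun z => ?_)
      rw [Real.norm_eq_abs, Real.norm_eq_abs, abs_of_nonneg (sq_nonneg ‖z - z₀‖)]
      refine (hlip _ _ _).trans ?_
      have e1 : ‖z.1 - z₀.1‖ ≤ ‖z - z₀‖ := norm_fst_le (z - z₀)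
      have e2 : |z.2 - z₀.2| ≤ ‖z - z₀‖ := norm_snd_le (z - z₀)
      rw [sq, mul_assoc]
      gcongr
    refine hO.trans_isLittleO ?_
    have h := isLittleO_pow_sub_sub z₀ (m := 2) (by norm_num)
    exact h
  have h2 : (fun z : Hs r × ℝ => z₀.1 z.2 - z₀.1 z₀.2 - (z.2 - z₀.2) • Hs.derivL hr z₀.1 z₀.2)
      =o[𝓝 z₀] fun z => z - z₀ := by
    have h := (hasDerivAt_iff_isLittleO.1 (Hs.hasDerivAt hr z₀.1 z₀.2)).comp_tendsto
      (continuous_snd.tendsto z₀)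
    refine h.trans_isBigO (IsBigO.of_bound 1 (Eventually.of_forall fun z => ?_))
    rw [one_mul]
    exact norm_snd_le (z - z₀)
  rw [hasFDerivAt_iff_isLittleO]
  refine (h1.add h2).congr_left fun z => ?_
  simp only [add_apply, ContinuousLinearMap.comp_apply,
    smul_apply, ContinuousLinearMap.coe_fst', ContinuousLinearMap.coe_snd',
    Hs.evalL_apply, Hs.sub_apply, Prod.fst_sub, Prod.snd_sub, smul_eq_mul]
  ring

/-- The inverse diffeomorphisms along a differentiable curve are differentiable in time. -/
theorem hasDerivAt_invFun_lift {s : ℝ} (hs : 5 / 2 < s) (hs' : 3 / 2 < s) {γ : ℝ → Model s}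
    {γ' : Model s} {t : ℝ} (hγ : HasDerivAt γ γ' t) (hmem : ∀ᶠ τ in 𝓝 t, γ τ ∈ Ks s) (y : ℝ) :
    HasDerivAt (fun τ => Function.invFun (lift (γ τ)) y)
      (-((γ'.1 : Hs s) (Function.invFun (lift (γ t)) y)
        / jacobian hs' (γ t) (Function.invFun (lift (γ t)) y))) t := by
  have hp₀ := hmem.self_of_nhds
  set x : ℝ → ℝ := fun τ => Function.invFun (lift (γ τ)) y with hx
  have ha : 0 < jacobian hs' (γ t) (x t) := (mem_Ks_iff hs').1 hp₀ _
  have heq : ∀ᶠ τ in 𝓝 t, x τ + ((γ τ).1 : Hs s) (x τ) = y := by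
    filter_upwards [hmem] with τ hτ
    exact (isCircleDiffeo_lift hs' hτ).right_inv y
  have hγO : (fun τ => γ τ - γ t) =O[𝓝 t] fun τ => τ - t := hγ.isBigO_sub
  -- This a priori bound turns errors that are small compared with z τ - z t into errors small
  -- compared with τ - t.
  have hxO : (fun τ => x τ - x t) =O[𝓝 t] fun τ => τ - t := by
    obtain ⟨C, hC0, hC⟩ := exists_abs_invFun_sub_le hs hp₀
    refine IsBigO.trans (IsBigO.of_bound C ?_) hγO
    filter_upwards [hγ.continuousAt.tendsto.eventually hC] with τ hτ
    exact hτ y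
  let F : ℝ → Hs s := fun τ => ((γ τ).1 : Hs s)
  have hF : HasDerivAt F (γ'.1 : Hs s) t :=
    (((H0 s).subtypeL.comp (ContinuousLinearMap.fst ℝ (H0 s) (HsQ (s - 1)))).hasFDerivAt
      |>.comp_hasDerivAt t hγ)
  let z : ℝ → Hs s × ℝ := fun τ => (F τ, x τ)
  have hxc : ContinuousAt x t := by
    have : Tendsto (fun τ => x τ - x t) (𝓝 t) (𝓝 0) := by
      refine hxO.trans_tendsto ?_
      have : Continuous fun τ : ℝ => τ - t := by fun_prop
      simpa using this.tendsto t
    have h := this.add_const (x t)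
    simp only [sub_add_cancel, zero_add] at h
    exact h
  have hz : Tendsto z (𝓝 t) (𝓝 (z t)) := hF.continuousAt.prodMk hxc
  have hzO : (fun τ => z τ - z t) =O[𝓝 t] fun τ => τ - t := hF.isBigO_sub.prod_left hxO
  have h1 := ((hasFDerivAt_iff_isLittleO.1 (hasFDerivAt_eval hs' (z t))).comp_tendsto hz).trans_isBigO
    hzO
  have h2 : (fun τ => F τ (x t) - F t (x t) - (τ - t) * (γ'.1 : Hs s) (x t)) =o[𝓝 t]
      fun τ => τ - t :=
    hasDerivAt_iff_isLittleO.1 ((Hs.evalL (by linarith) (x t)).hasFDerivAt.comp_hasDerivAt t hF)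
  -- Subtracting x + f(x) = y at times t and τ and inserting the two expansions leaves a linear
  -- equation for x τ - x t, whose coefficient is the positive Jacobian.
  have h3 : (fun τ => jacobian hs' (γ t) (x t) * (x τ - x t) + (τ - t) * (γ'.1 : Hs s) (x t))
      =o[𝓝 t] fun τ => τ - t := by
    refine (h1.add h2).neg_left.congr' ?_ EventuallyEq.rfl
    filter_upwards [heq] with τ hτ
    have h0 := heq.self_of_nhds
    simp only [Function.comp_apply, add_apply, ContinuousLinearMap.comp_apply,
      smul_apply, ContinuousLinearMap.coe_fst', ContinuousLinearMap.coe_snd',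
      Hs.evalL_apply, Hs.sub_apply, Prod.fst_sub, Prod.snd_sub, smul_eq_mul, z, F, jacobian_apply]
    linear_combination h0 - hτ
  rw [hasDerivAt_iff_isLittleO]
  refine (h3.const_mul_left (jacobian hs' (γ t) (x t))⁻¹).congr_left fun τ => ?_
  rw [smul_eq_mul, show Function.invFun (lift (γ t)) y = x t from rfl]
  field_simp
  ring

/-- A curve in `H^r`, `r > 1/2`, whose pointwise time derivative is a continuous curve in `H^r`,
is differentiable in `H^r`. -/
theorem Hs.hasDerivAt_of_pointwise {r : ℝ} (hr : 1 / 2 < r) {J : Set ℝ} (hJ : IsOpen J)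
    {w W : ℝ → Hs r} (hW : ContinuousOn W J)
    (h : ∀ t ∈ J, ∀ x, HasDerivAt (fun τ => w τ x) (W t x) t) {t : ℝ} (ht : t ∈ J) :
    HasDerivAt w (W t) t := by
  have := Hs.completeSpace hr
  obtain ⟨δ, hδ, hball⟩ := Metric.isOpen_iff.1 hJ t ht
  have hsub : ∀ τ ∈ Metric.ball t δ, uIcc t τ ⊆ J := fun τ hτ => by
    rw [Real.ball_eq_Ioo] at hτ hball
    have ht' : t ∈ Ioo (t - δ) (t + δ) := ⟨by linarith, by linarith⟩
    exact ((ordConnected_Ioo.uIcc_subset ht' hτ)).trans hball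
  -- Evaluation at x commutes with the integral, so the identity reduces to the scalar fundamental
  -- theorem at each x. The continuity of W then yields the derivative in H^r.
  have hint : ∀ τ ∈ Metric.ball t δ, w τ = w t + ∫ σ in t..τ, W σ := by
    intro τ hτ
    have hi : IntervalIntegrable W volume t τ := (hW.mono (hsub τ hτ)).intervalIntegrable
    refine Hs.ext fun x => ?_
    have e := (Hs.evalL hr x).intervalIntegral_comp_comm hi
    simp only [Hs.evalL_apply] at e
    rw [Hs.add_apply, ← e, intervalIntegral.integral_eq_sub_of_hasDerivAt
      (fun σ hσ => h σ (hsub τ hτ hσ) x)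
      (((Hs.evalL hr x).continuous.comp_continuousOn (hW.mono (hsub τ hτ))).intervalIntegrable)]
    ring
  have hd : HasDerivAt (fun τ => ∫ σ in t..τ, W σ) (W t) t :=
    intervalIntegral.integral_hasDerivAt_right (by simp)
      (hW.stronglyMeasurableAtFilter hJ t ht) (hW.continuousAt (hJ.mem_nhds ht))
  refine (hd.const_add (w t)).congr_of_eventuallyEq ?_
  filter_upwards [Metric.ball_mem_nhds t hδ] with τ hτ
  exact hint τ hτ

/-- The time derivative of `g ∘ φ⁻¹` along a curve. -/
theorem hasDerivAt_compInv_apply {s r : ℝ} (hs : 5 / 2 < s) (hr : 3 / 2 < r) (hrs : r ≤ s)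
    {γ : ℝ → Model s} {γ' : Model s} {t : ℝ} (hγ : HasDerivAt γ γ' t)
    (hmem : ∀ᶠ τ in 𝓝 t, γ τ ∈ Ks s) {g : ℝ → Hs r} {g' : Hs r} (hg : HasDerivAt g g' t) (y : ℝ) :
    HasDerivAt (fun τ => compInv (γ τ) (g τ) y)
      (compInv (γ t) g' y - compInv (γ t) (γ'.1 : Hs s) y
        * Hs.derivL hr (compInv (γ t) (g t)) y) t := by
  have hs' : 3 / 2 < s := by linarith
  have hp₀ := hmem.self_of_nhds
  have hψ := hasDerivAt_invFun_lift hs hs' hγ hmem y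
  have h := (hasFDerivAt_eval hr (g t, Function.invFun (lift (γ t)) y)).comp_hasDerivAt t
    (hg.prodMk hψ)
  have hd : Hs.derivL hr (compInv (γ t) (g t)) y
      = Hs.derivL hr (g t) (Function.invFun (lift (γ t)) y)
        / jacobian hs' (γ t) (Function.invFun (lift (γ t)) y) := by
    rw [Hs.derivL_apply, compInv_coe hs (by linarith) hrs hp₀]
    exact ((isCircleDiffeo_lift hs' hp₀).hasDerivAt_comp (fun x => Hs.hasDerivAt hr (g t) x) y).deriv
  refine (h.congr_of_eventuallyEq ?_).congr_deriv ?_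
  · filter_upwards [hmem] with τ hτ
    rw [compInv_coe hs (by linarith) hrs hτ]
    rfl
  · rw [hd, compInv_coe hs (by linarith) hrs hp₀, compInv_coe hs (by linarith) le_rfl hp₀]
    simp only [add_apply, ContinuousLinearMap.comp_apply,
      smul_apply, ContinuousLinearMap.coe_fst', ContinuousLinearMap.coe_snd',
      Hs.evalL_apply, smul_eq_mul, Function.comp_apply]
    ring

theorem continuousOn_compInv {s r : ℝ} (hs : 5 / 2 < s) (hr : 1 / 2 < r) (hrs : r ≤ s)
    {J : Set ℝ} {γ : ℝ → Model s} (hmem : ∀ t ∈ J, γ t ∈ Ks s) (hγ : ContinuousOn γ J)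
    {g : ℝ → Hs r} (hg : ContinuousOn g J) : ContinuousOn (fun t => compInv (γ t) (g t)) J :=
  fun t ht => (continuousAt_compInv hs hr hrs (hmem t ht) (g t)).comp_continuousWithinAt
    (f := fun t => (γ t, g t)) ((hγ t ht).prodMk (hg t ht))

/-- Along a `C¹` curve in `K^s`, composition of a `C¹` curve in `H^r` with the inverse
diffeomorphisms is `C¹` in `H^q`, `q ≤ r - 1`. -/
theorem exists_hasDerivAt_incl_compInv {s r q : ℝ} (hs : 5 / 2 < s) (hq : 1 / 2 < q)
    (hqr : q ≤ r - 1) (hqr' : q ≤ r) (hrs : r ≤ s) {J : Set ℝ} (hJ : IsOpen J) {γ γ' : ℝ → Model s}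
    (hmem : ∀ t ∈ J, γ t ∈ Ks s) (hγ : ∀ t ∈ J, HasDerivAt γ (γ' t) t) (hγ' : ContinuousOn γ' J)
    {g g' : ℝ → Hs r} (hg : ∀ t ∈ J, HasDerivAt g (g' t) t) (hg' : ContinuousOn g' J) :
    ∃ W : ℝ → Hs q, ContinuousOn W J ∧
      (∀ t ∈ J, HasDerivAt (fun τ => Hs.incl hqr' (compInv (γ τ) (g τ))) (W t) t) ∧
      ∀ t ∈ J, ∀ x, W t x = compInv (γ t) (g' t) x - compInv (γ t) ((γ' t).1 : Hs s) x
        * deriv (compInv (γ t) (g t)) x := by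
  have hr : 3 / 2 < r := by linarith
  have hqs : q ≤ s := by linarith
  have hγc : ContinuousOn γ J := fun t ht => (hγ t ht).continuousAt.continuousWithinAt
  have hgc : ContinuousOn g J := fun t ht => (hg t ht).continuousAt.continuousWithinAt
  have hγ1 : ContinuousOn (fun t => ((γ' t).1 : Hs s)) J :=
    ((H0 s).subtypeL.comp (ContinuousLinearMap.fst ℝ (H0 s) (HsQ (s - 1)))).continuous
      |>.comp_continuousOn hγ'
  have c1 := continuousOn_compInv hs (by linarith) hrs hmem hγc hg'
  have c2 := continuousOn_compInv hs (by linarith) hrs hmem hγc hgc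
  have c3 := continuousOn_compInv hs (by linarith) le_rfl hmem hγc hγ1
  -- The spatial derivative of g ∘ φ⁻¹ is only in H^(r-1): this is the derivative that is lost. The
  -- product is formed in H^q, an algebra because q > 1/2.
  let W : ℝ → Hs q := fun t => Hs.inclL hqr' (compInv (γ t) (g' t))
    - Hs.mulL hq (Hs.inclL hqs (compInv (γ t) ((γ' t).1 : Hs s)))
      (Hs.inclL hqr (Hs.derivL hr (compInv (γ t) (g t))))
  have hW : ContinuousOn W J := by
    have d1 := (Hs.inclL hqr').continuous.comp_continuousOn c1
    have d2 := ((Hs.inclL hqr).comp (Hs.derivL hr)).continuous.comp_continuousOn c2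
    have d3 := ((Hs.mulL hq).comp (Hs.inclL hqs)).continuous.comp_continuousOn c3
    exact d1.sub (d3.clm_apply d2)
  have hWx : ∀ t x, W t x = compInv (γ t) (g' t) x - compInv (γ t) ((γ' t).1 : Hs s) x
      * deriv (compInv (γ t) (g t)) x := fun t x => by
    simp only [W, Hs.sub_apply, Hs.mulL_apply, Hs.inclL_apply, Hs.incl_apply, Hs.derivL_apply]
  refine ⟨W, hW, fun t ht => Hs.hasDerivAt_of_pointwise hq hJ hW (fun τ hτ x => ?_) ht,
    fun t _ => hWx t⟩
  rw [hWx]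
  simp only [Hs.incl_apply]
  exact hasDerivAt_compInv_apply hs hr hrs (hγ τ hτ)
    ((hJ.eventually_mem hτ).mono hmem) (hg τ hτ) x

theorem contDiffOn_one_of_hasDerivAt {E : Type*} [NormedAddCommGroup E] [NormedSpace ℝ E]
    {J : Set ℝ} (hJ : IsOpen J) {f f' : ℝ → E} (h : ∀ t ∈ J, HasDerivAt f (f' t) t)
    (hc : ContinuousOn f' J) : ContDiffOn ℝ 1 f J := by
  rw [show (1 : WithTop ℕ∞) = 0 + 1 by simp, contDiffOn_succ_iff_deriv_of_isOpen hJ]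
  exact ⟨fun t ht => (h t ht).differentiableAt.differentiableWithinAt, by simp,
    contDiffOn_zero.2 (hc.congr fun t ht => (h t ht).deriv)⟩

/-- The difference quotients have the same norm in S as in E; closedness of S plays no role because
the limit is given in S. -/
theorem hasDerivAt_of_coe_submodule {E : Type*} [NormedAddCommGroup E] [NormedSpace ℝ E]
    {S : Submodule ℝ E} {f : ℝ → S} {f' : S} {t : ℝ}
    (h : HasDerivAt (fun τ => (f τ : E)) (f' : E) t) : HasDerivAt f f' t := by
  rw [hasDerivAt_iff_isLittleO, ← Asymptotics.isLittleO_norm_left] at h ⊢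
  exact h

/-! ### The geodesic equation in Eulerian variables -/

theorem meanFree_add_const {f : ℝ → ℝ} (hf : Continuous f) (c : ℝ) :
    meanFree (fun x => f x + c) = meanFree f := by
  funext x
  have := intervalIntegral.integral_add (μ := volume) (hf.intervalIntegrable 0 1)
    (continuous_const (y := c) |>.intervalIntegrable 0 1)
  simp only [meanFree, this]
  simp

/-- The Christoffel map on the diagonal. -/
theorem christoffel_self (φ g α q : ℝ → ℝ) (hq : meanFree (α ∘ Function.invFun φ) = q) :
    christoffel φ (g, α) (g, α) =
      ((fun x => -(1 / 2) * Ainv (deriv fun y => deriv (g ∘ Function.invFun φ) y ^ 2 - q y ^ 2) x)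
          ∘ φ,
        (fun x => -(deriv (g ∘ Function.invFun φ) x * q x)) ∘ φ) := by
  have e : ∀ x : ℝ, -(1 / 2) * (x + x) = -x := fun x => by ring
  simp only [christoffel, christoffelId, hq, ← sq, e]

theorem integral_deriv_eq_zero {r : ℝ} (hr : 3 / 2 < r) (f : Hs r) :
    ∫ x in (0 : ℝ)..1, deriv f x = 0 := by
  rw [intervalIntegral.integral_eq_sub_of_hasDerivAt (f' := deriv f)
    (fun x _ => Hs.hasDerivAt hr f x) ((Hs.derivL hr f).continuous.intervalIntegrable 0 1)]
  have := f.periodic 0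
  rw [zero_add] at this
  rw [this, sub_self]

open Classical in
/-- The Eulerian velocity `φ_t ∘ φ⁻¹`, as an element of `H_0^s`. -/
def velocity {s : ℝ} (p v : Model s) : H0 s :=
  if h : compInv p (v.1 : Hs s) ∈ H0 s then ⟨_, h⟩ else 0

theorem velocity_coe {s : ℝ} (hs : 5 / 2 < s) {p : Model s} (hp : p ∈ Ks s) (v : Model s) :
    (velocity p v : Hs s) = compInv p (v.1 : Hs s) := by
  have h : compInv p (v.1 : Hs s) ∈ H0 s := by
    rw [mem_H0, compInv_coe hs (by linarith) le_rfl hp, Function.comp_apply,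
      (isCircleDiffeo_lift (by linarith) hp).inv_zero]
    exact (mem_H0 _).1 v.1.2
  rw [velocity, dif_pos h]

/-- The Eulerian velocity `[α_t ∘ φ⁻¹]`, as an element of `H^(s-1)/ℝ`. -/
def density {s : ℝ} (p v : Model s) : HsQ (s - 1) :=
  HsQ.mk (compInv p (HsQ.proj (s - 1) v.2))

theorem isVelocity_velocity_density {s : ℝ} (hs : 5 / 2 < s) {J : Set ℝ} {γ : ℝ → Model s}
    (hmem : ∀ t ∈ J, γ t ∈ Ks s) :
    IsVelocity J γ (fun t => velocity (γ t) (deriv γ t)) (fun t => density (γ t) (deriv γ t)) := by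
  intro t ht
  refine ⟨?_, fun αt ρt hα hρ => ?_⟩
  · rw [velocity_coe hs (hmem t ht), compInv_coe hs (by linarith) le_rfl (hmem t ht)]
  · obtain ⟨c, hc⟩ := HsQ.mk_eq_iff.1 hρ
    obtain ⟨d, hd⟩ := HsQ.mk_eq_iff.1 (hα.trans (HsQ.mk_proj _).symm)
    refine ⟨c - d, fun x => ?_⟩
    rw [hc, compInv_coe hs (by linarith) (by linarith) (hmem t ht), Function.comp_apply,
      Function.comp_apply, hd]
    ring

/-- The equivalence of the Lagrangian and the Eulerian equations at a fixed time. Here `g₁`, `g₂`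
represent the velocity and `h₁`, `h₂` the acceleration of the curve, `w₁`, `w₂` the time derivatives
of the Eulerian velocity. -/
theorem lagrangian_iff_eulerian {s : ℝ} (hs : 5 / 2 < s) {p : Model s} (hp : p ∈ Ks s)
    (g₁ h₁ : H0 s) (g₂ h₂ : HsQ (s - 1)) (w₁ w₂ : ℝ → ℝ) (v : Hs s) (R : Hs (s - 1))
    (hv : v = compInv p (g₁ : Hs s)) (hR : R = compInv p (HsQ.proj (s - 1) g₂))
    (hw₁ : ∀ x, w₁ x = compInv p (h₁ : Hs s) x - v x * deriv v x)
    (hw₂ : ∀ x, w₂ x = compInv p (HsQ.proj (s - 1) h₂) x - v x * deriv R x) :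
    (∀ αt αtt : Hs (s - 1), HsQ.mk αt = g₂ → HsQ.mk αtt = h₂ →
      (h₁ : ℝ → ℝ) = (christoffel (lift p) (g₁, αt) (g₁, αt)).1 ∧
        EqModConst αtt (christoffel (lift p) (g₁, αt) (g₁, αt)).2) ↔
    (∀ x, w₁ x + v x * deriv v x = -(1 / 2) * Ainv (deriv fun y =>
        deriv v y ^ 2 - HsQ.proj (s - 1) (HsQ.mk R) y ^ 2) x) ∧
      ∀ x, w₂ x - ∫ y in (0 : ℝ)..1, w₂ y
        = -deriv (fun y => v y * HsQ.proj (s - 1) (HsQ.mk R) y) x := by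
  have hs' : 3 / 2 < s := by linarith
  have hs1 : 1 / 2 < s - 1 := by linarith
  have hs3 : 3 / 2 < s - 1 := by linarith
  have hD := isCircleDiffeo_lift hs' hp
  set q : Hs (s - 1) := HsQ.proj (s - 1) (HsQ.mk R) with hq
  set ψ := Function.invFun (lift p) with hψ
  have hvc : (v : ℝ → ℝ) = (g₁ : ℝ → ℝ) ∘ ψ := by
    rw [hv, compInv_coe hs (by linarith) le_rfl hp]
  have hRc : (R : ℝ → ℝ) = (HsQ.proj (s - 1) g₂ : ℝ → ℝ) ∘ ψ := by
    rw [hR, compInv_coe hs hs1 (by linarith) hp]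
  -- Representatives of one class differ by a constant, which survives composition with ψ and is
  -- removed by the mean-free part.
  have hmf : ∀ αt : Hs (s - 1), HsQ.mk αt = g₂ → meanFree ((αt : ℝ → ℝ) ∘ ψ) = q := by
    intro αt hα
    obtain ⟨c, hc⟩ := HsQ.mk_eq_iff.1 (hα.trans (HsQ.mk_proj _).symm)
    have e : (αt : ℝ → ℝ) ∘ ψ = fun x => R x + c := funext fun x => by
      rw [hRc, Function.comp_apply, Function.comp_apply, hc]
    rw [e, meanFree_add_const R.continuous, hq, HsQ.proj_mk]
  have hchr : ∀ αt : Hs (s - 1), HsQ.mk αt = g₂ →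
      christoffel (lift p) (g₁, αt) (g₁, αt) =
        ((fun x => -(1 / 2) * Ainv (deriv fun y => deriv v y ^ 2 - q y ^ 2) x) ∘ lift p,
          (fun x => -(deriv v x * q x)) ∘ lift p) := fun αt hα => by
    rw [christoffel_self _ _ _ q (hmf αt hα), hvc]
  have hvq : ∀ x, deriv (fun y => v y * q y) x = deriv v x * q x + v x * deriv R x := by
    intro x
    have e : (q : ℝ → ℝ) = fun x => R x - ∫ y in (0 : ℝ)..1, R y := by
      rw [hq, HsQ.proj_mk]; rfl
    have hqd : HasDerivAt q (deriv R x) x := by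
      rw [e]
      exact (Hs.hasDerivAt hs3 R x).sub_const _
    exact ((Hs.hasDerivAt hs' v x).mul hqd).deriv
  set P : Hs (s - 1) := Hs.mulL hs1 (Hs.incl (sub_one_le s) v) q with hP
  have hPc : (P : ℝ → ℝ) = fun y => v y * q y := funext fun y => by
    rw [hP, Hs.mulL_apply, Hs.incl_apply]
  have hPc' : ∀ x, deriv (fun y => v y * q y) x = deriv P x := fun x => by rw [hPc]
  -- The transport term v R_x is part of the derivative of P = v q, as R and q differ by a constant;
  -- what remains besides it is the Christoffel term v_x q.
  have hw₂' : ∀ x, w₂ x = HsQ.proj (s - 1) h₂ (ψ x) + deriv v x * q x - deriv P x := fun x => by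
    rw [hw₂, ← hPc', hvq, compInv_coe hs hs1 (by linarith) hp, Function.comp_apply]
    ring
  constructor
  · intro h
    obtain ⟨h1, c, h2⟩ := h _ _ (HsQ.mk_proj g₂) (HsQ.mk_proj h₂)
    rw [hchr _ (HsQ.mk_proj g₂)] at h1 h2
    refine ⟨fun x => ?_, fun x => ?_⟩
    · rw [hw₁, sub_add_cancel, compInv_coe hs (by linarith) le_rfl hp, ← hψ, h1]
      simp only [Function.comp_apply, hD.right_inv]
    · have e : ∀ x, w₂ x = c - deriv P x := fun x => by
        rw [hw₂', h2 (ψ x)]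
        simp only [Function.comp_apply, hD.right_inv]
        ring
      -- The derivative of the periodic function P has mean zero, so the mean of w₂ is the
      -- undetermined constant c of the Lagrangian equation.
      have hi := intervalIntegral.integral_sub (μ := volume)
        (continuous_const (y := c) |>.intervalIntegrable 0 1)
        ((Hs.derivL hs3 P).continuous.intervalIntegrable 0 1)
      rw [Hs.derivL_apply, integral_deriv_eq_zero hs3] at hi
      simp only [e, hi, hPc']
      simp
  · rintro ⟨h1, h2⟩ αt αtt hα hα'
    rw [hchr αt hα]
    refine ⟨funext fun x => ?_, ?_⟩
    · have := h1 (lift p x)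
      rw [hw₁, sub_add_cancel, compInv_coe hs (by linarith) le_rfl hp, ← hψ, Function.comp_apply,
        hD.left_inv] at this
      exact this
    · obtain ⟨c, hc⟩ := HsQ.mk_eq_iff.1 (hα'.trans (HsQ.mk_proj _).symm)
      -- The constant collects the offset c of the chosen representative and the mean of w₂, about
      -- which the projected equation says nothing.
      refine ⟨c + ∫ y in (0 : ℝ)..1, w₂ y, fun x => ?_⟩
      have := h2 (lift p x)
      rw [hw₂', hPc', hD.left_inv] at this
      rw [hc]
      simp only [Function.comp_apply]
      linarith

/-! ### Derivatives of curves of functions, and the main theorem -/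

/-- Continuous linear maps into topological vector spaces commute with derivatives of curves. -/
theorem deriv_continuousLinearMap_comp {E F : Type*} [NormedAddCommGroup E] [NormedSpace ℝ E]
    [AddCommGroup F] [Module ℝ F] [TopologicalSpace F] [ContinuousAdd F] [ContinuousSMul ℝ F]
    [T2Space F] (T : E →L[ℝ] F) {c : ℝ → E} {c' : E} {t : ℝ} (h : HasDerivAt c c' t) :
    deriv (fun τ => T (c τ)) t = T c' := by
  have h' : HasFDerivAt (fun τ => T (c τ))
      (T.comp (ContinuousLinearMap.toSpanSingleton ℝ c')) t := by
    refine .of_isLittleOTVS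
      ((T.isBigOTVS_fun_comp.trans_isLittleOTVS h.hasFDerivAt.isLittleOTVS).congr_left fun τ => ?_)
    simp
  rw [deriv, h'.fderiv]
  simp

/-- The derivative of a differentiable curve in `H^r`, `r > 1/2`, can be computed in the space of
functions with pointwise convergence. -/
theorem deriv_toFun {r : ℝ} (hr : 1 / 2 < r) {c : ℝ → Hs r} {c' : Hs r} {t : ℝ}
    (h : HasDerivAt c c' t) : deriv (fun τ => (c τ : ℝ → ℝ)) t = c' :=
  let T : Hs r →L[ℝ] (ℝ → ℝ) :=
    { toFun := fun f => f
      map_add' := fun _ _ => rfl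
      map_smul' := fun _ _ => rfl
      cont := continuous_pi fun x => (Hs.evalL hr x).continuous }
  deriv_continuousLinearMap_comp T h

/-- The velocity of a `C²` curve in `K^s` has the stated regularity, and the curve is a geodesic
if and only if its velocity solves the two-component Hunter-Saxton system. -/
theorem isGeodesic_iff_solvesWeakSystem {s : ℝ} (hs : 5 / 2 < s) {J : Set ℝ} (hJ : IsOpen J)
    (γ : ℝ → Model s) (hγ : IsC2Curve J γ) :
    ∃ (u : ℝ → H0 s) (ρ : ℝ → HsQ (s - 1)),
      IsVelocity J γ u ρ ∧
      ContinuousOn u J ∧ ContinuousOn ρ J ∧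
      ContDiffOn ℝ 1 (fun t => H0.incl (sub_one_le s) (u t)) J ∧
      ContDiffOn ℝ 1 (fun t => HsQ.incl (sub_two_le s) (ρ t)) J ∧
      (IsGeodesic J γ ↔ SolvesWeakSystem J u ρ) := by
  have hs1 : 1 / 2 < s - 1 := by linarith
  have hs2 : 1 / 2 < s - 2 := by linarith
  have hmem := hγ.mem
  have h2 := (contDiffOn_succ_iff_deriv_of_isOpen (n := 1) hJ).1
    (by simpa [one_add_one_eq_two] using hγ.contDiffOn)
  have hd1 : ∀ t ∈ J, HasDerivAt γ (deriv γ t) t := fun t ht =>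
    (h2.1.differentiableAt (hJ.mem_nhds ht)).hasDerivAt
  have hd2 : ∀ t ∈ J, HasDerivAt (deriv γ) (deriv (deriv γ) t) t := fun t ht =>
    ((h2.2.2.differentiableOn (by simp)).differentiableAt (hJ.mem_nhds ht)).hasDerivAt
  have hc0 : ContinuousOn γ J := fun t ht => (hd1 t ht).continuousAt.continuousWithinAt
  have hc1 : ContinuousOn (deriv γ) J := fun t ht => (hd2 t ht).continuousAt.continuousWithinAt
  have hc2 : ContinuousOn (deriv (deriv γ)) J := h2.2.2.continuousOn_deriv_of_isOpen hJ (by simp)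
  let L₁ : Model s →L[ℝ] Hs s := (H0 s).subtypeL.comp (ContinuousLinearMap.fst ℝ _ _)
  let L₂ : Model s →L[ℝ] Hs (s - 1) := (HsQ.projL hs1).comp (ContinuousLinearMap.snd ℝ _ _)
  have cu := continuousOn_compInv hs (by linarith) le_rfl hmem hc0
    (L₁.continuous.comp_continuousOn hc1)
  have cρ := continuousOn_compInv hs hs1 (sub_one_le s) hmem hc0
    (L₂.continuous.comp_continuousOn hc1)
  obtain ⟨W₁, hW₁c, hW₁d, hW₁⟩ := exists_hasDerivAt_incl_compInv hs hs1 le_rfl (sub_one_le s)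
    le_rfl hJ hmem hd1 hc1 (g := fun t => L₁ (deriv γ t)) (g' := fun t => L₁ (deriv (deriv γ) t))
    (fun t ht => L₁.hasFDerivAt.comp_hasDerivAt t (hd2 t ht)) (L₁.continuous.comp_continuousOn hc2)
  -- The density starts in H^(s-1) and loses one derivative; s > 5/2 keeps s - 2 above 1/2.
  obtain ⟨W₂, hW₂c, hW₂d, hW₂⟩ := exists_hasDerivAt_incl_compInv hs hs2 (by linarith) (sub_two_le s)
    (sub_one_le s) hJ hmem hd1 hc1 (g := fun t => L₂ (deriv γ t))
    (g' := fun t => L₂ (deriv (deriv γ) t))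
    (fun t ht => L₂.hasFDerivAt.comp_hasDerivAt t (hd2 t ht)) (L₂.continuous.comp_continuousOn hc2)
  have hu : ∀ t ∈ J, (velocity (γ t) (deriv γ t) : Hs s) = compInv (γ t) (L₁ (deriv γ t)) :=
    fun t ht => velocity_coe hs (hmem t ht) _
  -- Both terms of W₁ vanish at 0, because φ⁻¹ fixes 0 and tangent vectors in H_0^s vanish there.
  have hW₁0 : ∀ t ∈ J, W₁ t ∈ H0 (s - 1) := fun t ht => by
    have e : ∀ v : Model s, compInv (γ t) (v.1 : Hs s) 0 = 0 := fun v => by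
      rw [← velocity_coe hs (hmem t ht)]
      exact (mem_H0 _).1 (velocity (γ t) v).2
    rw [mem_H0, hW₁ t ht, e, zero_mul, sub_zero]
    exact e (deriv (deriv γ) t)
  have hu' : ∀ t (ht : t ∈ J), HasDerivAt
      (fun τ => H0.incl (sub_one_le s) (velocity (γ τ) (deriv γ τ))) ⟨W₁ t, hW₁0 t ht⟩ t := by
    intro t ht
    refine hasDerivAt_of_coe_submodule ((hW₁d t ht).congr_of_eventuallyEq ?_)
    filter_upwards [hJ.mem_nhds ht] with τ hτ
    rw [← hu τ hτ]
    rfl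
  have hρ' : ∀ t ∈ J, HasDerivAt (fun τ => HsQ.incl (sub_two_le s) (density (γ τ) (deriv γ τ)))
      (HsQ.mk (W₂ t)) t := fun t ht =>
    (constants (s - 2)).mkQL.hasFDerivAt.comp_hasDerivAt t (hW₂d t ht)
  -- The projection π is linear and continuous and commutes with the inclusions, so π(ρ)_t = π(ρ_t).
  have hq' : ∀ t ∈ J, HasDerivAt
      (fun τ => Hs.incl (sub_two_le s) (HsQ.proj (s - 1) (density (γ τ) (deriv γ τ))))
      (HsQ.proj (s - 2) (HsQ.mk (W₂ t))) t := by
    intro t ht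
    refine ((HsQ.projL hs2).hasFDerivAt.comp_hasDerivAt t (hρ' t ht)).congr_of_eventuallyEq
      (Filter.Eventually.of_forall fun τ => Hs.ext fun x => ?_)
    simp only [density, Function.comp_apply, HsQ.incl_mk, HsQ.projL_apply, HsQ.proj_mk_apply,
      Hs.incl_apply]
  refine ⟨fun t => velocity (γ t) (deriv γ t), fun t => density (γ t) (deriv γ t),
    isVelocity_velocity_density hs hmem, ?_, ?_, ?_, ?_, ?_⟩
  · exact Topology.IsInducing.subtypeVal.continuousOn_iff.2 (cu.congr hu)
  · exact (constants (s - 1)).mkQL.continuous.comp_continuousOn cρ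
  · classical
    -- Membership of W₁ t in `H0 (s - 1)` is known on J only; the value 0 elsewhere has no effect.
    refine contDiffOn_one_of_hasDerivAt hJ
      (f' := fun t => if h : t ∈ J then ⟨W₁ t, hW₁0 t h⟩ else 0)
      (fun t ht => by rw [dif_pos ht]; exact hu' t ht)
      (Topology.IsInducing.subtypeVal.continuousOn_iff.2 (hW₁c.congr fun t ht => ?_))
    simp only [Function.comp_apply, dif_pos ht]
  · exact contDiffOn_one_of_hasDerivAt hJ hρ'
      ((constants (s - 2)).mkQL.continuous.comp_continuousOn hW₂c)
  · refine forall₂_congr fun t ht => ?_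
    have key := lagrangian_iff_eulerian hs (hmem t ht) (deriv γ t).1 (deriv (deriv γ) t).1
      (deriv γ t).2 (deriv (deriv γ) t).2 (W₁ t) (W₂ t) (velocity (γ t) (deriv γ t) : Hs s)
      (compInv (γ t) (L₂ (deriv γ t))) (hu t ht) rfl
      (fun x => by rw [hW₁ t ht, hu t ht]; rfl) (fun x => by rw [hW₂ t ht, hu t ht]; rfl)
    refine key.trans ?_
    -- In `SolvesWeakSystem` the time derivatives appear as derivatives of curves of functions with
    -- pointwise convergence; the derivatives found in H^(s-1) and H^(s-2) agree with them.
    have hut := deriv_toFun hs1 ((H0 (s - 1)).subtypeL.hasFDerivAt.comp_hasDerivAt t (hu' t ht))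
    have hqt := deriv_toFun hs2 (hq' t ht)
    simp only [Function.comp_def, Submodule.subtypeL_apply] at hut
    dsimp only
    rw [hut, hqt]
    simp only [HsQ.proj_mk_apply]
    rfl

end HunterSaxton
end

theorem proposition3p7 (s : ℝ) (hs : 5 / 2 < s) (J : Set ℝ) (hJ : IsOpen J)
    (hJ' : J.OrdConnected) (γ : ℝ → HunterSaxton.Model s) (hγ : HunterSaxton.IsC2Curve J γ) :
    ∃ (u : ℝ → HunterSaxton.H0 s) (ρ : ℝ → HunterSaxton.HsQ (s - 1)),
      HunterSaxton.IsVelocity J γ u ρ ∧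
      ContinuousOn u J ∧ ContinuousOn ρ J ∧
      ContDiffOn ℝ 1 (fun t => HunterSaxton.H0.incl (HunterSaxton.sub_one_le s) (u t)) J ∧
      ContDiffOn ℝ 1 (fun t => HunterSaxton.HsQ.incl (HunterSaxton.sub_two_le s) (ρ t)) J ∧
      (HunterSaxton.IsGeodesic J γ ↔ HunterSaxton.SolvesWeakSystem J u ρ) :=
  HunterSaxton.isGeodesic_iff_solvesWeakSystem hs hJ γ hγ
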